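/- (Weighted endpoint Strichartz.) There is an absolute constant $C$ such that the following holds. Let $I\subset\mathbb{R}$ be an interval, let $t_0\in I$, and let $u_0\in L^2_x(\mathbb{R}^2)$ and $f\in L^{4/3}_{t,x}(I\times\mathbb{R}^2)$ be spherically symmetric (in $x$). Let $e^{it\Delta}$ be the free Schrödinger propagator, that is, the Fourier multiplier with symbol $e^{-it|\xi|^2}$ (for $\hat g(\xi)=(2\pi)^{-1}\int_{\mathbb{R}^2}e^{-ix\cdot\xi}g(x)\,dx$), acting on tempered distributions. Then for every $t\in I$ the formula $$u(t) := e^{i(t-t_0)\Delta}u_0 - i\int_{t_0}^t e^{i(t-t')\Delta}f(t')\,dt'$$ defines an element $u(t)\in L^2_x(\mathbb{R}^2)$, where the integral is understood weakly (it converges absolutely after pairing with any Schwartz function), and $$\bigl\||x|^{1/2}u\bigr\|_{L^4_tL^\infty_x(I\times\mathbb{R}^2)} \le C\Bigl(\|u_0\|_{L^2_x(\mathbb{R}^2)}+\|f\|_{L^{4/3}_{t,x}(I\times\mathbb{R}^2)}\Bigr),$$ where $\|v\|_{L^4_tL^\infty_x(I\times\mathbb{R}^2)}=\bigl(\int_I\|v(t)\|_{L^\infty_x(\mathbb{R}^2)}^4\,dt\bigr)^{1/4}$,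 the integrand being measurable in $t$. -/

import Mathlib

/-!
Averaged over the directions of `y`, the kernel of `e^{itΔ}` becomes a multiple of
`t⁻¹ J₀(|x| |y| / 2t)`, up to unimodular factors. Since `|J₀(r)| ≲ r^{-1/2}`, the operator
`|x|^{1/2} e^{itΔ} |y|^{1/2}` maps `L¹` to `L^∞` with norm `≲ |t|^{-1/2}` on radial functions, and
`TT*` together with the one-dimensional Hardy–Littlewood–Sobolev inequality `L^{4/3} → L⁴` gives
`‖|x|^{1/2} e^{itΔ} g‖_{L⁴_t L^∞_x} ≲ ‖g‖₂` for radial `g`.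

With forcing, `u(t) = e^{itΔ} P(t)`, where the profile `P` moves along a path in the radial part
of `L²`. The dual of the unweighted `L⁴_{t,x}` Strichartz estimate bounds `‖P(t) - P(s)‖₂` by the
power `3/4` of the mass of `|f|^{4/3}` between the times `s` and `t`. Parametrize time by this mass
and approximate `P` by its values at dyadic points: at level `n` the homogeneous estimate applies to
`2ⁿ` increments of size `2^{-3n/4}` which act on disjoint sets of times, so that their `ℓ⁴` sum is
`2^{n/4 - 3n/4}`, and this is summable in `n`.
-/

open MeasureTheory TemperedDistribution
open scoped ENNReal NNReal SchwartzMap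

noncomputable section

namespace WeightedStrichartz

/-- The Euclidean plane `ℝ²`. -/
abbrev Plane : Type := EuclideanSpace ℝ (Fin 2)

instance one_le_four_thirds : Fact ((1 : ℝ≥0∞) ≤ 4 / 3) :=
  ⟨by
    rw [ENNReal.le_div_iff_mul_le (by simp) (by simp)]
    norm_num⟩

/-- The symbol of `e^{itΔ}`. Mathlib's Fourier transform has the kernel `e^{-2πi⟨x,ξ⟩}`, so `Δ` is
the multiplier `-(2π)²|ξ|²` and `e^{itΔ}` is the multiplier `e^{-it(2π|ξ|)²}`. -/
def schrodingerSymbol (t : ℝ) (ξ : Plane) : ℂ :=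
  Complex.exp (-(Complex.I * ((t * (2 * Real.pi * ‖ξ‖) ^ 2 : ℝ) : ℂ)))

/-- The symbol is smooth of temperate growth, so that the Fourier multiplier below is the
genuine one (Mathlib gives it the value `0` for other symbols). -/
theorem schrodingerSymbol_hasTemperateGrowth (t : ℝ) :
    (schrodingerSymbol t).HasTemperateGrowth := by
  have key : (fun s : ℝ => Complex.exp (-(Complex.I * (s : ℂ)))).HasTemperateGrowth := by
    have hd : ∀ n : ℕ, iteratedDeriv n (fun s : ℝ => Complex.exp (-(Complex.I * (s : ℂ)))) =
        fun s : ℝ => (-Complex.I) ^ n * Complex.exp (-(Complex.I * (s : ℂ))) := by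
      intro n
      induction n with
      | zero => simp
      | succ n ih =>
        rw [iteratedDeriv_succ, ih]
        funext s
        have h1 : HasDerivAt (fun s : ℝ => -(Complex.I * (s : ℂ))) (-(Complex.I * 1)) s :=
          ((Complex.ofRealCLM.hasDerivAt (x := s)).const_mul Complex.I).neg
        have h2 := (h1.cexp).const_mul ((-Complex.I) ^ n)
        rw [h2.deriv]
        ring
    refine ⟨?_, fun n => ⟨0, 1, fun s => ?_⟩⟩
    · exact ContDiff.cexp (contDiff_const.mul Complex.ofRealCLM.contDiff).neg
    · rw [norm_iteratedFDeriv_eq_norm_iteratedDeriv, hd n]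
      simp [Complex.norm_exp]
  have hq : (fun ξ : Plane => t * (2 * Real.pi * ‖ξ‖) ^ 2).HasTemperateGrowth := by
    have : (fun ξ : Plane => t * (2 * Real.pi * ‖ξ‖) ^ 2) =
        fun ξ : Plane => (t * (2 * Real.pi) ^ 2) * ‖ξ‖ ^ 2 := by
      funext ξ
      ring
    rw [this]
    fun_prop
  exact key.comp hq

/-- The free Schrödinger propagator `e^{itΔ}`, acting on tempered distributions (in particular on
all `L^p` functions) as the Fourier multiplier with symbol `e^{-it|ξ|²}` (frequencies in the
normalization `∫ e^{-i⟨x,ξ⟩} f(x) dx`). -/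
def propagator (t : ℝ) : 𝓢'(Plane, ℂ) →L[ℂ] 𝓢'(Plane, ℂ) :=
  fourierMultiplierCLM ℂ (schrodingerSymbol t)

open Classical in
/-- A function `g ∈ L^{4/3}(ℝ²)` as the tempered distribution `φ ↦ ∫ φ g`. The value for other `g`
plays no role: almost every time slice of a function in `L^{4/3}_{t,x}` is in `L^{4/3}_x`. -/
def sliceDistribution (g : Plane → ℂ) : 𝓢'(Plane, ℂ) :=
  if hg : MemLp g (4 / 3) volume then Lp.toTemperedDistribution (hg.toLp g) else 0

/-- Spherical symmetry of a function on the plane that is defined up to null sets. -/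
def IsRadial (g : Plane → ℂ) : Prop :=
  ∃ h : ℝ → ℂ, g =ᵐ[volume] fun x => h ‖x‖

/-- `u(t) = e^{i(t-t₀)Δ} u₀ - i ∫_{t₀}^t e^{i(t-s)Δ} f(s) ds` for all `t ∈ I`, where `u(t) ∈ L²` and
the time integral is a weak one: it converges absolutely when tested against any Schwartz
function. -/
def IsDuhamel (I : Set ℝ) (t₀ : ℝ) (u₀ : Lp ℂ 2 (volume : Measure Plane))
    (f : ℝ → Plane → ℂ) (u : ℝ → Lp ℂ 2 (volume : Measure Plane)) : Prop :=
  ∀ t ∈ I, ∀ φ : 𝓢(Plane, ℂ),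
    IntervalIntegrable (fun s => propagator (t - s) (sliceDistribution (f s)) φ) volume t₀ t ∧
    Lp.toTemperedDistribution (u t) φ =
      propagator (t - t₀) (Lp.toTemperedDistribution u₀) φ -
        Complex.I * ∫ s in t₀..t, propagator (t - s) (sliceDistribution (f s)) φ

/-- The mixed norm `‖u‖_{L^q_t L^r_x(I × ℝ²)}`. -/
def mixedNorm (q r : ℝ≥0∞) (I : Set ℝ) (u : ℝ → Plane → ℂ) : ℝ≥0∞ :=
  eLpNorm (fun t => eLpNorm (u t) r volume) q (volume.restrict I)

/-- The function `|x|^{1/2} u(t, x)`. -/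
def weighted (u : ℝ → Lp ℂ 2 (volume : Measure Plane)) (t : ℝ) (x : Plane) : ℂ :=
  ((‖x‖ ^ (1 / 2 : ℝ) : ℝ) : ℂ) * u t x

end WeightedStrichartz

end

noncomputable section

namespace WeightedStrichartz

open FourierTransform

section FractionalIntegration

theorem lintegral_comp_abs (g : ℝ → ℝ≥0∞) :
    ∫⁻ τ : ℝ, g |τ| = 2 * ∫⁻ τ in Set.Ioi 0, g τ := by
  have pos_half : ∫⁻ τ in Set.Ioi (0 : ℝ), g |τ| = ∫⁻ τ in Set.Ioi 0, g τ :=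
    setLIntegral_congr_fun measurableSet_Ioi fun τ hτ => by rw [abs_of_pos hτ]
  have neg_half : ∫⁻ τ in Set.Iic (0 : ℝ), g |τ| = ∫⁻ τ in Set.Ioi 0, g τ := by
    rw [← pos_half, ← setLIntegral_congr (Iio_ae_eq_Iic (a := (0 : ℝ))),
      ← (Measure.measurePreserving_neg (volume : Measure ℝ)).setLIntegral_comp_preimage_emb
        (MeasurableEquiv.neg ℝ).measurableEmbedding]
    simp
  rw [← lintegral_add_compl _ (measurableSet_Ioi (a := (0 : ℝ))), Set.compl_Ioi, pos_half,
    neg_half, two_mul]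

theorem lintegral_ball_enorm_rpow_neg {α R : ℝ} (hα : α < 1) (hR : 0 < R) :
    ∫⁻ τ in Metric.ball (0 : ℝ) R, ‖τ‖ₑ ^ (-α) = ENNReal.ofReal (2 / (1 - α) * R ^ (1 - α)) := by
  have radial : ∀ τ : ℝ, (Metric.ball (0 : ℝ) R).indicator (fun τ => ‖τ‖ₑ ^ (-α)) τ =
      (Set.Iio R).indicator (fun r : ℝ => ‖r‖ₑ ^ (-α)) |τ| := fun τ => by
    classical simp [Set.indicator_apply]
  rw [← lintegral_indicator measurableSet_ball, lintegral_congr radial, lintegral_comp_abs,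
    setLIntegral_indicator measurableSet_Iio, Set.Iio_inter_Ioi,
    setLIntegral_congr_fun (g := fun τ => ENNReal.ofReal (τ ^ (-α))) measurableSet_Ioo
      fun τ hτ => by rw [Real.enorm_of_nonneg hτ.1.le, ENNReal.ofReal_rpow_of_pos hτ.1],
    setLIntegral_congr Ioo_ae_eq_Ioc, ← ofReal_integral_eq_lintegral_ofReal,
    ← intervalIntegral.integral_of_le hR.le, integral_rpow (Or.inl (by linarith)),
    ← ENNReal.ofReal_ofNat, ← ENNReal.ofReal_mul (by norm_num), neg_add_eq_sub,
    Real.zero_rpow (by linarith)]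
  · congr 1
    ring
  · exact (intervalIntegrable_iff_integrableOn_Ioc_of_le hR.le).1
      (intervalIntegral.intervalIntegrable_rpow' (by linarith))
  · filter_upwards [ae_restrict_mem measurableSet_Ioc] with τ hτ
    exact Real.rpow_nonneg hτ.1.le _

theorem lintegral_compl_ball_enorm_rpow_neg {β R : ℝ} (hβ : 1 < β) (hR : 0 < R) :
    ∫⁻ τ in (Metric.ball (0 : ℝ) R)ᶜ, ‖τ‖ₑ ^ (-β) =
      ENNReal.ofReal (2 / (β - 1) * R ^ (1 - β)) := by
  have radial : ∀ τ : ℝ, (Metric.ball (0 : ℝ) R)ᶜ.indicator (fun τ => ‖τ‖ₑ ^ (-β)) τ =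
      (Set.Ici R).indicator (fun r : ℝ => ‖r‖ₑ ^ (-β)) |τ| := fun τ => by
    classical simp [Set.indicator_apply]
  have pos_of_mem : ∀ τ ∈ Set.Ioi R, 0 < τ := fun τ hτ => hR.trans hτ
  rw [← lintegral_indicator measurableSet_ball.compl, lintegral_congr radial, lintegral_comp_abs,
    setLIntegral_indicator measurableSet_Ici,
    Set.inter_eq_left.2 (show Set.Ici R ⊆ Set.Ioi 0 from fun x hx => hR.trans_le hx),
    ← setLIntegral_congr Ioi_ae_eq_Ici,
    setLIntegral_congr_fun (g := fun τ => ENNReal.ofReal (τ ^ (-β))) measurableSet_Ioi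
      fun τ hτ => by
        rw [Real.enorm_of_nonneg (pos_of_mem τ hτ).le,
          ENNReal.ofReal_rpow_of_pos (pos_of_mem τ hτ)],
    ← ofReal_integral_eq_lintegral_ofReal, integral_Ioi_rpow_of_lt (by linarith) hR,
    ← ENNReal.ofReal_ofNat, ← ENNReal.ofReal_mul (by norm_num), neg_add_eq_sub]
  · congr 1
    rw [← neg_sub β 1, div_neg, neg_div, neg_neg]
    ring
  · exact integrableOn_Ioi_rpow_of_lt (by linarith) hR
  · filter_upwards [ae_restrict_mem measurableSet_Ioi] with τ hτ
    exact Real.rpow_nonneg (pos_of_mem τ hτ).le _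

variable {p q : ℝ} {w : ℝ → ℝ≥0∞}

theorem lintegral_riesz_mul_min_le_add (hpq : p.HolderConjugate q) (hq : 2 < q)
    (hw : Measurable w) (a : ℝ≥0∞) (t : ℝ) {R : ℝ} (hR : 0 < R) :
    ∫⁻ s, ‖t - s‖ₑ ^ (-(2 / q)) * min (w s) a ≤
      ENNReal.ofReal (2 / (1 - 2 / q) * R ^ (1 - 2 / q)) * a +
        ENNReal.ofReal (2 * R⁻¹) ^ (1 / q) * (∫⁻ s, w s ^ p) ^ (1 / p) := by
  have hα : 2 / q < 1 := (div_lt_one (by linarith)).2 hq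
  rw [← lintegral_sub_left_eq_self _ t]
  simp only [sub_sub_cancel]
  rw [← lintegral_add_compl _ (measurableSet_ball (x := (0 : ℝ)) (ε := R))]
  gcongr ?_ + ?_
  · calc _ ≤ ∫⁻ τ in Metric.ball (0 : ℝ) R, ‖τ‖ₑ ^ (-(2 / q)) * a := by
          gcongr; exact min_le_right _ _
      _ = _ := by rw [lintegral_mul_const _ (by fun_prop), lintegral_ball_enorm_rpow_neg hα hR]
  · have kernel_rpow : ∀ τ : ℝ, (‖τ‖ₑ ^ (-(2 / q))) ^ q = ‖τ‖ₑ ^ (-2 : ℝ) := fun τ => by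
      rw [← ENNReal.rpow_mul, neg_mul, div_mul_cancel₀ _ (by linarith)]
    calc _ ≤ ∫⁻ τ in (Metric.ball (0 : ℝ) R)ᶜ,
            ((fun τ : ℝ => ‖τ‖ₑ ^ (-(2 / q))) * fun τ => w (t - τ)) τ := by
          simp only [Pi.mul_apply]
          gcongr; exact min_le_left _ _
      _ ≤ (∫⁻ τ in (Metric.ball (0 : ℝ) R)ᶜ, (‖τ‖ₑ ^ (-(2 / q))) ^ q) ^ (1 / q) *
          (∫⁻ τ in (Metric.ball (0 : ℝ) R)ᶜ, w (t - τ) ^ p) ^ (1 / p) :=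
        ENNReal.lintegral_mul_le_Lp_mul_Lq _ hpq.symm (by fun_prop)
          (hw.comp (by fun_prop)).aemeasurable
      _ ≤ (∫⁻ τ in (Metric.ball (0 : ℝ) R)ᶜ, ‖τ‖ₑ ^ (-2 : ℝ)) ^ (1 / q) *
          (∫⁻ τ, w (t - τ) ^ p) ^ (1 / p) := by
        simp only [kernel_rpow]
        have := hpq.nonneg
        gcongr
        exact Measure.restrict_le_self
      _ = _ := by
        rw [lintegral_compl_ball_enorm_rpow_neg one_lt_two hR,
          lintegral_sub_left_eq_self (fun s => w s ^ p) t]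
        norm_num [Real.rpow_neg_one]

/-- Constant in the one-dimensional Hardy–Littlewood–Sobolev inequality with kernel
`|t - s| ^ (-2/q)`. -/
def hlsConst (q : ℝ) : ℝ≥0 := Real.toNNReal (8 * (q - 1) / (q - 2))

theorem two_mul_add_two_eq_hlsConst (hq : 2 < q) :
    2 * (2 / (1 - 2 / q) + 2) = (hlsConst q : ℝ) := by
  have : q - 2 ≠ 0 := by linarith
  rw [hlsConst, Real.coe_toNNReal _ (div_nonneg (by linarith) (by linarith))]
  field_simp
  ring

theorem two_mul_split_at_balanced_radius_le (hpq : p.HolderConjugate q) (hq : 2 < q) {a I : ℝ}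
    (ha : 0 < a) (hI : 0 < I) :
    2 * (2 / (1 - 2 / q) * (I * a ^ (-p)) ^ (1 - 2 / q) * a +
        (2 * (I * a ^ (-p))⁻¹) ^ (1 / q) * I ^ (1 / p)) ≤
      hlsConst q * I ^ (1 - 2 / q) * a ^ (p - 1) := by
  have hpq' := hpq.inv_add_inv_eq_one
  have hpq'' : p * q⁻¹ = p - 1 := by
    linear_combination p * hpq' - mul_inv_cancel₀ hpq.ne_zero
  have : 0 < 1 - 2 / q := sub_pos.2 ((div_lt_one (by linarith)).2 hq)
  have near : (I * a ^ (-p)) ^ (1 - 2 / q) * a = I ^ (1 - 2 / q) * a ^ (p - 1) := by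
    rw [Real.mul_rpow hI.le (by positivity), ← Real.rpow_mul ha.le, mul_assoc,
      ← Real.rpow_add_one ha.ne']
    congr 2
    linear_combination 2 * hpq''
  have far : (2 * (I * a ^ (-p))⁻¹) ^ (1 / q) * I ^ (1 / p) ≤
      2 * (I ^ (1 - 2 / q) * a ^ (p - 1)) := by
    calc _ = 2 ^ (1 / q) * ((I ^ (-(1 / q)) * I ^ (1 / p)) * a ^ (p * q⁻¹)) := by
          rw [Real.mul_rpow (by norm_num) (by positivity), mul_inv, Real.rpow_neg ha.le, inv_inv,
            Real.mul_rpow (by positivity) (by positivity), ← Real.rpow_mul ha.le,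
            Real.inv_rpow hI.le, ← Real.rpow_neg hI.le, one_div q]
          ring
      _ = 2 ^ (1 / q) * (I ^ (1 - 2 / q) * a ^ (p - 1)) := by
          rw [← Real.rpow_add hI, hpq'']
          congr 3
          linear_combination hpq'
      _ ≤ _ := by
          gcongr
          exact Real.rpow_le_self_of_one_le one_le_two
            ((div_le_one (by linarith)).2 (by linarith))
  calc _ = 2 * (2 / (1 - 2 / q) * ((I * a ^ (-p)) ^ (1 - 2 / q) * a) +
        (2 * (I * a ^ (-p))⁻¹) ^ (1 / q) * I ^ (1 / p)) := by ring
    _ ≤ 2 * (2 / (1 - 2 / q) * (I ^ (1 - 2 / q) * a ^ (p - 1)) +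
        2 * (I ^ (1 - 2 / q) * a ^ (p - 1))) := by rw [near]; gcongr
    _ = 2 * (2 / (1 - 2 / q) + 2) * (I ^ (1 - 2 / q) * a ^ (p - 1)) := by ring
    _ = _ := by rw [two_mul_add_two_eq_hlsConst hq, mul_assoc]

-- The radius `R = I / a ^ p` balances the contributions of `|t - s| < R` and `|t - s| ≥ R`.
theorem two_mul_lintegral_riesz_mul_min_le_of_pos (hpq : p.HolderConjugate q) (hq : 2 < q)
    (hw : Measurable w) {a I : ℝ≥0} (ha : 0 < a) (hI : 0 < I) (hwI : ∫⁻ s, w s ^ p = I) (t : ℝ) :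
    2 * ∫⁻ s, ‖t - s‖ₑ ^ (-(2 / q)) * min (w s) a ≤
      hlsConst q * (I : ℝ≥0∞) ^ (1 - 2 / q) * (a : ℝ≥0∞) ^ (p - 1) := by
  have hα : 0 < 1 - 2 / q := sub_pos.2 ((div_lt_one (by linarith)).2 hq)
  have ha : 0 < (a : ℝ) := ha
  have hI : 0 < (I : ℝ) := hI
  calc _ ≤ 2 * (ENNReal.ofReal (2 / (1 - 2 / q) * (I * a ^ (-p) : ℝ) ^ (1 - 2 / q)) * a +
        ENNReal.ofReal (2 * (I * a ^ (-p) : ℝ)⁻¹) ^ (1 / q) * (I : ℝ≥0∞) ^ (1 / p)) := by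
        rw [← hwI]
        gcongr
        exact lintegral_riesz_mul_min_le_add hpq hq hw a t (by positivity)
    _ ≤ _ := by
      rw [← ENNReal.ofReal_coe_nnreal, ← ENNReal.ofReal_coe_nnreal, ← ENNReal.ofReal_coe_nnreal,
        ← ENNReal.ofReal_ofNat, ENNReal.ofReal_rpow_of_pos hI, ENNReal.ofReal_rpow_of_pos hI,
        ENNReal.ofReal_rpow_of_pos ha, ENNReal.ofReal_rpow_of_pos (by positivity),
        ← ENNReal.ofReal_mul (by positivity), ← ENNReal.ofReal_mul (by positivity),
        ← ENNReal.ofReal_add (by positivity) (by positivity), ← ENNReal.ofReal_mul (by positivity),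
        ← ENNReal.ofReal_mul (by positivity), ← ENNReal.ofReal_mul (by positivity)]
      exact ENNReal.ofReal_le_ofReal (two_mul_split_at_balanced_radius_le hpq hq ha hI)

theorem two_mul_lintegral_riesz_mul_min_le (hpq : p.HolderConjugate q) (hq : 2 < q)
    (hw : Measurable w) (a : ℝ≥0∞) (t : ℝ) :
    2 * ∫⁻ s, ‖t - s‖ₑ ^ (-(2 / q)) * min (w s) a ≤
      hlsConst q * (∫⁻ s, w s ^ p) ^ (1 - 2 / q) * a ^ (p - 1) := by
  have hα : 0 < 1 - 2 / q := sub_pos.2 ((div_lt_one (by linarith)).2 hq)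
  have hc : hlsConst q ≠ 0 := by
    rw [← NNReal.coe_ne_zero, ← two_mul_add_two_eq_hlsConst hq]
    positivity
  rcases eq_or_ne a 0 with rfl | ha0
  · simp
  rcases eq_or_ne (∫⁻ s, w s ^ p) 0 with hW0 | hW0
  · have integrand_zero : (fun s => ‖t - s‖ₑ ^ (-(2 / q)) * min (w s) a) =ᵐ[volume] 0 := by
      filter_upwards [(lintegral_eq_zero_iff (by fun_prop)).1 hW0] with s hs
      simp [(ENNReal.rpow_eq_zero_iff_of_pos hpq.pos).1 hs]
    simp [lintegral_congr_ae integrand_zero]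
  rcases eq_or_ne (∫⁻ s, w s ^ p) ∞ with hW | hW
  · rw [hW, ENNReal.top_rpow_of_pos hα, ENNReal.mul_top (by simpa using hc), ENNReal.top_mul]
    · exact le_top
    · simp [ha0, hpq.lt.le]
  rcases eq_or_ne a ∞ with rfl | ha
  · rw [ENNReal.top_rpow_of_pos hpq.sub_one_pos, ENNReal.mul_top]
    · exact le_top
    · simp [hc, hW0, hW]
  lift a to ℝ≥0 using ha
  have hI := ENNReal.coe_toNNReal hW
  rw [← hI]
  exact two_mul_lintegral_riesz_mul_min_le_of_pos hpq hq hw (pos_iff_ne_zero.2 (by simpa using ha0))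
    (ENNReal.toNNReal_pos hW0 hW) hI.symm t

theorem lintegral_lintegral_riesz_mul_min_le (hpq : p.HolderConjugate q) (hq : 2 < q)
    (hw : Measurable w) :
    2 * ∫⁻ t, ∫⁻ s, w t * (‖t - s‖ₑ ^ (-(2 / q)) * min (w s) (w t)) ≤
      hlsConst q * (∫⁻ s, w s ^ p) ^ (2 / p) := by
  have hp := hpq.sub_one_pos
  have hα : 0 < 1 - 2 / q := sub_pos.2 ((div_lt_one (by linarith)).2 hq)
  have exponent : 2 / p = 1 - 2 / q + 1 := by
    linear_combination 2 * hpq.inv_add_inv_eq_one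
  rw [← lintegral_const_mul _ (by fun_prop), exponent,
    ENNReal.rpow_add_of_nonneg _ _ hα.le zero_le_one, ENNReal.rpow_one, ← mul_assoc,
    ← lintegral_const_mul _ (by fun_prop)]
  refine lintegral_mono fun t => ?_
  calc _ = w t * (2 * ∫⁻ s, ‖t - s‖ₑ ^ (-(2 / q)) * min (w s) (w t)) := by
        rw [lintegral_const_mul _ (by fun_prop), mul_left_comm]
    _ ≤ w t * (hlsConst q * (∫⁻ s, w s ^ p) ^ (1 - 2 / q) * w t ^ (p - 1)) := by
        gcongr w t * ?_
        exact two_mul_lintegral_riesz_mul_min_le hpq hq hw _ t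
    _ = hlsConst q * (∫⁻ s, w s ^ p) ^ (1 - 2 / q) * (w t ^ (1 : ℝ) * w t ^ (p - 1)) := by
        rw [ENNReal.rpow_one]; ring
    _ = _ := by
        rw [← ENNReal.rpow_add_of_nonneg _ _ zero_le_one hp.le, add_sub_cancel]

theorem lintegral_lintegral_mul_mul_riesz_le (hpq : p.HolderConjugate q) (hq : 2 < q)
    (hw : Measurable w) :
    ∫⁻ t, ∫⁻ s, w t * w s * ‖t - s‖ₑ ^ (-(2 / q)) ≤
      hlsConst q * (∫⁻ s, w s ^ p) ^ (2 / p) := by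
  set k : ℝ → ℝ → ℝ≥0∞ := fun t s => w t * (‖t - s‖ₑ ^ (-(2 / q)) * min (w s) (w t)) with hk
  have hkm : Measurable (Function.uncurry k) := by
    simp only [hk, Function.uncurry_def]
    fun_prop
  have symmetrize : ∀ t s, w t * w s * ‖t - s‖ₑ ^ (-(2 / q)) ≤ k t s + k s t := fun t s => by
    simp only [hk, ← neg_sub t s, enorm_neg]
    rcases le_total (w s) (w t) with h | h <;> rw [min_eq_left h]
    · exact le_add_right (by ring_nf; rfl)
    · exact le_add_left (by ring_nf; rfl)
  calc _ ≤ ∫⁻ t, ∫⁻ s, (k t s + k s t) :=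
        lintegral_mono fun t => lintegral_mono fun s => symmetrize t s
    _ = (∫⁻ t, ∫⁻ s, k t s) + ∫⁻ t, ∫⁻ s, k s t := by
      rw [← lintegral_add_left hkm.lintegral_prod_right]
      exact lintegral_congr fun t => lintegral_add_left (hkm.comp measurable_prodMk_left) _
    _ = 2 * ∫⁻ t, ∫⁻ s, k t s := by
      rw [lintegral_lintegral_swap (f := fun t s => k s t) (hkm.comp measurable_swap).aemeasurable,
        two_mul]
    _ ≤ _ := lintegral_lintegral_riesz_mul_min_le hpq hq hw

end FractionalIntegration

section TTStar

variable {𝕜 H : Type*} [RCLike 𝕜] [NormedAddCommGroup H] [InnerProductSpace 𝕜 H]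

theorem exists_measurable_argmax {α β : Type*} [MeasurableSpace α] [LinearOrder β]
    [TopologicalSpace β] [OrderClosedTopology β] [SecondCountableTopology β] [MeasurableSpace β]
    [OpensMeasurableSpace β] {f : ℕ → α → β} (hf : ∀ n, Measurable (f n)) (N : ℕ) :
    ∃ ν : α → ℕ, Measurable ν ∧ ∀ t, ∀ n ≤ N, f n t ≤ f (ν t) t := by
  classical
  have attained : ∀ t, ∃ m, ∀ n ≤ N, f n t ≤ f m t := fun t => by
    obtain ⟨m, -, hm⟩ := (Finset.range (N + 1)).exists_max_image (f · t) ⟨0, by simp⟩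
    exact ⟨m, fun n hn => hm n (by simpa [Nat.lt_succ_iff] using hn)⟩
  refine ⟨fun t => Nat.find (attained t), measurable_find attained fun m => ?_,
    fun t => Nat.find_spec (attained t)⟩
  simp only [Set.ofPred_forall]
  exact .iInter fun n => .iInter fun _ => measurableSet_le (hf n) (hf m)

theorem enorm_integral_sq_le_lintegral_inner [NormedSpace ℝ H] [CompleteSpace H] {α : Type*}
    [MeasurableSpace α] {μ : Measure α} {G : α → H} (hG : Integrable G μ) :
    ‖∫ t, G t ∂μ‖ₑ ^ 2 ≤ ∫⁻ t, ∫⁻ s, ‖inner 𝕜 (G t) (G s)‖ₑ ∂μ ∂μ := by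
  calc ‖∫ t, G t ∂μ‖ₑ ^ 2 = ‖∫ t, inner 𝕜 (∫ s, G s ∂μ) (G t) ∂μ‖ₑ := by
        rw [integral_inner hG, inner_self_eq_norm_sq_to_K, ← ofReal_norm, ← ofReal_norm,
          ← ENNReal.ofReal_pow (norm_nonneg _)]
        simp
    _ ≤ ∫⁻ t, ‖inner 𝕜 (∫ s, G s ∂μ) (G t)‖ₑ ∂μ := enorm_integral_le_lintegral_enorm _
    _ ≤ _ := lintegral_mono fun t => by
        rw [← inner_conj_symm, RCLike.enorm_conj, ← integral_inner hG]
        exact enorm_integral_le_lintegral_enorm _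

variable {p q : ℝ} {C : ℝ≥0∞}

theorem enorm_integral_sq_le_of_enorm_inner_le [NormedSpace ℝ H] [CompleteSpace H]
    (hpq : p.HolderConjugate q) (hq : 2 < q)
    {G : ℝ → H} (hG : Integrable G) {w : ℝ → ℝ≥0∞} (hw : Measurable w)
    (hC : ∀ t s, ‖inner 𝕜 (G t) (G s)‖ₑ ≤ C * (w t * w s * ‖t - s‖ₑ ^ (-(2 / q)))) :
    ‖∫ t, G t‖ₑ ^ 2 ≤ C * (hlsConst q * (∫⁻ s, w s ^ p) ^ (2 / p)) := by
  calc _ ≤ ∫⁻ t, ∫⁻ s, C * (w t * w s * ‖t - s‖ₑ ^ (-(2 / q))) :=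
        (enorm_integral_sq_le_lintegral_inner (𝕜 := 𝕜) hG).trans
          (lintegral_mono fun t => lintegral_mono fun s => hC t s)
    _ = C * ∫⁻ t, ∫⁻ s, w t * w s * ‖t - s‖ₑ ^ (-(2 / q)) := by
        rw [← lintegral_const_mul _ (by fun_prop)]
        exact lintegral_congr fun t => lintegral_const_mul _ (by fun_prop)
    _ ≤ _ := by gcongr; exact lintegral_lintegral_mul_mul_riesz_le hpq hq hw

variable (𝕜) in
/-- The vector `|⟨γ, h⟩| ^ (q - 2) ⟨γ, h⟩ γ`, whose inner product with `h` is `|⟨γ, h⟩| ^ q`; it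
dualizes the `L^q` norm of `t ↦ ⟨γ t, h⟩`. -/
def dualizer (q : ℝ) (h γ : H) : H :=
  (((‖inner 𝕜 γ h‖ ^ (q - 2) : ℝ) : 𝕜) * inner 𝕜 γ h) • γ

theorem enorm_dualizer_coeff (hq : 2 ≤ q) (h γ : H) :
    ‖((‖inner 𝕜 γ h‖ ^ (q - 2) : ℝ) : 𝕜) * inner 𝕜 γ h‖ₑ = ‖inner 𝕜 γ h‖ₑ ^ (q - 1) := by
  have : q - 1 = q - 2 + 1 := by ring
  rw [this, ENNReal.rpow_add_of_nonneg _ _ (by linarith) zero_le_one, ENNReal.rpow_one, enorm_mul,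
    ← ofReal_norm, RCLike.norm_ofReal, abs_of_nonneg (by positivity),
    ← ENNReal.ofReal_rpow_of_nonneg (norm_nonneg _) (by linarith), ofReal_norm]

theorem inner_dualizer (hq : 2 ≤ q) (h γ : H) :
    inner 𝕜 h (dualizer 𝕜 q h γ) = ((‖inner 𝕜 γ h‖ ^ q : ℝ) : 𝕜) := by
  have : q = q - 2 + (2 : ℕ) := by push_cast; ring
  nth_rw 2 [this]
  rw [dualizer, inner_smul_right, mul_assoc, ← inner_conj_symm h, RCLike.mul_conj,
    Real.rpow_add_natCast' (norm_nonneg _) (by push_cast; linarith)]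
  push_cast
  rfl

theorem enorm_inner_dualizer_dualizer (hq : 2 ≤ q) (h γ γ' : H) :
    ‖inner 𝕜 (dualizer 𝕜 q h γ) (dualizer 𝕜 q h γ')‖ₑ =
      ‖inner 𝕜 γ h‖ₑ ^ (q - 1) * ‖inner 𝕜 γ' h‖ₑ ^ (q - 1) * ‖inner 𝕜 γ γ'‖ₑ := by
  rw [dualizer, dualizer, inner_smul_left, inner_smul_right, enorm_mul, enorm_mul,
    RCLike.enorm_conj, enorm_dualizer_coeff hq, enorm_dualizer_coeff hq, mul_assoc]

theorem enorm_inner_le (x y : H) : ‖inner 𝕜 x y‖ₑ ≤ ‖x‖ₑ * ‖y‖ₑ := by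
  simpa only [enorm_eq_nnnorm] using mod_cast nnnorm_inner_le_nnnorm (𝕜 := 𝕜) x y

theorem enorm_dualizer_le (hq : 2 ≤ q) (h γ : H) :
    ‖dualizer 𝕜 q h γ‖ₑ ≤ ‖h‖ₑ ^ (q - 1) * ‖γ‖ₑ ^ q := by
  have hq1 : 0 ≤ q - 1 := by linarith
  calc _ = ‖inner 𝕜 γ h‖ₑ ^ (q - 1) * ‖γ‖ₑ := by
        rw [dualizer, enorm_smul, enorm_dualizer_coeff hq]
    _ ≤ (‖γ‖ₑ * ‖h‖ₑ) ^ (q - 1) * ‖γ‖ₑ := by gcongr; exact enorm_inner_le _ _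
    _ = ‖h‖ₑ ^ (q - 1) * (‖γ‖ₑ ^ (q - 1) * ‖γ‖ₑ ^ (1 : ℝ)) := by
        rw [ENNReal.mul_rpow_of_nonneg _ _ hq1, ENNReal.rpow_one]; ring
    _ = _ := by rw [← ENNReal.rpow_add_of_nonneg _ _ hq1 zero_le_one, sub_add_cancel]

section Curve

variable {α : Type*} [MeasurableSpace α] {μ : Measure α} {γ : α → H}

theorem integrable_dualizer (hq : 2 ≤ q) (hγ : StronglyMeasurable γ)
    (hγq : ∫⁻ t, ‖γ t‖ₑ ^ q ∂μ ≠ ∞) (h : H) : Integrable (fun t => dualizer 𝕜 q h (γ t)) μ := by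
  have hinner : StronglyMeasurable fun t => inner 𝕜 (γ t) h := hγ.inner stronglyMeasurable_const
  have hpow := (RCLike.continuous_ofReal (K := 𝕜)).comp_stronglyMeasurable
    (hinner.norm.measurable.pow_const (q - 2)).stronglyMeasurable
  refine ⟨((hpow.mul hinner).smul hγ).aestronglyMeasurable, ?_⟩
  calc ∫⁻ t, ‖dualizer 𝕜 q h (γ t)‖ₑ ∂μ ≤ ∫⁻ t, ‖h‖ₑ ^ (q - 1) * ‖γ t‖ₑ ^ q ∂μ :=
        lintegral_mono fun t => enorm_dualizer_le hq h (γ t)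
    _ = ‖h‖ₑ ^ (q - 1) * ∫⁻ t, ‖γ t‖ₑ ^ q ∂μ :=
        lintegral_const_mul _ (hγ.enorm.pow_const q)
    _ < ∞ := ENNReal.mul_lt_top
        (ENNReal.rpow_lt_top_of_nonneg (by linarith) enorm_ne_top) hγq.lt_top

theorem lintegral_enorm_inner_rpow_le_enorm_integral_dualizer [NormedSpace ℝ H] [CompleteSpace H]
    (hq : 2 ≤ q) (hγ : StronglyMeasurable γ) (hγq : ∫⁻ t, ‖γ t‖ₑ ^ q ∂μ ≠ ∞) (h : H) :
    ∫⁻ t, ‖inner 𝕜 (γ t) h‖ₑ ^ q ∂μ ≤ ‖h‖ₑ * ‖∫ t, dualizer 𝕜 q h (γ t) ∂μ‖ₑ := by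
  have hG := integrable_dualizer (𝕜 := 𝕜) hq hγ hγq h
  have hint : Integrable (fun t => ‖inner 𝕜 (γ t) h‖ ^ q) μ := by
    simpa only [inner_dualizer hq, RCLike.ofReal_re] using (hG.const_inner (𝕜 := 𝕜) h).re
  have hnonneg : ∀ t, 0 ≤ ‖inner 𝕜 (γ t) h‖ ^ q := fun t => by positivity
  calc ∫⁻ t, ‖inner 𝕜 (γ t) h‖ₑ ^ q ∂μ = ENNReal.ofReal (∫ t, ‖inner 𝕜 (γ t) h‖ ^ q ∂μ) := by
        rw [ofReal_integral_eq_lintegral_ofReal hint (.of_forall hnonneg)]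
        refine lintegral_congr fun t => ?_
        rw [← ofReal_norm, ENNReal.ofReal_rpow_of_nonneg (norm_nonneg _) (by linarith)]
    _ = ‖∫ t, inner 𝕜 h (dualizer 𝕜 q h (γ t)) ∂μ‖ₑ := by
        simp_rw [inner_dualizer hq]
        rw [integral_ofReal, ← ofReal_norm, RCLike.norm_ofReal,
          abs_of_nonneg (integral_nonneg hnonneg)]
    _ ≤ _ := by
        rw [integral_inner hG]
        exact enorm_inner_le _ _

theorem lintegral_enorm_inner_rpow_ne_top (hq : 0 ≤ q) (hγ : StronglyMeasurable γ)
    (hγq : ∫⁻ t, ‖γ t‖ₑ ^ q ∂μ ≠ ∞) (h : H) : ∫⁻ t, ‖inner 𝕜 (γ t) h‖ₑ ^ q ∂μ ≠ ∞ := by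
  refine ne_top_of_le_ne_top ?_ (lintegral_mono
    (g := fun t => ‖γ t‖ₑ ^ q * ‖h‖ₑ ^ q) fun t => ?_)
  · rw [lintegral_mul_const _ (hγ.enorm.pow_const q)]
    exact ENNReal.mul_ne_top hγq (ENNReal.rpow_ne_top_of_nonneg hq enorm_ne_top)
  · simpa only [← ENNReal.mul_rpow_of_nonneg _ _ hq] using
      ENNReal.rpow_le_rpow (enorm_inner_le _ _) hq

end Curve

/-- The restriction of a curve to the times of absolute value at most `K` at which its norm is at
most `K`, extended by zero. -/
def truncateCurve (K : ℕ) (γ : ℝ → H) : ℝ → H :=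
  {t : ℝ | |t| ≤ K ∧ ‖γ t‖ ≤ K}.indicator γ

theorem stronglyMeasurable_truncateCurve {γ : ℝ → H} (hγ : StronglyMeasurable γ) (K : ℕ) :
    StronglyMeasurable (truncateCurve K γ) :=
  hγ.indicator ((measurableSet_le measurable_id.abs measurable_const).inter
    (measurableSet_le hγ.norm.measurable measurable_const))

theorem enorm_truncateCurve_le (K : ℕ) (γ : ℝ → H) (t : ℝ) :
    ‖truncateCurve K γ t‖ₑ ≤ (Metric.closedBall (0 : ℝ) K).indicator (fun _ => (K : ℝ≥0∞)) t := by
  by_cases ht : |t| ≤ K ∧ ‖γ t‖ ≤ K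
  · have : ‖γ t‖₊ ≤ (K : ℝ≥0) := ht.2
    simpa [truncateCurve, ht.1, ht.2, enorm_eq_nnnorm] using mod_cast this
  · simp [truncateCurve, ht]

theorem enorm_inner_truncateCurve_le (K : ℕ) (γ : ℝ → H) (t : ℝ) (y : H) :
    ‖inner 𝕜 (truncateCurve K γ t) y‖ₑ ≤ ‖inner 𝕜 (γ t) y‖ₑ := by
  by_cases ht : |t| ≤ K ∧ ‖γ t‖ ≤ K <;> simp [truncateCurve, ht]

theorem enorm_inner_truncateCurve_truncateCurve_le (K : ℕ) (γ γ' : ℝ → H) (t s : ℝ) :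
    ‖inner 𝕜 (truncateCurve K γ t) (truncateCurve K γ' s)‖ₑ ≤ ‖inner 𝕜 (γ t) (γ' s)‖ₑ := by
  refine (enorm_inner_truncateCurve_le K γ t _).trans ?_
  rw [← inner_conj_symm, RCLike.enorm_conj, ← inner_conj_symm (γ t), RCLike.enorm_conj]
  exact enorm_inner_truncateCurve_le K γ' s _

theorem monotone_enorm_inner_truncateCurve (γ : ℝ → H) (t : ℝ) (h : H) :
    Monotone fun K => ‖inner 𝕜 (truncateCurve K γ t) h‖ₑ := fun K L hKL => by
  have hKL : (K : ℝ) ≤ L := mod_cast hKL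
  by_cases ht : |t| ≤ K ∧ ‖γ t‖ ≤ K
  · simp [truncateCurve, ht.1, ht.2, ht.1.trans hKL, ht.2.trans hKL]
  · simp [truncateCurve, ht]

theorem exists_truncateCurve_eq (γ : ℝ → H) (t : ℝ) (n : ℕ) :
    ∃ K, n ≤ K ∧ truncateCurve K γ t = γ t := by
  obtain ⟨M, hM⟩ := exists_nat_ge (max |t| ‖γ t‖)
  obtain ⟨K, hnK, hMK⟩ : ∃ K, n ≤ K ∧ M ≤ K := ⟨max n M, le_max_left _ _, le_max_right _ _⟩
  have hK : max |t| ‖γ t‖ ≤ K := hM.trans (mod_cast hMK)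
  exact ⟨K, hnK, by simp [truncateCurve, le_of_max_le_left hK, le_of_max_le_right hK]⟩

theorem lintegral_enorm_rpow_ne_top_of_le_indicator {γ : ℝ → H} {K : ℕ} (hq : 0 < q)
    (hγ : ∀ t, ‖γ t‖ₑ ≤ (Metric.closedBall (0 : ℝ) K).indicator (fun _ => (K : ℝ≥0∞)) t) :
    ∫⁻ t, ‖γ t‖ₑ ^ q ≠ ∞ := by
  refine ne_top_of_le_ne_top (b := ∫⁻ _ in Metric.closedBall (0 : ℝ) K, (K : ℝ≥0∞) ^ q) ?_ ?_
  · rw [setLIntegral_const]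
    exact ENNReal.mul_ne_top (ENNReal.rpow_ne_top_of_nonneg hq.le (ENNReal.natCast_ne_top K))
      (isCompact_closedBall _ _).measure_ne_top
  · rw [← lintegral_indicator Metric.isClosed_closedBall.measurableSet]
    refine lintegral_mono fun t => (ENNReal.rpow_le_rpow (hγ t) hq.le).trans ?_
    by_cases ht : t ∈ Metric.closedBall (0 : ℝ) K
    · simp [ht]
    · simp [ht, hq]

theorem stronglyMeasurable_apply_measurable {α : Type*} [MeasurableSpace α] {T : ℕ → α → H}
    (hT : ∀ n, StronglyMeasurable (T n)) {ν : α → ℕ} (hν : Measurable ν) :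
    StronglyMeasurable fun t => T (ν t) t :=
  (stronglyMeasurable_uncurry_of_continuous_of_stronglyMeasurable
    (u := fun n t => T n t) (fun _ => continuous_of_discreteTopology) hT).comp_measurable
    (hν.prodMk measurable_id)

variable [NormedSpace ℝ H] [CompleteSpace H]

theorem lintegral_enorm_inner_rpow_le (hpq : p.HolderConjugate q) (hq : 2 < q) {γ : ℝ → H}
    (hγ : StronglyMeasurable γ) (hγq : ∫⁻ t, ‖γ t‖ₑ ^ q ≠ ∞)
    (hC : ∀ t s, ‖inner 𝕜 (γ t) (γ s)‖ₑ ≤ C * ‖t - s‖ₑ ^ (-(2 / q))) (h : H) :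
    (∫⁻ t, ‖inner 𝕜 (γ t) h‖ₑ ^ q) ^ (2 / q) ≤ C * hlsConst q * ‖h‖ₑ ^ 2 := by
  have hXtop := lintegral_enorm_inner_rpow_ne_top (𝕜 := 𝕜) hpq.symm.nonneg hγ hγq h
  have hXG := lintegral_enorm_inner_rpow_le_enorm_integral_dualizer (𝕜 := 𝕜) hq.le hγ hγq h
  set X := ∫⁻ t, ‖inner 𝕜 (γ t) h‖ₑ ^ q with hX
  have hG : ‖∫ t, dualizer 𝕜 q h (γ t)‖ₑ ^ 2 ≤ C * (hlsConst q * X ^ (2 / p)) := by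
    have hXw : X = ∫⁻ t, (‖inner 𝕜 (γ t) h‖ₑ ^ (q - 1)) ^ p := by
      have : (q - 1) * p = q := by linear_combination hpq.mul_eq_add
      simp only [← ENNReal.rpow_mul, this, hX]
    rw [hXw]
    refine enorm_integral_sq_le_of_enorm_inner_le (𝕜 := 𝕜) hpq hq
      (integrable_dualizer hq.le hγ hγq h)
      ((hγ.inner stronglyMeasurable_const).enorm.pow_const _) fun t s => ?_
    rw [enorm_inner_dualizer_dualizer hq.le, mul_left_comm]
    gcongr
    exact hC t s
  rcases eq_or_ne X 0 with hX0 | hX0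
  · simp [hX0, hpq.symm.pos]
  have hcancel : X ^ (2 / p) * X ^ (2 / q) ≤ X ^ (2 / p) * (C * hlsConst q * ‖h‖ₑ ^ 2) := by
    calc _ = X ^ 2 := by
          rw [← ENNReal.rpow_add _ _ hX0 hXtop, ← ENNReal.rpow_natCast]
          congr 1
          push_cast
          linear_combination 2 * hpq.inv_add_inv_eq_one
      _ ≤ (‖h‖ₑ * ‖∫ t, dualizer 𝕜 q h (γ t)‖ₑ) ^ 2 := by gcongr
      _ ≤ ‖h‖ₑ ^ 2 * (C * (hlsConst q * X ^ (2 / p))) := by rw [mul_pow]; gcongr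
      _ = _ := by ring
  refine (ENNReal.mul_le_mul_iff_right ?_ ?_).1 hcancel
  · simp [hX0, hXtop]
  · exact ENNReal.rpow_ne_top_of_nonneg (by have := hpq.pos; positivity) hXtop

theorem lintegral_iSup_truncateCurve_le (hpq : p.HolderConjugate q) (hq : 2 < q) {T : ℕ → ℝ → H}
    (hT : ∀ n, StronglyMeasurable (T n))
    (hC : ∀ m n t s, ‖inner 𝕜 (T m t) (T n s)‖ₑ ≤ C * ‖t - s‖ₑ ^ (-(2 / q))) (h : H) (K : ℕ) :
    ∫⁻ t, (⨆ n ≤ K, ‖inner 𝕜 (truncateCurve K (T n) t) h‖ₑ) ^ q ≤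
      (C * hlsConst q * ‖h‖ₑ ^ 2) ^ (q / 2) := by
  have hq0 : 0 < q := hpq.symm.pos
  have hTK := fun n => stronglyMeasurable_truncateCurve (hT n) K
  obtain ⟨ν, hν, hmax⟩ := exists_measurable_argmax (fun n =>
    ((hTK n).inner (𝕜 := 𝕜) (stronglyMeasurable_const (b := h))).enorm) K
  set γ : ℝ → H := fun t => truncateCurve K (T (ν t)) t
  have hγ : StronglyMeasurable γ := stronglyMeasurable_apply_measurable hTK hν
  have hγq : ∫⁻ t, ‖γ t‖ₑ ^ q ≠ ∞ := lintegral_enorm_rpow_ne_top_of_le_indicator hq0 fun t =>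
    enorm_truncateCurve_le K (T (ν t)) t
  calc _ ≤ ∫⁻ t, ‖inner 𝕜 (γ t) h‖ₑ ^ q := lintegral_mono fun t =>
        ENNReal.rpow_le_rpow (iSup₂_le (hmax t)) hq0.le
    _ = ((∫⁻ t, ‖inner 𝕜 (γ t) h‖ₑ ^ q) ^ (2 / q)) ^ (q / 2) := by
        rw [← ENNReal.rpow_mul, div_mul_div_cancel₀ hq0.ne', div_self two_ne_zero,
          ENNReal.rpow_one]
    _ ≤ _ := by
        gcongr
        exact lintegral_enorm_inner_rpow_le hpq hq hγ hγq (fun t s =>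
          (enorm_inner_truncateCurve_truncateCurve_le K _ _ t s).trans (hC _ _ t s)) h

theorem lintegral_iSup_enorm_inner_rpow_le (hpq : p.HolderConjugate q) (hq : 2 < q)
    {T : ℕ → ℝ → H} (hT : ∀ n, StronglyMeasurable (T n))
    (hC : ∀ m n t s, ‖inner 𝕜 (T m t) (T n s)‖ₑ ≤ C * ‖t - s‖ₑ ^ (-(2 / q))) (h : H) :
    ∫⁻ t, (⨆ n, ‖inner 𝕜 (T n t) h‖ₑ) ^ q ≤ (C * hlsConst q * ‖h‖ₑ ^ 2) ^ (q / 2) := by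
  have hq0 : 0 < q := hpq.symm.pos
  set M : ℕ → ℝ → ℝ≥0∞ := fun K t => ⨆ n ≤ K, ‖inner 𝕜 (truncateCurve K (T n) t) h‖ₑ
  have hMm : ∀ K, Measurable (M K) := fun K => .iSup fun n => .iSup fun _ =>
    ((stronglyMeasurable_truncateCurve (hT n) K).inner stronglyMeasurable_const).enorm
  have hMmono : Monotone M := fun K L hKL t => iSup₂_le fun n hn =>
    (monotone_enorm_inner_truncateCurve (T n) t h hKL).trans
      (le_iSup₂ (f := fun n (_ : n ≤ L) => ‖inner 𝕜 (truncateCurve L (T n) t) h‖ₑ) n (hn.trans hKL))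
  have hle : ∀ t, ⨆ n, ‖inner 𝕜 (T n t) h‖ₑ ≤ ⨆ K, M K t := fun t => iSup_le fun n => by
    obtain ⟨K, hnK, hK⟩ := exists_truncateCurve_eq (T n) t n
    refine le_iSup_of_le K (le_iSup₂_of_le n hnK ?_)
    rw [hK]
  calc _ ≤ ∫⁻ t, ⨆ K, M K t ^ q := lintegral_mono fun t => by
        refine le_of_le_of_eq ?_ ((ENNReal.orderIsoRpow q hq0).map_iSup fun K => M K t)
        exact ENNReal.rpow_le_rpow (hle t) hq0.le
    _ = ⨆ K, ∫⁻ t, M K t ^ q := lintegral_iSup (fun K => (hMm K).pow_const q)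
        fun K L hKL t => ENNReal.rpow_le_rpow (hMmono hKL t) hq0.le
    _ ≤ _ := iSup_le fun K => lintegral_iSup_truncateCurve_le hpq hq hT hC h K

end TTStar

section Chaining

variable {α H : Type*} [MeasurableSpace α] {μ : Measure α} {q : ℝ≥0∞}

theorem eLpNorm_le_iff_lintegral_rpow_le (hq : q ≠ 0) (hq' : q ≠ ∞) (g : α → ℝ≥0∞) (c : ℝ≥0∞) :
    eLpNorm g q μ ≤ c ↔ ∫⁻ t, g t ^ q.toReal ∂μ ≤ c ^ q.toReal := by
  rw [eLpNorm_eq_lintegral_rpow_enorm_toReal hq hq', one_div,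
    ENNReal.rpow_inv_le_iff (ENNReal.toReal_pos hq hq')]
  simp only [enorm_eq_self]

theorem eLpNorm_tsum_le (hq : 1 ≤ q) (hq' : q ≠ ∞) {a : ℕ → α → ℝ≥0∞}
    (ha : ∀ k, Measurable (a k)) :
    eLpNorm (fun t => ∑' k, a k t) q μ ≤ ∑' k, eLpNorm (a k) q μ := by
  have hq0 : q ≠ 0 := (zero_lt_one.trans_le hq).ne'
  have hqr := ENNReal.toReal_pos hq0 hq'
  rw [eLpNorm_le_iff_lintegral_rpow_le hq0 hq']
  calc _ = ∫⁻ t, ⨆ K, (∑ k ∈ Finset.range K, a k t) ^ q.toReal ∂μ := lintegral_congr fun t => by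
        rw [ENNReal.tsum_eq_iSup_nat]
        exact (ENNReal.orderIsoRpow _ hqr).map_iSup fun K => ∑ k ∈ Finset.range K, a k t
    _ = ⨆ K, ∫⁻ t, (∑ k ∈ Finset.range K, a k t) ^ q.toReal ∂μ :=
        lintegral_iSup (fun K => (Finset.measurable_fun_sum _ fun k _ => ha k).pow_const _)
          fun K L hKL t => by gcongr
    _ ≤ _ := iSup_le fun K => by
        rw [← eLpNorm_le_iff_lintegral_rpow_le hq0 hq']
        calc _ = eLpNorm (∑ k ∈ Finset.range K, a k) q μ := by congr 1; ext t; simp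
          _ ≤ ∑ k ∈ Finset.range K, eLpNorm (a k) q μ :=
              eLpNorm_sum_le (fun k _ => (ha k).aestronglyMeasurable) hq
          _ ≤ _ := ENNReal.sum_le_tsum _

variable [NormedAddCommGroup H] {S : α → H → ℝ≥0∞} {B : ℝ≥0∞}

theorem eLpNorm_simpleFunc_le (hq : q ≠ 0) (hq' : q ≠ ∞)
    (hSm : ∀ h, Measurable fun t => S t h) (hSB : ∀ h, eLpNorm (fun t => S t h) q μ ≤ B * ‖h‖ₑ)
    (γ : SimpleFunc α H) {N : ℕ} (hN : γ.range.card ≤ N) {c : ℝ≥0∞} (hc : ∀ t, ‖γ t‖ₑ ≤ c) :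
    eLpNorm (fun t => S t (γ t)) q μ ≤ N ^ (1 / q.toReal) * (B * c) := by
  have hqr := ENNReal.toReal_pos hq hq'
  simp only [eLpNorm_le_iff_lintegral_rpow_le hq hq'] at hSB ⊢
  calc _ ≤ ∫⁻ t, ∑ h ∈ γ.range, S t h ^ q.toReal ∂μ := lintegral_mono fun t =>
        Finset.single_le_sum_of_canonicallyOrdered (f := fun h => S t h ^ q.toReal)
          (γ.mem_range_self t)
    _ = ∑ h ∈ γ.range, ∫⁻ t, S t h ^ q.toReal ∂μ :=
        lintegral_finsetSum _ fun h _ => (hSm h).pow_const _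
    _ ≤ ∑ _h ∈ γ.range, (B * c) ^ q.toReal := Finset.sum_le_sum fun h hh => by
        obtain ⟨t, rfl⟩ := SimpleFunc.mem_range.1 hh
        refine (hSB _).trans ?_
        gcongr
        exact hc t
    _ ≤ N * (B * c) ^ q.toReal := by
        rw [Finset.sum_const, nsmul_eq_mul]
        gcongr
    _ = _ := by
        rw [ENNReal.mul_rpow_of_nonneg (N ^ _) _ hqr.le, ← ENNReal.rpow_mul, one_div,
          inv_mul_cancel₀ hqr.ne', ENNReal.rpow_one]

theorem le_tsum_of_lowerSemicontinuous {s : H → ℝ≥0∞} (hs : LowerSemicontinuous s)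
    (hadd : ∀ h h', s (h + h') ≤ s h + s h') {x : ℕ → H} {y : H}
    (hxy : Filter.Tendsto x Filter.atTop (nhds y)) :
    s y ≤ s (x 0) + ∑' k, s (x (k + 1) - x k) := by
  have partial_sum : ∀ K, s (x K) ≤ s (x 0) + ∑ k ∈ Finset.range K, s (x (k + 1) - x k) := by
    intro K
    induction K with
    | zero => simp
    | succ K ih =>
      rw [Finset.sum_range_succ, ← add_assoc]
      calc s (x (K + 1)) = s (x K + (x (K + 1) - x K)) := by rw [add_sub_cancel]
        _ ≤ s (x K) + s (x (K + 1) - x K) := hadd _ _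
        _ ≤ _ := by gcongr
  refine le_of_forall_lt fun r hr => ?_
  obtain ⟨K, hK⟩ := (hxy.eventually (hs y r hr)).exists
  refine hK.trans_le ((partial_sum K).trans ?_)
  gcongr
  exact ENNReal.sum_le_tsum _

theorem eLpNorm_le_of_simpleFunc_tendsto (hq : 1 ≤ q) (hq' : q ≠ ∞)
    (hSm : ∀ h, Measurable fun t => S t h) (hSlsc : ∀ t, LowerSemicontinuous (S t))
    (hSadd : ∀ t h h', S t (h + h') ≤ S t h + S t h')
    {D : α → H} {γ : ℕ → SimpleFunc α H}
    (hγD : ∀ t, Filter.Tendsto (fun k => γ k t) Filter.atTop (nhds (D t))) :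
    eLpNorm (fun t => S t (D t)) q μ ≤
      eLpNorm (fun t => S t (γ 0 t)) q μ +
        ∑' k, eLpNorm (fun t => S t ((γ (k + 1) - γ k) t)) q μ := by
  have hSγ : ∀ γ : SimpleFunc α H, Measurable fun t => S t (γ t) := fun γ =>
    γ.measurable_bind (fun h t => S t h) hSm
  calc _ ≤ eLpNorm ((fun t => S t (γ 0 t)) + fun t => ∑' k, S t ((γ (k + 1) - γ k) t)) q μ :=
        eLpNorm_mono_enorm fun t => le_tsum_of_lowerSemicontinuous (hSlsc t) (hSadd t) (hγD t)
    _ ≤ _ := (eLpNorm_add_le (hSγ _).aestronglyMeasurable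
        (Measurable.tsum fun k => hSγ _).aestronglyMeasurable hq).trans
        (by gcongr; exact eLpNorm_tsum_le hq hq' fun k => hSγ _)

/-- The index of the dyadic interval of length `2⁻ᵏ` that contains `F t`, for `F` with values in
`[0, 1]`. -/
def dyadicIndex {F : α → ℝ} (hF : Measurable F) (hF1 : ∀ t, F t ≤ 1) (k : ℕ) : SimpleFunc α ℕ where
  toFun t := ⌊F t * 2 ^ k⌋₊
  measurableSet_fiber' _ := Nat.measurable_floor.comp (hF.mul_const _) (measurableSet_singleton _)
  finite_range' := (Set.finite_Iic (2 ^ k)).subset <| by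
    rintro _ ⟨t, rfl⟩
    refine Nat.floor_le_of_le ?_
    push_cast
    exact mul_le_of_le_one_left (by positivity) (hF1 t)

section Dyadic

variable {F : α → ℝ} (hF : Measurable F) (hF0 : ∀ t, 0 ≤ F t) (hF1 : ∀ t, F t ≤ 1)

theorem card_range_dyadicIndex_le (k : ℕ) : (dyadicIndex hF hF1 k).range.card ≤ 2 ^ (k + 1) := by
  have hsub : (dyadicIndex hF hF1 k).range ⊆ Finset.range (2 ^ k + 1) := fun i hi => by
    obtain ⟨t, rfl⟩ := SimpleFunc.mem_range.1 hi
    rw [Finset.mem_range, Nat.lt_succ_iff]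
    change ⌊F t * 2 ^ k⌋₊ ≤ 2 ^ k
    refine Nat.floor_le_of_le ?_
    push_cast
    exact mul_le_of_le_one_left (by positivity) (hF1 t)
  calc _ ≤ 2 ^ k + 1 := by simpa using Finset.card_le_card hsub
    _ ≤ 2 ^ k + 2 ^ k := by gcongr; exact Nat.one_le_two_pow
    _ = _ := by ring

theorem dyadicIndex_succ_div_two (k : ℕ) (t : α) :
    dyadicIndex hF hF1 (k + 1) t / 2 = dyadicIndex hF hF1 k t := by
  change ⌊F t * 2 ^ (k + 1)⌋₊ / 2 = ⌊F t * 2 ^ k⌋₊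
  rw [← Nat.floor_div_ofNat, pow_succ, ← mul_assoc]
  simp

include hF0 in
theorem enorm_sub_le_of_dyadicIndex_eq {k : ℕ} {t s : α}
    (h : dyadicIndex hF hF1 k t = dyadicIndex hF hF1 k s) : ‖F t - F s‖ₑ ≤ 2⁻¹ ^ k := by
  have h2k : (0 : ℝ) < 2 ^ k := by positivity
  have floor_bounds : ∀ t, (dyadicIndex hF hF1 k t : ℝ) ≤ F t * 2 ^ k ∧
      F t * 2 ^ k < dyadicIndex hF hF1 k t + 1 := fun t =>
    ⟨Nat.floor_le (mul_nonneg (hF0 t) h2k.le), Nat.lt_floor_add_one _⟩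
  have habs : |F t - F s| ≤ 2⁻¹ ^ k := by
    have ht := floor_bounds t
    have hs := floor_bounds s
    rw [← h] at hs
    rw [inv_pow, inv_eq_one_div, le_div_iff₀ h2k, ← abs_of_pos h2k, ← abs_mul, sub_mul, abs_le]
    constructor <;> linarith
  rw [Real.enorm_eq_ofReal_abs]
  refine (ENNReal.ofReal_le_ofReal habs).trans_eq ?_
  rw [ENNReal.ofReal_pow (by positivity), ENNReal.ofReal_inv_of_pos two_pos, ENNReal.ofReal_ofNat]

/-- The approximation of the curve `D` that is constant on the level sets of the dyadic index of
generation `k`, where it takes the value of `D` at one point of the level set. -/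
def dyadicApprox [Nonempty α] (D : α → H) (k : ℕ) : SimpleFunc α H :=
  (dyadicIndex hF hF1 k).map fun i => D (Function.invFun (dyadicIndex hF hF1 k) i)

omit [NormedAddCommGroup H] in
theorem card_range_dyadicApprox_le [Nonempty α] (D : α → H) (k : ℕ) :
    (dyadicApprox hF hF1 D k).range.card ≤ 2 ^ (k + 1) := by
  classical
  rw [dyadicApprox, SimpleFunc.range_map]
  exact Finset.card_image_le.trans (card_range_dyadicIndex_le hF hF1 k)

theorem card_range_dyadicApprox_succ_sub_le [Nonempty α] (D : α → H) (k : ℕ) :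
    (dyadicApprox hF hF1 D (k + 1) - dyadicApprox hF hF1 D k).range.card ≤ 2 ^ (k + 2) := by
  classical
  have hmap : dyadicApprox hF hF1 D (k + 1) - dyadicApprox hF hF1 D k =
      (dyadicIndex hF hF1 (k + 1)).map fun i =>
        D (Function.invFun (dyadicIndex hF hF1 (k + 1)) i) -
          D (Function.invFun (dyadicIndex hF hF1 k) (i / 2)) := by
    ext t
    simp only [dyadicApprox, SimpleFunc.coe_sub, Pi.sub_apply, SimpleFunc.map_apply,
      dyadicIndex_succ_div_two]
  rw [hmap, SimpleFunc.range_map]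
  exact Finset.card_image_le.trans (card_range_dyadicIndex_le hF hF1 (k + 1))

include hF0 in
theorem enorm_sub_dyadicApprox_le [Nonempty α] {D : α → H} {c : ℝ≥0∞} {σ : ℝ} (hσ : 0 ≤ σ)
    (hD : ∀ t s, ‖D t - D s‖ₑ ≤ c * ‖F t - F s‖ₑ ^ σ) (k : ℕ) (t : α) :
    ‖D t - dyadicApprox hF hF1 D k t‖ₑ ≤ c * (2 ^ (-σ)) ^ k := by
  have hindex := Function.invFun_eq (f := dyadicIndex hF hF1 k) ⟨t, rfl⟩
  calc _ ≤ c * (2⁻¹ ^ k) ^ σ := (hD _ _).trans <| by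
        gcongr
        exact enorm_sub_le_of_dyadicIndex_eq hF hF0 hF1 hindex.symm
    _ = _ := by
        rw [← ENNReal.rpow_natCast, ← ENNReal.rpow_natCast, ← ENNReal.rpow_mul, mul_comm (k : ℝ),
          ENNReal.rpow_mul, ENNReal.inv_rpow, ENNReal.rpow_neg]

include hF0 in
theorem enorm_dyadicApprox_succ_sub_le [Nonempty α] {D : α → H} {c : ℝ≥0∞} {σ : ℝ} (hσ : 0 < σ)
    (hD : ∀ t s, ‖D t - D s‖ₑ ≤ c * ‖F t - F s‖ₑ ^ σ) (k : ℕ) (t : α) :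
    ‖(dyadicApprox hF hF1 D (k + 1) - dyadicApprox hF hF1 D k) t‖ₑ ≤
      2 * (c * (2 ^ (-σ)) ^ k) := by
  set γ := dyadicApprox hF hF1 D
  have hratio : (2 : ℝ≥0∞) ^ (-σ) ≤ 1 :=
    ENNReal.rpow_le_one_of_one_le_of_neg one_le_two (neg_lt_zero.2 hσ)
  calc ‖γ (k + 1) t - γ k t‖ₑ = ‖(D t - γ k t) - (D t - γ (k + 1) t)‖ₑ := by
        rw [sub_sub_sub_cancel_left]
    _ ≤ ‖D t - γ k t‖ₑ + ‖D t - γ (k + 1) t‖ₑ := enorm_sub_le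
    _ ≤ c * (2 ^ (-σ)) ^ k + c * (2 ^ (-σ)) ^ (k + 1) := by
        gcongr <;> exact enorm_sub_dyadicApprox_le hF hF0 hF1 hσ.le hD _ t
    _ ≤ c * (2 ^ (-σ)) ^ k + c * (2 ^ (-σ)) ^ k :=
        add_le_add le_rfl (mul_le_mul_right (pow_le_pow_right_of_le_one' hratio k.le_succ) _)
    _ = _ := (two_mul _).symm

include hF0 in
theorem tendsto_dyadicApprox [Nonempty α] {D : α → H} {c : ℝ≥0} {σ : ℝ} (hσ : 0 < σ)
    (hD : ∀ t s, ‖D t - D s‖ₑ ≤ c * ‖F t - F s‖ₑ ^ σ) (t : α) :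
    Filter.Tendsto (fun k => dyadicApprox hF hF1 D k t) Filter.atTop (nhds (D t)) := by
  have hratio : (2 : ℝ≥0∞) ^ (-σ) < 1 :=
    ENNReal.rpow_lt_one_of_one_lt_of_neg ENNReal.one_lt_two (neg_lt_zero.2 hσ)
  have hlim := ENNReal.Tendsto.const_mul (a := (c : ℝ≥0∞))
    (ENNReal.tendsto_pow_atTop_nhds_zero_of_lt_one hratio) (Or.inr ENNReal.coe_ne_top)
  rw [mul_zero] at hlim
  refine tendsto_iff_edist_tendsto_0.2 (tendsto_of_tendsto_of_tendsto_of_le_of_le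
    tendsto_const_nhds hlim (fun _ => zero_le) fun k => ?_)
  rw [edist_comm, edist_eq_enorm_sub]
  exact enorm_sub_dyadicApprox_le hF hF0 hF1 hσ.le hD k t

end Dyadic

/-- The constant of the chaining estimate `eLpNorm_holder_path_le`: generation `k` of the chain
contributes `2 * 4 ^ (1 / q) * (2 ^ (1 / q - σ)) ^ k`. -/
def chainingConst (q : ℝ≥0∞) (σ : ℝ) : ℝ≥0∞ :=
  2 ^ (1 / q.toReal) + 2 * 4 ^ (1 / q.toReal) * (1 - 2 ^ (1 / q.toReal - σ))⁻¹

theorem chainingConst_ne_top {σ : ℝ} (hσ : 1 / q.toReal < σ) : chainingConst q σ ≠ ∞ := by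
  have hq : 0 ≤ 1 / q.toReal := by positivity
  have hratio : (2 : ℝ≥0∞) ^ (1 / q.toReal - σ) < 1 :=
    ENNReal.rpow_lt_one_of_one_lt_of_neg ENNReal.one_lt_two (by linarith)
  exact ENNReal.add_ne_top.2 ⟨ENNReal.rpow_ne_top_of_nonneg hq (by norm_num),
    ENNReal.mul_ne_top
      (ENNReal.mul_ne_top (by norm_num) (ENNReal.rpow_ne_top_of_nonneg hq (by norm_num)))
      (ENNReal.inv_ne_top.2 (tsub_pos_of_lt hratio).ne')⟩

theorem eLpNorm_holder_path_le (hq : 1 ≤ q) (hq' : q ≠ ∞)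
    (hSm : ∀ h, Measurable fun t => S t h) (hSlsc : ∀ t, LowerSemicontinuous (S t))
    (hSadd : ∀ t h h', S t (h + h') ≤ S t h + S t h')
    (hSB : ∀ h, eLpNorm (fun t => S t h) q μ ≤ B * ‖h‖ₑ)
    {F : α → ℝ} (hF : Measurable F) (hF0 : ∀ t, 0 ≤ F t) (hF1 : ∀ t, F t ≤ 1)
    {D : α → H} {c : ℝ≥0} {σ : ℝ} (hσ : 0 < σ) (hDc : ∀ t, ‖D t‖ₑ ≤ c)
    (hD : ∀ t s, ‖D t - D s‖ₑ ≤ c * ‖F t - F s‖ₑ ^ σ) :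
    eLpNorm (fun t => S t (D t)) q μ ≤ chainingConst q σ * (B * c) := by
  cases isEmpty_or_nonempty α
  · simp [μ.eq_zero_of_isEmpty]
  have hq0 : q ≠ 0 := (zero_lt_one.trans_le hq).ne'
  set γ := dyadicApprox hF hF1 D
  have level_le : ∀ k, eLpNorm (fun t => S t ((γ (k + 1) - γ k) t)) q μ ≤
      2 * 4 ^ (1 / q.toReal) * (B * c) * (2 ^ (1 / q.toReal - σ)) ^ k := fun k => by
    have hpow : ((2 ^ (k + 2) : ℕ) : ℝ≥0∞) ^ (1 / q.toReal) =
        4 ^ (1 / q.toReal) * (2 ^ (1 / q.toReal)) ^ k := by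
      rw [← ENNReal.rpow_mul_natCast, mul_comm (1 / q.toReal), ENNReal.rpow_natCast_mul,
        ← ENNReal.mul_rpow_of_nonneg _ _ (by positivity)]
      congr 1
      push_cast
      ring
    refine (eLpNorm_simpleFunc_le hq0 hq' hSm hSB _
      (card_range_dyadicApprox_succ_sub_le hF hF1 D k)
      (enorm_dyadicApprox_succ_sub_le hF hF0 hF1 hσ hD k)).trans_eq ?_
    rw [hpow, sub_eq_add_neg, ENNReal.rpow_add _ _ two_ne_zero ENNReal.ofNat_ne_top, mul_pow]
    ring
  calc _ ≤ eLpNorm (fun t => S t (γ 0 t)) q μ +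
        ∑' k, eLpNorm (fun t => S t ((γ (k + 1) - γ k) t)) q μ :=
        eLpNorm_le_of_simpleFunc_tendsto hq hq' hSm hSlsc hSadd
          (tendsto_dyadicApprox hF hF0 hF1 hσ hD)
    _ ≤ 2 ^ (1 / q.toReal) * (B * c) +
        ∑' k, 2 * 4 ^ (1 / q.toReal) * (B * c) * (2 ^ (1 / q.toReal - σ)) ^ k := by
        refine add_le_add ?_ (ENNReal.tsum_le_tsum level_le)
        simpa using eLpNorm_simpleFunc_le hq0 hq' hSm hSB (γ 0)
          (card_range_dyadicApprox_le hF hF1 D 0) fun t => hDc _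
    _ = _ := by
        rw [ENNReal.tsum_mul_left, ENNReal.tsum_geometric, chainingConst]
        ring

end Chaining

section Schur

variable {X Y : Type*} [MeasurableSpace X] {μ : Measure X}

theorem two_mul_le_sq_add_sq (a b : ℝ≥0∞) : 2 * (a * b) ≤ a ^ 2 + b ^ 2 := by
  rcases eq_or_ne a ∞ with rfl | ha
  · simp
  rcases eq_or_ne b ∞ with rfl | hb
  · simp
  lift a to ℝ≥0 using ha
  lift b to ℝ≥0 using hb
  exact_mod_cast (mul_assoc 2 a b).symm.trans_le (two_mul_le_add_sq a b)

theorem lintegral_lintegral_symm_kernel_mul_le [SFinite μ] {κ : X → X → ℝ≥0∞}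
    (hκm : Measurable (Function.uncurry κ)) (hκs : ∀ x x', κ x x' = κ x' x) {c : ℝ≥0∞}
    (hc : ∀ x, ∫⁻ x', κ x x' ∂μ ≤ c) {a : X → ℝ≥0∞} (ha : AEMeasurable a μ) :
    ∫⁻ x, ∫⁻ x', κ x x' * (a x * a x') ∂μ ∂μ ≤ c * ∫⁻ x, a x ^ 2 ∂μ := by
  have ha2 : AEMeasurable (fun x => a x ^ 2) μ := ha.pow_const 2
  have hfst : AEMeasurable (fun z : X × X => κ z.1 z.2 * a z.1 ^ 2) (μ.prod μ) :=
    hκm.aemeasurable.mul ha2.comp_fst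
  have hsnd : AEMeasurable (fun z : X × X => κ z.1 z.2 * a z.2 ^ 2) (μ.prod μ) :=
    hκm.aemeasurable.mul ha2.comp_snd
  have diagonal_le : ∫⁻ x, ∫⁻ x', κ x x' * a x ^ 2 ∂μ ∂μ ≤ c * ∫⁻ x, a x ^ 2 ∂μ := by
    rw [← lintegral_const_mul'' _ ha2]
    refine lintegral_mono fun x => ?_
    have hκx : Measurable (κ x) := hκm.comp measurable_prodMk_left
    rw [lintegral_mul_const _ hκx]
    gcongr
    exact hc x
  have diagonal_swap : ∫⁻ x, ∫⁻ x', κ x x' * a x' ^ 2 ∂μ ∂μ =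
      ∫⁻ x, ∫⁻ x', κ x x' * a x ^ 2 ∂μ ∂μ := by
    rw [lintegral_lintegral_swap hsnd]
    simp_rw [hκs]
  refine (ENNReal.mul_le_mul_iff_right two_ne_zero ENNReal.ofNat_ne_top).1 ?_
  calc 2 * ∫⁻ x, ∫⁻ x', κ x x' * (a x * a x') ∂μ ∂μ
      = ∫⁻ x, ∫⁻ x', 2 * (κ x x' * (a x * a x')) ∂μ ∂μ := by
        simp_rw [lintegral_const_mul' 2 _ ENNReal.ofNat_ne_top]
    _ ≤ ∫⁻ x, ∫⁻ x', κ x x' * a x ^ 2 + κ x x' * a x' ^ 2 ∂μ ∂μ := by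
        gcongr with x x'
        rw [mul_left_comm, ← mul_add]
        gcongr
        exact two_mul_le_sq_add_sq _ _
    _ = (∫⁻ x, ∫⁻ x', κ x x' * a x ^ 2 ∂μ ∂μ) + ∫⁻ x, ∫⁻ x', κ x x' * a x' ^ 2 ∂μ ∂μ := by
        rw [← lintegral_prod _ hfst, ← lintegral_prod _ hsnd, ← lintegral_add_left' hfst]
        exact (lintegral_prod _ (hfst.add hsnd)).symm
    _ ≤ 2 * (c * ∫⁻ x, a x ^ 2 ∂μ) := by
        rw [diagonal_swap, ← two_mul]
        gcongr

variable {𝕜 : Type*} [RCLike 𝕜] [MeasurableSpace Y] {ν : Measure Y} {E : X → Y → 𝕜} {w : Y → ℝ}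
  {G : X → 𝕜}

theorem integrable_kernel_mul_conj_mul [SFinite μ] [SFinite ν]
    (hE : Measurable (Function.uncurry E)) (hEw : ∀ x y, ‖E x y‖ ≤ w y)
    (hw : Integrable (fun y => w y ^ 2) ν) (hG : Integrable G μ) :
    Integrable (fun z : Y × (X × X) => (E z.2.1 z.1 * starRingEnd 𝕜 (E z.2.2 z.1)) *
      (G z.2.1 * starRingEnd 𝕜 (G z.2.2))) (ν.prod (μ.prod μ)) := by
  have hGG : Integrable (fun z : X × X => ‖G z.1‖ * ‖G z.2‖) (μ.prod μ) := hG.norm.mul_prod hG.norm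
  have hmeas : ∀ i : X × X → X, Measurable i →
      Measurable fun z : Y × (X × X) => E (i z.2) z.1 := fun i hi =>
    hE.comp ((hi.comp measurable_snd).prodMk measurable_fst)
  have hGm := hG.aestronglyMeasurable
  refine (hw.mul_prod hGG).mono' (.mul ?_ ?_) (.of_forall fun z => ?_)
  · exact ((hmeas _ measurable_fst).mul
      (RCLike.continuous_conj.measurable.comp (hmeas _ measurable_snd))).aestronglyMeasurable
  · exact (hGm.comp_fst.mul
      (RCLike.continuous_conj.comp_aestronglyMeasurable hGm.comp_snd)).comp_snd
  · simp only [norm_mul, RCLike.norm_conj]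
    rw [sq]
    have := (norm_nonneg _).trans (hEw z.2.1 z.1)
    gcongr <;> exact hEw _ _

-- `TT*` for the operator with kernel `E`: the squared norm is `∬ ⟪E x, E x'⟫ G x conj (G x')`.
theorem lintegral_enorm_integral_mul_sq_le [SFinite μ] [SFinite ν]
    (hE : Measurable (Function.uncurry E)) (hEw : ∀ x y, ‖E x y‖ ≤ w y)
    (hw : Integrable (fun y => w y ^ 2) ν) (hG : Integrable G μ) {κ : X → X → ℝ≥0∞}
    (hκm : Measurable (Function.uncurry κ)) (hκs : ∀ x x', κ x x' = κ x' x)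
    (hκ : ∀ x x', ‖∫ y, E x y * starRingEnd 𝕜 (E x' y) ∂ν‖ₑ ≤ κ x x') {c : ℝ≥0∞}
    (hc : ∀ x, ∫⁻ x', κ x x' ∂μ ≤ c) :
    ∫⁻ y, ‖∫ x, E x y * G x ∂μ‖ₑ ^ 2 ∂ν ≤ c * ∫⁻ x, ‖G x‖ₑ ^ 2 ∂μ := by
  set V : Y → 𝕜 := fun y => ∫ x, E x y * G x ∂μ
  set Φ : Y → X × X → 𝕜 := fun y z =>
    (E z.1 y * starRingEnd 𝕜 (E z.2 y)) * (G z.1 * starRingEnd 𝕜 (G z.2))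
  have hΦ : Integrable (Function.uncurry Φ) (ν.prod (μ.prod μ)) :=
    integrable_kernel_mul_conj_mul hE hEw hw hG
  have sq_eq : ∀ y, ((‖V y‖ ^ 2 : ℝ) : 𝕜) = ∫ z, Φ y z ∂(μ.prod μ) := fun y => by
    push_cast
    rw [← RCLike.mul_conj, ← integral_conj, ← integral_prod_mul]
    refine integral_congr_ae (.of_forall fun z => ?_)
    simp only [map_mul, Φ]
    ring
  have hV : Integrable (fun y => ‖V y‖ ^ 2) ν := by
    have := hΦ.integral_prod_left
    simp_rw [Function.uncurry_apply_pair, ← sq_eq] at this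
    simpa using this.re
  calc ∫⁻ y, ‖V y‖ₑ ^ 2 ∂ν = ‖∫ y, ((‖V y‖ ^ 2 : ℝ) : 𝕜) ∂ν‖ₑ := by
        rw [integral_ofReal, ← ofReal_norm, RCLike.norm_ofReal,
          abs_of_nonneg (integral_nonneg fun y => by positivity),
          ofReal_integral_eq_lintegral_ofReal hV (.of_forall fun y => by positivity)]
        simp_rw [ENNReal.ofReal_pow (norm_nonneg _), ofReal_norm]
    _ = ‖∫ z, ∫ y, Φ y z ∂ν ∂(μ.prod μ)‖ₑ := by
        simp_rw [sq_eq]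
        rw [integral_integral_swap hΦ]
    _ ≤ ∫⁻ z, ‖∫ y, Φ y z ∂ν‖ₑ ∂(μ.prod μ) := enorm_integral_le_lintegral_enorm _
    _ ≤ ∫⁻ z, κ z.1 z.2 * (‖G z.1‖ₑ * ‖G z.2‖ₑ) ∂(μ.prod μ) := lintegral_mono fun z => by
        simp only [Φ]
        rw [integral_mul_const, enorm_mul, enorm_mul, RCLike.enorm_conj]
        gcongr
        exact hκ _ _
    _ = ∫⁻ x, ∫⁻ x', κ x x' * (‖G x‖ₑ * ‖G x'‖ₑ) ∂μ ∂μ := by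
        have hGe := hG.aestronglyMeasurable.enorm
        exact lintegral_prod _ (hκm.aemeasurable.mul (hGe.comp_fst.mul hGe.comp_snd))
    _ ≤ _ := lintegral_lintegral_symm_kernel_mul_le hκm hκs hc hG.aestronglyMeasurable.enorm

end Schur

section Gaussian

variable {V : Type*} [NormedAddCommGroup V] [InnerProductSpace ℝ V]

/-- The Fourier transform `∫ e^{i⟨x, b⟩} e^{-ε|x|²} dx` of a Gaussian. -/
def gaussianTransform (ε : ℝ) (b : V) : ℝ :=
  (Real.pi / ε) ^ (Module.finrank ℝ V / 2 : ℝ) * Real.exp (-‖b‖ ^ 2 / (4 * ε))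

theorem gaussianTransform_nonneg {ε : ℝ} (hε : 0 < ε) (b : V) : 0 ≤ gaussianTransform ε b := by
  unfold gaussianTransform
  positivity

theorem gaussianTransform_sub_comm (ε : ℝ) (b b' : V) :
    gaussianTransform ε (b - b') = gaussianTransform ε (b' - b) := by
  rw [gaussianTransform, norm_sub_rev, gaussianTransform]

theorem continuous_gaussianTransform (ε : ℝ) : Continuous (gaussianTransform ε : V → ℝ) := by
  unfold gaussianTransform
  fun_prop

variable [FiniteDimensional ℝ V] [MeasurableSpace V] [BorelSpace V]

theorem integrable_exp_neg_mul_norm_sq {ε : ℝ} (hε : 0 < ε) :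
    Integrable fun x : V => Real.exp (-ε * ‖x‖ ^ 2) := by
  have h := GaussianFourier.integrable_cexp_neg_mul_sq_norm_add (b := ε) (by simpa using hε) 0
    (0 : V)
  refine h.re.congr (.of_forall fun x => ?_)
  simp only [zero_mul, add_zero]
  rw [← Complex.exp_ofReal_re]
  simp

theorem integral_exp_inner_mul_exp_neg_mul_norm_sq {ε : ℝ} (hε : 0 < ε) (b : V) :
    ∫ x : V, Complex.exp (Complex.I * (inner ℝ x b : ℝ)) * (Real.exp (-ε * ‖x‖ ^ 2) : ℂ) =
      gaussianTransform ε b := by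
  have h := GaussianFourier.integral_cexp_neg_mul_sq_norm_add (b := ε) (by simpa using hε)
    Complex.I b
  rw [Complex.I_sq, neg_one_mul] at h
  rw [gaussianTransform, Complex.ofReal_mul, Complex.ofReal_cpow (by positivity)]
  push_cast
  rw [← h]
  congr 1 with x
  rw [← Complex.exp_add, real_inner_comm, add_comm]

theorem integrable_gaussianTransform {ε : ℝ} (hε : 0 < ε) :
    Integrable (gaussianTransform ε : V → ℝ) := by
  have h := (integrable_exp_neg_mul_norm_sq (V := V) (ε := (4 * ε)⁻¹) (by positivity)).const_mul
    ((Real.pi / ε) ^ (Module.finrank ℝ V / 2 : ℝ))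
  refine h.congr (.of_forall fun b => ?_)
  simp only [gaussianTransform]
  ring_nf

theorem integral_gaussianTransform {ε : ℝ} (hε : 0 < ε) :
    ∫ b : V, gaussianTransform ε b = (2 * Real.pi) ^ Module.finrank ℝ V := by
  have h := GaussianFourier.integral_rexp_neg_mul_sq_norm (V := V) (b := (4 * ε)⁻¹) (by positivity)
  calc ∫ b : V, gaussianTransform ε b
      = (Real.pi / ε) ^ (Module.finrank ℝ V / 2 : ℝ) *
          ∫ b : V, Real.exp (-(4 * ε)⁻¹ * ‖b‖ ^ 2) := by
        rw [← integral_const_mul]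
        congr 1 with b
        rw [gaussianTransform]
        ring_nf
    _ = ((2 * Real.pi) ^ 2) ^ (Module.finrank ℝ V / 2 : ℝ) := by
        rw [h, ← Real.mul_rpow (by positivity) (by positivity)]
        congr 1
        field_simp
        ring
    _ = _ := by
        rw [← Real.rpow_natCast, ← Real.rpow_natCast, ← Real.rpow_mul (by positivity)]
        congr 1
        push_cast
        ring

end Gaussian

section Resonance

theorem integrable_comp_norm_sq {h : ℝ → ℝ} (hh : Integrable h) :
    Integrable fun z : Plane => h (‖z‖ ^ 2) := by
  rw [integrable_fun_norm_addHaar (volume : Measure Plane) (f := fun r => h (r ^ 2))]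
  refine ((integrableOn_Ioi_comp_rpow_iff' h two_ne_zero).2 hh.integrableOn).congr_fun
    (fun y _ => ?_) measurableSet_Ioi
  norm_num

theorem integral_comp_norm_sq (h : ℝ → ℝ) :
    ∫ z : Plane, h (‖z‖ ^ 2) = Real.pi * ∫ ρ in Set.Ioi 0, h ρ := by
  rw [integral_fun_norm_addHaar (volume : Measure Plane) (fun r => h (r ^ 2)),
    ← integral_comp_rpow_Ioi h two_ne_zero, Measure.real, EuclideanSpace.volume_ball_fin_two,
    ← integral_const_mul, smul_eq_mul, nsmul_eq_mul, ← integral_const_mul, ← integral_const_mul]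
  refine setIntegral_congr_fun measurableSet_Ioi fun y _ => ?_
  norm_num [ENNReal.toReal_ofReal Real.pi_pos.le]
  ring

variable {h : ℝ → ℝ} (hh : Integrable h) (h0 : ∀ q, 0 ≤ h q)

include hh h0

theorem lintegral_comp_sub_two_mul_norm_sq_le (c : ℝ) :
    ∫⁻ z : Plane, ENNReal.ofReal (h (c - 2 * ‖z‖ ^ 2)) ≤
      ENNReal.ofReal (Real.pi / 2 * ∫ q, h q) := by
  have hi : Integrable fun ρ => h (c - 2 * ρ) :=
    (hh.comp_sub_left c).comp_mul_left' two_ne_zero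
  rw [← ofReal_integral_eq_lintegral_ofReal (integrable_comp_norm_sq hi)
    (.of_forall fun z => h0 _), integral_comp_norm_sq fun ρ => h (c - 2 * ρ)]
  refine ENNReal.ofReal_le_ofReal ?_
  rw [div_eq_mul_inv, mul_assoc]
  gcongr
  calc _ ≤ ∫ ρ, h (c - 2 * ρ) := setIntegral_le_integral hi (.of_forall fun ρ => h0 _)
    _ = _ := by
        rw [Measure.integral_comp_mul_left (fun ρ => h (c - ρ)) 2, integral_sub_left_eq_self]
        norm_num [abs_of_pos]

-- By the parallelogram law the first factor is a function of `|y - η/2|²` for fixed `η`.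
theorem lintegral_comp_sub_norm_sq_add_norm_sq_le (c : ℝ) (η : Plane) :
    ∫⁻ y : Plane, ENNReal.ofReal (h (c - (‖η - y‖ ^ 2 + ‖y‖ ^ 2))) ≤
      ENNReal.ofReal (Real.pi / 2 * ∫ q, h q) := by
  refine le_trans (le_of_eq ?_) (lintegral_comp_sub_two_mul_norm_sq_le hh h0 (c - ‖η‖ ^ 2 / 2))
  rw [← lintegral_add_right_eq_self _ ((1 / 2 : ℝ) • η)]
  refine lintegral_congr fun z => ?_
  congr 2
  have hreflect : η - (z + (1 / 2 : ℝ) • η) = (1 / 2 : ℝ) • η - z := by module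
  rw [hreflect, norm_sub_sq_real, norm_add_sq_real, norm_smul, real_inner_comm]
  norm_num
  ring

theorem lintegral_resonance_le (hhm : Measurable h) {k : Plane → ℝ≥0∞} (hk : Measurable k) (c : ℝ)
    (η₀ : Plane) :
    ∫⁻ z : Plane × Plane, ENNReal.ofReal (h (c - (‖z.1‖ ^ 2 + ‖z.2‖ ^ 2))) *
      k (η₀ - (z.1 + z.2)) ≤ ENNReal.ofReal (Real.pi / 2 * ∫ q, h q) * ∫⁻ η, k η := by
  have hm : Measurable fun z : Plane × Plane =>
      ENNReal.ofReal (h (c - (‖z.1‖ ^ 2 + ‖z.2‖ ^ 2))) * k (η₀ - (z.1 + z.2)) :=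
    (ENNReal.measurable_ofReal.comp (hhm.comp (by fun_prop))).mul (hk.comp (by fun_prop))
  have hm' : Measurable (Function.uncurry fun y η : Plane =>
      ENNReal.ofReal (h (c - (‖η - y‖ ^ 2 + ‖y‖ ^ 2))) * k (η₀ - η)) :=
    (ENNReal.measurable_ofReal.comp (hhm.comp (by fun_prop))).mul (hk.comp (by fun_prop))
  calc _ = ∫⁻ y : Plane, ∫⁻ x : Plane, ENNReal.ofReal (h (c - (‖x‖ ^ 2 + ‖y‖ ^ 2))) *
          k (η₀ - (x + y)) := lintegral_prod_symm _ hm.aemeasurable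
    _ = ∫⁻ y : Plane, ∫⁻ η : Plane, ENNReal.ofReal (h (c - (‖η - y‖ ^ 2 + ‖y‖ ^ 2))) *
          k (η₀ - η) := by
        refine lintegral_congr fun y => ?_
        rw [← lintegral_sub_right_eq_self _ y]
        simp only [sub_add_cancel]
    _ = ∫⁻ η : Plane, ∫⁻ y : Plane, ENNReal.ofReal (h (c - (‖η - y‖ ^ 2 + ‖y‖ ^ 2))) *
          k (η₀ - η) := lintegral_lintegral_swap hm'.aemeasurable
    _ ≤ ∫⁻ η : Plane, ENNReal.ofReal (Real.pi / 2 * ∫ q, h q) * k (η₀ - η) := by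
        refine lintegral_mono fun η => ?_
        dsimp only
        rw [lintegral_mul_const _ (by fun_prop)]
        gcongr
        exact lintegral_comp_sub_norm_sq_add_norm_sq_le hh h0 c η
    _ = _ := by
        have hkη : Measurable fun η => k (η₀ - η) := hk.comp (by fun_prop)
        rw [lintegral_const_mul _ hkη, lintegral_sub_left_eq_self]

end Resonance

section Strichartz

/-- The plane wave of space-time frequency `-η`, damped by a Gaussian. -/
def dampedWave (ε : ℝ) (η y : ℝ × Plane) : ℂ :=
  Complex.exp (-(Complex.I * (y.1 * η.1 + inner ℝ y.2 η.2 : ℝ))) *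
    (Real.exp (-(ε / 2) * (y.1 ^ 2 + ‖y.2‖ ^ 2)) : ℂ)

/-- Minus the space-time frequency of the product of the free waves of frequencies `z.1` and
`z.2`. -/
def pairFrequency (z : Plane × Plane) : ℝ × Plane :=
  ((2 * Real.pi) ^ 2 * (‖z.1‖ ^ 2 + ‖z.2‖ ^ 2), (2 * Real.pi) • (z.1 + z.2))

theorem norm_dampedWave (ε : ℝ) (η y : ℝ × Plane) :
    ‖dampedWave ε η y‖ = Real.exp (-(ε / 2) * (y.1 ^ 2 + ‖y.2‖ ^ 2)) := by
  rw [dampedWave, norm_mul, Complex.norm_real, Real.norm_of_nonneg (Real.exp_pos _).le, ← mul_neg,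
    ← Complex.ofReal_neg, mul_comm Complex.I, Complex.norm_exp_ofReal_mul_I, one_mul]

theorem sq_exp_neg_half_mul (ε r : ℝ) : Real.exp (-(ε / 2) * r) ^ 2 = Real.exp (-ε * r) := by
  rw [← Real.exp_nat_mul]
  congr 1
  push_cast
  ring

theorem sq_damping_eq (ε : ℝ) (y : ℝ × Plane) :
    Real.exp (-(ε / 2) * (y.1 ^ 2 + ‖y.2‖ ^ 2)) ^ 2 =
      Real.exp (-ε * ‖y.1‖ ^ 2) * Real.exp (-ε * ‖y.2‖ ^ 2) := by
  rw [sq_exp_neg_half_mul, mul_add, Real.exp_add, Real.norm_eq_abs, sq_abs]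

theorem integrable_sq_damping {ε : ℝ} (hε : 0 < ε) :
    Integrable fun y : ℝ × Plane => Real.exp (-(ε / 2) * (y.1 ^ 2 + ‖y.2‖ ^ 2)) ^ 2 := by
  refine ((integrable_exp_neg_mul_norm_sq (V := ℝ) hε).mul_prod
    (integrable_exp_neg_mul_norm_sq (V := Plane) hε)).congr (.of_forall fun y => ?_)
  exact (sq_damping_eq ε y).symm

theorem integral_dampedWave_mul_conj {ε : ℝ} (hε : 0 < ε) (η η' : ℝ × Plane) :
    ∫ y, dampedWave ε η y * starRingEnd ℂ (dampedWave ε η' y) =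
      gaussianTransform ε (η'.1 - η.1) * gaussianTransform ε (η'.2 - η.2) := by
  rw [← integral_exp_inner_mul_exp_neg_mul_norm_sq hε,
    ← integral_exp_inner_mul_exp_neg_mul_norm_sq hε, ← integral_prod_mul]
  refine integral_congr_ae (.of_forall fun y => ?_)
  simp only [dampedWave, map_mul, ← Complex.exp_conj, map_neg, Complex.conj_I, Complex.conj_ofReal]
  rw [mul_mul_mul_comm, ← sq, ← Complex.exp_add,
    mul_mul_mul_comm (Complex.exp (Complex.I * _)), ← Complex.exp_add]
  congr 1
  · congr 1
    simp only [inner_sub_right, Real.inner_apply]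
    push_cast
    ring
  · exact_mod_cast sq_damping_eq ε y

theorem lintegral_gaussianTransform_pairFrequency_sub_le {ε : ℝ} (hε : 0 < ε) (z : Plane × Plane) :
    ∫⁻ z', ENNReal.ofReal (gaussianTransform ε ((pairFrequency z).1 - (pairFrequency z').1) *
      gaussianTransform ε ((pairFrequency z).2 - (pairFrequency z').2)) ≤ 4⁻¹ := by
  set h : ℝ → ℝ := fun q => gaussianTransform ε ((2 * Real.pi) ^ 2 * q)
  set k : Plane → ℝ≥0∞ := fun η => ENNReal.ofReal (gaussianTransform ε ((2 * Real.pi) • η))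
  have hh : Integrable h := (integrable_gaussianTransform hε).comp_mul_left' (by positivity)
  have integral_h : ∫ q, h q = (2 * Real.pi)⁻¹ := by
    rw [Measure.integral_comp_mul_left, integral_gaussianTransform hε, abs_of_pos (by positivity)]
    simp only [Module.finrank_self, smul_eq_mul]
    field_simp
  have lintegral_k : ∫⁻ η, k η = 1 := by
    rw [← ofReal_integral_eq_lintegral_ofReal
      ((integrable_gaussianTransform hε).comp_smul (by positivity))
      (.of_forall fun η => gaussianTransform_nonneg hε _), Measure.integral_comp_smul,
      integral_gaussianTransform hε, abs_of_pos (by positivity), smul_eq_mul,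
      inv_mul_cancel₀ (by positivity), ENNReal.ofReal_one]
  calc _ = ∫⁻ z' : Plane × Plane, ENNReal.ofReal (h (‖z.1‖ ^ 2 + ‖z.2‖ ^ 2 -
        (‖z'.1‖ ^ 2 + ‖z'.2‖ ^ 2))) * k (z.1 + z.2 - (z'.1 + z'.2)) := by
        simp only [h, k, pairFrequency, mul_sub, smul_sub,
          ENNReal.ofReal_mul (gaussianTransform_nonneg hε _)]
    _ ≤ ENNReal.ofReal (Real.pi / 2 * ∫ q, h q) * ∫⁻ η, k η :=
        lintegral_resonance_le hh (fun q => gaussianTransform_nonneg hε _)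
          ((continuous_gaussianTransform ε).measurable.comp (measurable_const_mul _))
          (ENNReal.measurable_ofReal.comp
            ((continuous_gaussianTransform ε).measurable.comp (measurable_const_smul _))) _ _
    _ = ENNReal.ofReal 4⁻¹ := by
        rw [integral_h, lintegral_k, mul_one]
        congr 1
        field_simp
        norm_num
    _ = 4⁻¹ := by rw [ENNReal.ofReal_inv_of_pos (by norm_num), ENNReal.ofReal_ofNat]

/-- The free Schrödinger wave with frequency profile `g`. -/
def freeWave (g : Plane → ℂ) (t : ℝ) (x : Plane) : ℂ :=
  ∫ ξ, Complex.exp (Complex.I *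
    ((-(2 * Real.pi * inner ℝ x ξ + t * (2 * Real.pi * ‖ξ‖) ^ 2) : ℝ) : ℂ)) * g ξ

theorem norm_exp_I_mul_ofReal (r : ℝ) : ‖Complex.exp (Complex.I * (r : ℂ))‖ = 1 := by
  rw [mul_comm, Complex.norm_exp_ofReal_mul_I]

theorem continuous_freeWave {g : Plane → ℂ} (hg : Integrable g) :
    Continuous fun y : ℝ × Plane => freeWave g y.1 y.2 := by
  refine continuous_of_dominated (bound := fun ξ => ‖g ξ‖) (fun y => ?_) (fun y => ?_) hg.norm ?_
  · exact (by fun_prop : Continuous fun ξ : Plane => Complex.exp (Complex.I *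
      ((-(2 * Real.pi * inner ℝ y.2 ξ + y.1 * (2 * Real.pi * ‖ξ‖) ^ 2) : ℝ) : ℂ))
      ).aestronglyMeasurable.mul hg.aestronglyMeasurable
  · exact .of_forall fun ξ => by rw [norm_mul, norm_exp_I_mul_ofReal, one_mul]
  · exact .of_forall fun ξ => by fun_prop

theorem freeWave_sq_mul_damping (g : Plane → ℂ) (ε : ℝ) (y : ℝ × Plane) :
    freeWave g y.1 y.2 ^ 2 * (Real.exp (-(ε / 2) * (y.1 ^ 2 + ‖y.2‖ ^ 2)) : ℂ) =
      ∫ z : Plane × Plane, dampedWave ε (pairFrequency z) y * (g z.1 * g z.2) := by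
  rw [sq, freeWave, ← integral_prod_mul, ← integral_mul_const]
  refine integral_congr_ae (.of_forall fun z => ?_)
  simp only [dampedWave]
  rw [mul_mul_mul_comm, ← Complex.exp_add, mul_right_comm]
  congr 3
  simp only [pairFrequency, inner_smul_right, inner_add_right]
  push_cast
  ring

theorem lintegral_freeWave_pow_four_mul_gaussian_le {g : Plane → ℂ} (hg : Integrable g) {ε : ℝ}
    (hε : 0 < ε) :
    ∫⁻ y : ℝ × Plane, ‖freeWave g y.1 y.2‖ₑ ^ 4 *
      ENNReal.ofReal (Real.exp (-ε * (y.1 ^ 2 + ‖y.2‖ ^ 2))) ≤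
      4⁻¹ * (∫⁻ ξ, ‖g ξ‖ₑ ^ 2) ^ 2 := by
  have hg2 : AEMeasurable fun ξ => ‖g ξ‖ₑ ^ 2 := hg.aestronglyMeasurable.enorm.pow_const 2
  have hE : Measurable (Function.uncurry fun z : Plane × Plane => dampedWave ε (pairFrequency z)) :=
    (by unfold dampedWave pairFrequency Function.uncurry; fun_prop :
      Continuous (Function.uncurry fun z : Plane × Plane =>
        dampedWave ε (pairFrequency z))).measurable
  have hκm : Measurable (Function.uncurry fun z z' : Plane × Plane => ENNReal.ofReal
      (gaussianTransform ε ((pairFrequency z).1 - (pairFrequency z').1) *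
        gaussianTransform ε ((pairFrequency z).2 - (pairFrequency z').2))) := by
    unfold Function.uncurry pairFrequency gaussianTransform
    fun_prop
  calc _ = ∫⁻ y, ‖∫ z : Plane × Plane,
        dampedWave ε (pairFrequency z) y * (g z.1 * g z.2)‖ₑ ^ 2 := by
        refine lintegral_congr fun y => ?_
        rw [← freeWave_sq_mul_damping, enorm_mul, mul_pow, enorm_pow, ← pow_mul,
          ← sq_exp_neg_half_mul, ENNReal.ofReal_pow (Real.exp_pos _).le,
          ← ofReal_norm (Complex.ofReal _), Complex.norm_real,
          Real.norm_of_nonneg (Real.exp_pos _).le]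
    _ ≤ 4⁻¹ * ∫⁻ z : Plane × Plane, ‖g z.1 * g z.2‖ₑ ^ 2 :=
        lintegral_enorm_integral_mul_sq_le hE (fun z y => (norm_dampedWave ε _ y).le)
          (integrable_sq_damping hε) (hg.mul_prod hg) hκm
          (fun z z' => by
            rw [gaussianTransform_sub_comm, gaussianTransform_sub_comm ε (pairFrequency z).2])
          (fun z z' => by
            rw [integral_dampedWave_mul_conj hε, gaussianTransform_sub_comm,
              gaussianTransform_sub_comm ε (pairFrequency z').2, ← Complex.ofReal_mul,
              ← ofReal_norm, Complex.norm_real, Real.norm_of_nonneg (mul_nonneg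
                (gaussianTransform_nonneg hε _) (gaussianTransform_nonneg hε _))])
          (lintegral_gaussianTransform_pairFrequency_sub_le hε)
    _ = _ := by
        simp_rw [enorm_mul, mul_pow]
        rw [sq (∫⁻ ξ, ‖g ξ‖ₑ ^ 2), ← lintegral_prod_mul hg2 hg2]
        rfl

theorem lintegral_freeWave_pow_four_le {g : Plane → ℂ} (hg : Integrable g) :
    ∫⁻ y : ℝ × Plane, ‖freeWave g y.1 y.2‖ₑ ^ 4 ≤ 4⁻¹ * (∫⁻ ξ, ‖g ξ‖ₑ ^ 2) ^ 2 := by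
  set ε : ℕ → ℝ := fun n => 1 / ((n : ℝ) + 1)
  set damped : ℕ → ℝ × Plane → ℝ≥0∞ := fun n y => ‖freeWave g y.1 y.2‖ₑ ^ 4 *
    ENNReal.ofReal (Real.exp (-ε n * (y.1 ^ 2 + ‖y.2‖ ^ 2)))
  have tendsto_damped : ∀ y, Filter.Tendsto (damped · y) Filter.atTop
      (nhds (‖freeWave g y.1 y.2‖ₑ ^ 4)) := fun y => by
    have hcont : Continuous fun e : ℝ => Real.exp (-e * (y.1 ^ 2 + ‖y.2‖ ^ 2)) := by fun_prop
    have hexp : Filter.Tendsto (fun n => Real.exp (-ε n * (y.1 ^ 2 + ‖y.2‖ ^ 2)))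
        Filter.atTop (nhds 1) := by
      simpa [ε, Function.comp_def] using
        (hcont.tendsto 0).comp tendsto_one_div_add_atTop_nhds_zero_nat
    simpa [damped] using ENNReal.Tendsto.const_mul (a := ‖freeWave g y.1 y.2‖ₑ ^ 4)
      (ENNReal.tendsto_ofReal hexp) (Or.inr (by simp))
  have hdamped : ∀ n, Measurable (damped n) := fun n =>
    ((continuous_freeWave hg).enorm.measurable.pow_const 4).mul (by fun_prop)
  calc _ = ∫⁻ y, Filter.liminf (damped · y) Filter.atTop :=
        lintegral_congr fun y => (tendsto_damped y).liminf_eq.symm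
    _ ≤ Filter.liminf (fun n => ∫⁻ y, damped n y) Filter.atTop := lintegral_liminf_le hdamped
    _ ≤ _ := Filter.liminf_le_of_le (by isBoundedDefault) fun b hb => by
        obtain ⟨n, hn⟩ := hb.exists
        exact hn.trans (lintegral_freeWave_pow_four_mul_gaussian_le hg Nat.one_div_pos_of_nat)

end Strichartz

section OscillatoryIntegral

theorem integral_exp_I_mul_eq {a b : ℝ} {φ φ' φ'' : ℝ → ℝ}
    (hφ : ∀ x ∈ Set.uIcc a b, HasDerivAt φ (φ' x) x)
    (hφ' : ∀ x ∈ Set.uIcc a b, HasDerivAt φ' (φ'' x) x)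
    (hφ'' : ContinuousOn φ'' (Set.uIcc a b)) (h0 : ∀ x ∈ Set.uIcc a b, φ' x ≠ 0) :
    ∫ x in a..b, Complex.exp (Complex.I * φ x) =
      Complex.exp (Complex.I * φ b) / (Complex.I * φ' b) -
        Complex.exp (Complex.I * φ a) / (Complex.I * φ' a) -
          ∫ x in a..b, ((-φ'' x / φ' x ^ 2 : ℝ) : ℂ) * Complex.I⁻¹ *
            Complex.exp (Complex.I * φ x) := by
  have hφc : ContinuousOn φ (Set.uIcc a b) := fun x hx => (hφ x hx).continuousAt.continuousWithinAt
  have hφ'c : ContinuousOn φ' (Set.uIcc a b) :=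
    fun x hx => (hφ' x hx).continuousAt.continuousWithinAt
  have hu : ∀ x ∈ Set.uIcc a b, HasDerivAt (fun x => (((φ' x)⁻¹ : ℝ) : ℂ) * Complex.I⁻¹)
      (((-φ'' x / φ' x ^ 2 : ℝ) : ℂ) * Complex.I⁻¹) x :=
    fun x hx => ((hφ' x hx).inv (h0 x hx)).ofReal_comp.mul_const _
  have hv : ∀ x ∈ Set.uIcc a b, HasDerivAt (fun x => Complex.exp (Complex.I * φ x))
      (Complex.exp (Complex.I * φ x) * (Complex.I * φ' x)) x :=
    fun x hx => ((hφ x hx).ofReal_comp.const_mul _).cexp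
  have hu' : ContinuousOn (fun x => ((-φ'' x / φ' x ^ 2 : ℝ) : ℂ) * Complex.I⁻¹)
      (Set.uIcc a b) := by
    refine (Complex.continuous_ofReal.comp_continuousOn ?_).mul continuousOn_const
    exact hφ''.neg.div (hφ'c.pow 2) fun x hx => pow_ne_zero 2 (h0 x hx)
  have hv' : ContinuousOn (fun x => Complex.exp (Complex.I * φ x) * (Complex.I * φ' x))
      (Set.uIcc a b) := by fun_prop
  have cancel : ∀ x ∈ Set.uIcc a b, Complex.exp (Complex.I * φ x) =
      (((φ' x)⁻¹ : ℝ) : ℂ) * Complex.I⁻¹ * (Complex.exp (Complex.I * φ x) * (Complex.I * φ' x)) :=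
    fun x hx => by
      have : (φ' x : ℂ) ≠ 0 := by exact_mod_cast h0 x hx
      push_cast
      field_simp
  rw [intervalIntegral.integral_congr cancel, intervalIntegral.integral_mul_deriv_eq_deriv_mul hu hv
    hu'.intervalIntegrable hv'.intervalIntegrable]
  push_cast
  field_simp

/-- A special case of van der Corput's lemma. -/
theorem norm_integral_exp_I_mul_le_two_div {a b : ℝ} (hab : a ≤ b) {φ φ' φ'' : ℝ → ℝ}
    (hφ : ∀ x ∈ Set.Icc a b, HasDerivAt φ (φ' x) x)
    (hφ' : ∀ x ∈ Set.Icc a b, HasDerivAt φ' (φ'' x) x)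
    (hφ'' : ContinuousOn φ'' (Set.Icc a b)) (hφ''0 : ∀ x ∈ Set.Icc a b, 0 ≤ φ'' x)
    (h0 : ∀ x ∈ Set.Icc a b, 0 < φ' x) :
    ‖∫ x in a..b, Complex.exp (Complex.I * φ x)‖ ≤ 2 / φ' a := by
  have norm_boundary : ∀ x ∈ Set.Icc a b,
      ‖Complex.exp (Complex.I * φ x) / (Complex.I * φ' x)‖ = (φ' x)⁻¹ := fun x hx => by
    rw [norm_div, norm_exp_I_mul_ofReal, norm_mul, Complex.norm_I, one_mul, Complex.norm_real,
      Real.norm_of_nonneg (h0 x hx).le, one_div]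
  rw [← Set.uIcc_of_le hab] at *
  have norm_remainder : ‖∫ x in a..b, ((-φ'' x / φ' x ^ 2 : ℝ) : ℂ) * Complex.I⁻¹ *
      Complex.exp (Complex.I * φ x)‖ ≤ (φ' a)⁻¹ - (φ' b)⁻¹ := by
    have integral_deriv : ∫ x in a..b, -φ'' x / φ' x ^ 2 = (φ' b)⁻¹ - (φ' a)⁻¹ := by
      refine intervalIntegral.integral_eq_sub_of_hasDerivAt
        (fun x hx => (hφ' x hx).inv (h0 x hx).ne') (ContinuousOn.intervalIntegrable ?_)
      refine hφ''.neg.div (.pow (fun x hx => ?_) 2) fun x hx => pow_ne_zero 2 (h0 x hx).ne'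
      exact (hφ' x hx).continuousAt.continuousWithinAt
    rw [← neg_sub, ← integral_deriv, ← intervalIntegral.integral_neg]
    refine (intervalIntegral.norm_integral_le_integral_norm hab).trans_eq
      (intervalIntegral.integral_congr fun x hx => ?_)
    rw [norm_mul, norm_exp_I_mul_ofReal, norm_mul, norm_inv, Complex.norm_I, Complex.norm_real,
      neg_div, norm_neg, neg_neg, inv_one, mul_one, mul_one,
      Real.norm_of_nonneg (div_nonneg (hφ''0 x hx) (sq_nonneg _))]
  rw [integral_exp_I_mul_eq hφ hφ' hφ'' fun x hx => (h0 x hx).ne']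
  refine (norm_sub_le_of_le (norm_sub_le _ _) norm_remainder).trans_eq ?_
  rw [norm_boundary b Set.right_mem_uIcc, norm_boundary a Set.left_mem_uIcc]
  ring

theorem norm_integral_exp_I_mul_ofReal_le {a b : ℝ} (hab : a ≤ b) (φ : ℝ → ℝ) :
    ‖∫ x in a..b, Complex.exp (Complex.I * φ x)‖ ≤ b - a := by
  refine (intervalIntegral.norm_integral_le_of_norm_le_const (C := 1)
    fun x _ => (norm_exp_I_mul_ofReal _).le).trans_eq ?_
  rw [one_mul, abs_of_nonneg (sub_nonneg.2 hab)]

theorem norm_integral_exp_neg_cos_tail_le {δ r : ℝ} (hδ : 0 < δ) (hδ' : δ ≤ Real.pi / 2)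
    (hr : r * δ ^ 2 = 1) :
    ‖∫ θ in δ..(Real.pi / 2), Complex.exp (Complex.I * (-r * Real.cos θ : ℝ))‖ ≤ 4 * δ := by
  have hr0 : 0 < r := pos_of_mul_pos_left (hr ▸ one_pos) (sq_nonneg δ)
  have hsin : ∀ θ ∈ Set.Icc δ (Real.pi / 2), 0 < r * Real.sin θ := fun θ hθ =>
    mul_pos hr0 (Real.sin_pos_of_pos_of_lt_pi (by linarith [hθ.1]) (by linarith [hθ.2, hδ]))
  refine (norm_integral_exp_I_mul_le_two_div hδ' (φ' := fun θ => r * Real.sin θ)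
    (φ'' := fun θ => r * Real.cos θ) (fun θ _ => ?_)
    (fun θ _ => (Real.hasDerivAt_sin θ).const_mul r) (by fun_prop)
    (fun θ hθ => mul_nonneg hr0.le (Real.cos_nonneg_of_neg_pi_div_two_le_of_le
      (by linarith [hθ.1]) hθ.2)) hsin).trans ?_
  · simpa only [neg_mul_neg] using (Real.hasDerivAt_cos θ).const_mul (-r)
  · have hδsin : δ / 2 ≤ Real.sin δ := by
      refine le_trans ?_ (Real.mul_le_sin hδ.le hδ')
      rw [div_mul_eq_mul_div, div_le_div_iff₀ two_pos Real.pi_pos]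
      nlinarith [Real.pi_le_four]
    rw [div_le_iff₀ (hsin δ ⟨le_rfl, hδ'⟩)]
    calc (2 : ℝ) = 4 * δ * (r * (δ / 2)) := by linear_combination -2 * hr
      _ ≤ 4 * δ * (r * Real.sin δ) := by gcongr

theorem norm_integral_exp_mul_cos_eq (a b z : ℝ) :
    ‖∫ θ in a..b, Complex.exp (Complex.I * (z * Real.cos θ : ℝ))‖ =
      ‖∫ θ in a..b, Complex.exp (Complex.I * (-|z| * Real.cos θ : ℝ))‖ := by
  rcases abs_choice z with h | h
  · rw [h, ← RCLike.norm_conj, ← intervalIntegral.intervalIntegral_conj]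
    simp only [← Complex.exp_conj, map_mul, Complex.conj_I, Complex.conj_ofReal, neg_mul,
      Complex.ofReal_neg, mul_neg]
  · rw [h, neg_neg]

theorem norm_integral_exp_cos_quarter_le {δ z : ℝ} (hδ : 0 < δ) (hz : |z| * δ ^ 2 = 1) :
    ‖∫ θ in 0..(Real.pi / 2), Complex.exp (Complex.I * (z * Real.cos θ : ℝ))‖ ≤ 5 * δ := by
  rw [norm_integral_exp_mul_cos_eq]
  have hcont : Continuous fun θ : ℝ => Complex.exp (Complex.I * (-|z| * Real.cos θ : ℝ)) := by
    fun_prop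
  rcases le_total (Real.pi / 2) δ with h | h
  · refine (norm_integral_exp_I_mul_ofReal_le (by positivity) _).trans ?_
    linarith
  · rw [← intervalIntegral.integral_add_adjacent_intervals (b := δ)
      (hcont.intervalIntegrable _ _) (hcont.intervalIntegrable _ _)]
    refine (norm_add_le_of_le (norm_integral_exp_I_mul_ofReal_le hδ.le _)
      (norm_integral_exp_neg_cos_tail_le hδ h hz)).trans_eq ?_
    ring

theorem integral_comp_cos_add {E : Type*} [NormedAddCommGroup E] [NormedSpace ℝ E] {q : ℝ → E}
    (hq : Continuous q) (α : ℝ) :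
    ∫ θ in 0..(2 * Real.pi), q (Real.cos (θ + α)) =
      (2 : ℝ) • ((∫ θ in 0..(Real.pi / 2), q (Real.cos θ)) +
        ∫ θ in 0..(Real.pi / 2), q (-Real.cos θ)) := by
  have hi : ∀ a b, IntervalIntegrable (fun θ => q (Real.cos θ)) volume a b :=
    fun a b => (hq.comp Real.continuous_cos).intervalIntegrable a b
  have periodic : Function.Periodic (fun θ => q (Real.cos θ)) (2 * Real.pi) := fun θ => by
    simp only [Real.cos_add_two_pi]
  have second_quarter : ∫ θ in (Real.pi / 2)..Real.pi, q (Real.cos θ) =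
      ∫ θ in 0..(Real.pi / 2), q (-Real.cos θ) := by
    have := intervalIntegral.integral_comp_sub_left (a := 0) (b := Real.pi / 2)
      (fun θ => q (Real.cos θ)) Real.pi
    simpa only [Real.cos_pi_sub, sub_zero, sub_half] using this.symm
  have second_half : ∫ θ in Real.pi..(2 * Real.pi), q (Real.cos θ) =
      ∫ θ in 0..Real.pi, q (Real.cos θ) := by
    have := intervalIntegral.integral_comp_sub_left (a := 0) (b := Real.pi)
      (fun θ => q (Real.cos θ)) (2 * Real.pi)
    rw [show 2 * Real.pi - Real.pi = Real.pi by ring, sub_zero] at this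
    simpa only [Real.cos_two_pi_sub] using this.symm
  rw [intervalIntegral.integral_comp_add_right (fun θ => q (Real.cos θ)), zero_add,
    add_comm (2 * Real.pi) α, periodic.intervalIntegral_add_eq α 0, zero_add,
    ← intervalIntegral.integral_add_adjacent_intervals (hi 0 Real.pi) (hi _ _), second_half,
    ← intervalIntegral.integral_add_adjacent_intervals (hi 0 (Real.pi / 2)) (hi _ _),
    second_quarter, two_smul]

theorem sqrt_mul_norm_integral_exp_cos_le (z α : ℝ) :
    √|z| * ‖∫ θ in 0..(2 * Real.pi), Complex.exp (Complex.I * (z * Real.cos (θ + α) : ℝ))‖ ≤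
      20 := by
  rcases eq_or_ne z 0 with rfl | hz0
  · simp
  have hzpos : 0 < √|z| := Real.sqrt_pos.2 (abs_pos.2 hz0)
  have hδ : |z| * (√|z|)⁻¹ ^ 2 = 1 := by
    rw [inv_pow, Real.sq_sqrt (abs_nonneg z), mul_inv_cancel₀ (abs_pos.2 hz0).ne']
  rw [integral_comp_cos_add (q := fun c => Complex.exp (Complex.I * (z * c : ℝ))) (by fun_prop),
    norm_smul]
  simp only [mul_neg, ← neg_mul]
  calc _ ≤ √|z| * (‖(2 : ℝ)‖ * (5 * (√|z|)⁻¹ + 5 * (√|z|)⁻¹)) := by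
        gcongr
        exact norm_add_le_of_le (norm_integral_exp_cos_quarter_le (inv_pos.2 hzpos) hδ)
          (norm_integral_exp_cos_quarter_le (inv_pos.2 hzpos) (by rwa [abs_neg]))
    _ = 20 := by
      rw [Real.norm_ofNat]
      field_simp
      norm_num

end OscillatoryIntegral

section GaussianKernel

variable {V : Type*} [NormedAddCommGroup V] [InnerProductSpace ℝ V]

/-- The Fourier transform of the Gaussian `e^{-b|ξ|²}`. -/
def gaussianKernel (b : ℂ) (v : V) : ℂ :=
  (Real.pi / b) ^ (Module.finrank ℝ V / 2 : ℂ) * Complex.exp (-Real.pi ^ 2 * ‖v‖ ^ 2 / b)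

theorem norm_gaussianKernel_le {b : ℂ} (hb : 0 ≤ b.re) (v : V) :
    ‖gaussianKernel b v‖ ≤ (Real.pi / ‖b‖) ^ (Module.finrank ℝ V / 2 : ℝ) := by
  have norm_factor : ‖(Real.pi / b : ℂ) ^ (Module.finrank ℝ V / 2 : ℂ)‖ =
      (Real.pi / ‖b‖) ^ (Module.finrank ℝ V / 2 : ℝ) := by
    have hexp : (Module.finrank ℝ V / 2 : ℂ) = ((Module.finrank ℝ V / 2 : ℝ) : ℂ) := by
      push_cast
      rfl
    rw [hexp, Complex.norm_cpow_real, norm_div, Complex.norm_real,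
      Real.norm_of_nonneg Real.pi_pos.le]
  rw [gaussianKernel, norm_mul, norm_factor]
  refine mul_le_of_le_one_right (by positivity) ?_
  have hexponent : -(Real.pi : ℂ) ^ 2 * (‖v‖ : ℂ) ^ 2 / b =
      ((-(Real.pi ^ 2 * ‖v‖ ^ 2) : ℝ) : ℂ) * b⁻¹ := by
    push_cast
    ring
  rw [Complex.norm_exp, Real.exp_le_one_iff, hexponent, Complex.re_ofReal_mul, Complex.inv_re,
    neg_mul, Left.neg_nonpos_iff]
  exact mul_nonneg (by positivity) (div_nonneg hb (Complex.normSq_nonneg _))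

theorem continuousAt_gaussianKernel {b : ℂ} (hb : 0 ≤ b.re) (hb0 : b ≠ 0) (v : V) :
    ContinuousAt (fun b => gaussianKernel b v) b := by
  have slit : (Real.pi : ℂ) / b ∈ Complex.slitPlane := by
    have hnormSq : 0 < Complex.normSq b := Complex.normSq_pos.2 hb0
    rw [div_eq_mul_inv, Complex.mem_slitPlane_iff, Complex.re_ofReal_mul, Complex.im_ofReal_mul,
      Complex.inv_re, Complex.inv_im]
    rcases hb.lt_or_eq with hre | hre
    · exact .inl (by positivity)
    · have him : b.im ≠ 0 := fun him => hb0 (Complex.ext hre.symm him)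
      exact .inr (mul_ne_zero Real.pi_ne_zero (div_ne_zero (neg_ne_zero.2 him) hnormSq.ne'))
  unfold gaussianKernel
  fun_prop (disch := assumption)

theorem continuous_gaussianKernel (b : ℂ) : Continuous (gaussianKernel b : V → ℂ) := by
  unfold gaussianKernel
  simp only [div_eq_mul_inv]
  fun_prop

variable [FiniteDimensional ℝ V] [MeasurableSpace V] [BorelSpace V]

theorem integral_exp_I_inner_mul_gaussian {b : ℂ} (hb : 0 < b.re) (v : V) :
    ∫ ξ : V, Complex.exp (Complex.I * (2 * Real.pi * inner ℝ v ξ : ℝ)) *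
      Complex.exp (-b * ‖ξ‖ ^ 2) = gaussianKernel b v := by
  have hexponent : (2 * Real.pi * Complex.I) ^ 2 * (‖v‖ : ℂ) ^ 2 / (4 * b) =
      -Real.pi ^ 2 * (‖v‖ : ℂ) ^ 2 / b := by
    rw [show (2 * (Real.pi : ℂ) * Complex.I) ^ 2 * (‖v‖ : ℂ) ^ 2 =
      4 * (-Real.pi ^ 2 * (‖v‖ : ℂ) ^ 2) by rw [mul_pow, Complex.I_sq]; ring,
      mul_div_mul_left _ _ (by norm_num)]
  rw [gaussianKernel, ← hexponent,
    ← GaussianFourier.integral_cexp_neg_mul_sq_norm_add hb (2 * Real.pi * Complex.I) v]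
  refine integral_congr_ae (.of_forall fun ξ => ?_)
  simp only [← Complex.exp_add]
  push_cast
  ring_nf

theorem fourier_mul_conj_fourier_eq (ψ φ : V → ℂ) (ξ : V) :
    𝓕 ψ ξ * starRingEnd ℂ (𝓕 φ ξ) = ∫ z : V × V,
      Complex.exp (Complex.I * (2 * Real.pi * inner ℝ (z.1 - z.2) ξ : ℝ)) *
        (starRingEnd ℂ (φ z.1) * ψ z.2) := by
  rw [Real.fourier_eq', Real.fourier_eq', ← integral_conj, mul_comm, ← integral_prod_mul]
  refine integral_congr_ae (.of_forall fun z => ?_)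
  simp only [smul_eq_mul, map_mul, ← Complex.exp_conj, Complex.conj_I, Complex.conj_ofReal]
  rw [mul_mul_mul_comm, ← Complex.exp_add, inner_sub_left]
  push_cast
  ring_nf

theorem integrable_conj_mul_prod {ψ φ : V → ℂ} (hψ : Integrable ψ) (hφ : Integrable φ) :
    Integrable fun z : V × V => starRingEnd ℂ (φ z.1) * ψ z.2 :=
  (Complex.conjLIE.toContinuousLinearEquiv.toContinuousLinearMap.integrable_comp hφ).mul_prod hψ

theorem integral_gaussian_mul_fourier_of_re_pos {ψ φ : V → ℂ} (hψ : Integrable ψ)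
    (hφ : Integrable φ) {b : ℂ} (hb : 0 < b.re) :
    ∫ ξ : V, Complex.exp (-b * ‖ξ‖ ^ 2) * (𝓕 ψ ξ * starRingEnd ℂ (𝓕 φ ξ)) =
      ∫ z : V × V, gaussianKernel b (z.1 - z.2) * (starRingEnd ℂ (φ z.1) * ψ z.2) := by
  set e : V → V × V → ℂ := fun ξ z =>
    Complex.exp (Complex.I * (2 * Real.pi * inner ℝ (z.1 - z.2) ξ : ℝ)) with he
  have hg : Integrable fun ξ : V => Complex.exp (-b * ‖ξ‖ ^ 2) := by
    simpa only [zero_mul, add_zero] using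
      GaussianFourier.integrable_cexp_neg_mul_sq_norm_add hb 0 (0 : V)
  have hi : Integrable (Function.uncurry fun (ξ : V) (z : V × V) =>
      e ξ z * (Complex.exp (-b * ‖ξ‖ ^ 2) * (starRingEnd ℂ (φ z.1) * ψ z.2)))
      (volume.prod volume) := by
    refine (hg.mul_prod (integrable_conj_mul_prod hψ hφ)).bdd_mul (c := 1)
      (f := Function.uncurry e) (Continuous.aestronglyMeasurable ?_)
      (.of_forall fun p => (norm_exp_I_mul_ofReal _).le)
    simp only [he]
    fun_prop
  calc _ = ∫ ξ : V, ∫ z : V × V,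
        e ξ z * (Complex.exp (-b * ‖ξ‖ ^ 2) * (starRingEnd ℂ (φ z.1) * ψ z.2)) := by
        simp only [fourier_mul_conj_fourier_eq, ← integral_const_mul, mul_left_comm, he]
    _ = ∫ z : V × V, ∫ ξ : V,
        e ξ z * (Complex.exp (-b * ‖ξ‖ ^ 2) * (starRingEnd ℂ (φ z.1) * ψ z.2)) :=
        integral_integral_swap hi
    _ = _ := by
        simp only [← mul_assoc, integral_mul_const, he, integral_exp_I_inner_mul_gaussian hb]

theorem continuousOn_integral_gaussian_mul {h : V → ℂ} (hh : Integrable h) :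
    ContinuousOn (fun b : ℂ => ∫ ξ : V, Complex.exp (-b * ‖ξ‖ ^ 2) * h ξ) {b | 0 ≤ b.re} := by
  refine continuousOn_of_dominated (bound := fun ξ => ‖h ξ‖) (fun b _ => ?_) (fun b hb => ?_)
    hh.norm (.of_forall fun ξ => by fun_prop)
  · have : Continuous fun ξ : V => Complex.exp (-b * ‖ξ‖ ^ 2) := by fun_prop
    exact this.aestronglyMeasurable.mul hh.aestronglyMeasurable
  · refine .of_forall fun ξ => ?_
    rw [norm_mul]
    refine mul_le_of_le_one_left (norm_nonneg _) ?_
    rw [Complex.norm_exp, Real.exp_le_one_iff, ← Complex.ofReal_pow, Complex.re_mul_ofReal,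
      Complex.neg_re, neg_mul, Left.neg_nonpos_iff]
    exact mul_nonneg hb (sq_nonneg _)

theorem continuousWithinAt_integral_gaussianKernel_mul {h : V × V → ℂ} (hh : Integrable h) {b : ℂ}
    (hb : 0 ≤ b.re) (hb0 : b ≠ 0) :
    ContinuousWithinAt (fun b : ℂ => ∫ z : V × V, gaussianKernel b (z.1 - z.2) * h z)
      {b | 0 ≤ b.re} b := by
  have far_from_zero : ∀ᶠ b' in nhdsWithin b {b | 0 ≤ b.re}, ‖b‖ / 2 < ‖b'‖ :=
    nhdsWithin_le_nhds (continuous_norm.continuousAt.eventually_const_lt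
      (half_lt_self (norm_pos_iff.2 hb0)))
  refine continuousWithinAt_of_dominated
    (bound := fun z => (Real.pi / (‖b‖ / 2)) ^ (Module.finrank ℝ V / 2 : ℝ) * ‖h z‖)
    (.of_forall fun b' => ?_) ?_ (hh.norm.const_mul _) (.of_forall fun z => ?_)
  · exact ((continuous_gaussianKernel b').comp (by fun_prop)).aestronglyMeasurable.mul
      hh.aestronglyMeasurable
  · filter_upwards [far_from_zero, self_mem_nhdsWithin] with b' hb' hre
    have : 0 < ‖b‖ / 2 := half_pos (norm_pos_iff.2 hb0)
    refine .of_forall fun z => ?_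
    rw [norm_mul]
    refine mul_le_mul_of_nonneg_right ((norm_gaussianKernel_le hre _).trans ?_) (norm_nonneg _)
    gcongr
  · exact ((continuousAt_gaussianKernel hb hb0 _).mul continuousAt_const).continuousWithinAt

theorem integral_gaussian_mul_fourier_eq {ψ φ : V → ℂ} (hψ : Integrable ψ) (hφ : Integrable φ)
    (hi : Integrable fun ξ => 𝓕 ψ ξ * starRingEnd ℂ (𝓕 φ ξ)) {b : ℂ} (hb : 0 ≤ b.re)
    (hb0 : b ≠ 0) :
    ∫ ξ : V, Complex.exp (-b * ‖ξ‖ ^ 2) * (𝓕 ψ ξ * starRingEnd ℂ (𝓕 φ ξ)) =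
      ∫ z : V × V, gaussianKernel b (z.1 - z.2) * (starRingEnd ℂ (φ z.1) * ψ z.2) := by
  have regularize : Filter.Tendsto (fun ε : ℝ => b + ε) (nhdsWithin 0 (Set.Ioi 0))
      (nhdsWithin b {b | 0 ≤ b.re}) := by
    refine tendsto_nhdsWithin_iff.2 ⟨?_, ?_⟩
    · refine Filter.Tendsto.mono_left ?_ nhdsWithin_le_nhds
      simpa using (by fun_prop : Continuous fun ε : ℝ => b + ε).tendsto 0
    · filter_upwards [self_mem_nhdsWithin] with ε hε
      simpa using add_nonneg hb (le_of_lt hε)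
  refine tendsto_nhds_unique
    ((continuousOn_integral_gaussian_mul hi b hb).tendsto.comp regularize)
    (((continuousWithinAt_integral_gaussianKernel_mul (integrable_conj_mul_prod hψ hφ) hb
      hb0).tendsto.comp regularize).congr' ?_)
  filter_upwards [self_mem_nhdsWithin] with ε hε
  refine (integral_gaussian_mul_fourier_of_re_pos hψ hφ ?_).symm
  simpa using add_pos_of_nonneg_of_pos hb hε

end GaussianKernel

section Rotation

/-- The rotation of the plane by the angle `θ`, transported from `ℂ`. -/
def rot (θ : ℝ) : Plane ≃ₗᵢ[ℝ] Plane :=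
  Complex.orthonormalBasisOneI.repr.symm.trans
    ((rotation (Circle.exp θ)).trans Complex.orthonormalBasisOneI.repr)

theorem continuous_rot : Continuous fun p : ℝ × Plane => rot p.1 p.2 := by
  simp only [rot, LinearIsometryEquiv.trans_apply, rotation_apply]
  exact Complex.orthonormalBasisOneI.repr.continuous.comp
    ((Continuous.subtype_val (Circle.exp.continuous.comp continuous_fst)).mul
      (Complex.orthonormalBasisOneI.repr.symm.continuous.comp continuous_snd))

theorem rot_symm (θ : ℝ) : (rot θ).symm = rot (-θ) := by
  ext x : 1
  simp only [rot, LinearIsometryEquiv.symm_trans, LinearIsometryEquiv.symm_symm, rotation_symm,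
    Circle.exp_neg, LinearIsometryEquiv.trans_apply]

theorem continuous_rot_symm : Continuous fun p : ℝ × Plane => (rot p.1).symm p.2 := by
  simp only [rot_symm]
  exact continuous_rot.comp (g := fun p : ℝ × Plane => rot p.1 p.2)
    (f := fun p : ℝ × Plane => (-p.1, p.2)) (by fun_prop)

theorem periodic_rot : Function.Periodic rot (2 * Real.pi) := fun θ => by
  rw [rot, Circle.periodic_exp θ, rot]

theorem inner_exp_mul_eq_norm_mul_norm_mul_cos (z w : ℂ) (θ : ℝ) :
    inner ℝ ((Circle.exp θ : ℂ) * z) w = ‖z‖ * ‖w‖ * Real.cos (θ + (z.arg - w.arg)) := by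
  have polar : starRingEnd ℂ (Circle.exp θ * z) * w =
      ((‖z‖ * ‖w‖ : ℝ) : ℂ) * Complex.exp ((-(θ + (z.arg - w.arg)) : ℝ) * Complex.I) := by
    conv_lhs => rw [← Complex.norm_mul_exp_arg_mul_I z, ← Complex.norm_mul_exp_arg_mul_I w]
    simp only [Circle.coe_exp, map_mul, ← Complex.exp_conj, Complex.conj_ofReal, Complex.conj_I]
    push_cast
    rw [show -((θ : ℂ) + (z.arg - w.arg)) * Complex.I =
      θ * -Complex.I + z.arg * -Complex.I + w.arg * Complex.I by ring, Complex.exp_add,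
      Complex.exp_add]
    ring
  rw [Complex.inner, mul_comm, polar, Complex.re_ofReal_mul, Complex.exp_ofReal_mul_I_re,
    Real.cos_neg]

theorem exists_inner_rot_eq (x y : Plane) :
    ∃ α : ℝ, ∀ θ, inner ℝ (rot θ x) y = ‖x‖ * ‖y‖ * Real.cos (θ + α) := by
  set e := Complex.orthonormalBasisOneI.repr.symm with he
  refine ⟨(e x).arg - (e y).arg, fun θ => ?_⟩
  rw [← e.inner_map_map, ← e.norm_map x, ← e.norm_map y, ← inner_exp_mul_eq_norm_mul_norm_mul_cos]
  simp only [rot, he, LinearIsometryEquiv.trans_apply, rotation_apply,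
    LinearIsometryEquiv.symm_apply_apply]

end Rotation

section TestDensity

variable {E : Type*} [NormedAddCommGroup E] [MeasurableSpace E]

/-- Bounded measurable functions of compact support: the class of densities against which the
supremum norm of a locally integrable function is tested. -/
structure IsTestDensity (ρ : E → ℝ) : Prop where
  measurable : Measurable ρ
  exists_abs_le : ∃ c, ∀ x, |ρ x| ≤ c
  hasCompactSupport : HasCompactSupport ρ

namespace IsTestDensity

variable {ρ : E → ℝ}

theorem memLp_ofReal (hρ : IsTestDensity ρ) (p : ℝ≥0∞) (μ : Measure E)
    [IsFiniteMeasureOnCompacts μ] : MemLp (fun x => (ρ x : ℂ)) p μ := by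
  obtain ⟨c, hc⟩ := hρ.exists_abs_le
  exact (hρ.hasCompactSupport.memLp_of_bound hρ.measurable.aestronglyMeasurable c
    (.of_forall hc)).ofReal

theorem continuous_mul [OpensMeasurableSpace E] (hρ : IsTestDensity ρ) {w : E → ℝ}
    (hw : Continuous w) : IsTestDensity fun x => w x * ρ x := by
  obtain ⟨c, hc⟩ := hρ.exists_abs_le
  obtain ⟨d, hd⟩ := hρ.hasCompactSupport.isCompact.exists_bound_of_continuousOn hw.continuousOn
  refine ⟨hw.measurable.mul hρ.measurable, ⟨|d| * c, fun x => ?_⟩, hρ.hasCompactSupport.mul_left⟩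
  rw [abs_mul]
  by_cases hx : ρ x = 0
  · rw [hx, abs_zero, mul_zero]
    exact mul_nonneg (abs_nonneg d) ((abs_nonneg _).trans (hc x))
  · exact mul_le_mul ((hd x (subset_tsupport ρ hx)).trans (le_abs_self d)) (hc x) (abs_nonneg _)
      (abs_nonneg d)

theorem exists_eq_zero (hρ : IsTestDensity ρ) : ∃ R, ∀ x, R < ‖x‖ → ρ x = 0 := by
  obtain ⟨R, hR⟩ := hρ.hasCompactSupport.isCompact.isBounded.subset_closedBall 0
  refine ⟨R, fun x hx => image_eq_zero_of_notMem_tsupport fun hmem => ?_⟩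
  exact hx.not_ge (mem_closedBall_zero_iff.1 (hR hmem))

end IsTestDensity

end TestDensity

section RadialMean

variable {E : Type*} [NormedAddCommGroup E] [NormedSpace ℝ E]

/-- The average of a function over the rotations of the plane. -/
def radialMean (f : Plane → E) (x : Plane) : E :=
  (2 * Real.pi)⁻¹ • ∫ θ in 0..(2 * Real.pi), f (rot θ x)

theorem radialMean_eq_integral_symm (f : Plane → E) (x : Plane) :
    radialMean f x = (2 * Real.pi)⁻¹ • ∫ θ in 0..(2 * Real.pi), f ((rot θ).symm x) := by
  have periodic : Function.Periodic (fun θ => f (rot θ x)) (2 * Real.pi) := fun θ => by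
    simp only [periodic_rot θ]
  simp only [rot_symm]
  rw [intervalIntegral.integral_comp_neg fun θ => f (rot θ x), radialMean, neg_zero]
  have := periodic.intervalIntegral_add_eq (-(2 * Real.pi)) 0
  rw [neg_add_cancel, zero_add] at this
  rw [this]

theorem radialMean_norm_mul (w : ℝ → ℝ) (ρ : Plane → ℝ) (x : Plane) :
    radialMean (fun y => w ‖y‖ * ρ y) x = w ‖x‖ * radialMean ρ x := by
  simp only [radialMean, LinearIsometryEquiv.norm_map, intervalIntegral.integral_const_mul,
    smul_eq_mul, mul_left_comm]

theorem measurable_radialMean {ρ : Plane → ℝ} (hρ : Measurable ρ) : Measurable (radialMean ρ) := by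
  have uncurried : StronglyMeasurable fun p : ℝ × Plane => ρ (rot p.1 p.2) :=
    (hρ.comp continuous_rot.measurable).stronglyMeasurable
  unfold radialMean
  simp_rw [intervalIntegral.integral_of_le (show 0 ≤ 2 * Real.pi by positivity)]
  exact uncurried.integral_prod_left'.measurable.const_mul _

theorem norm_radialMean_le {f : Plane → E} {c : ℝ} (hc : ∀ x, ‖f x‖ ≤ c) (x : Plane) :
    ‖radialMean f x‖ ≤ c := by
  have := intervalIntegral.norm_integral_le_of_norm_le_const (a := 0) (b := 2 * Real.pi)
    (f := fun θ => f (rot θ x)) fun θ _ => hc _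
  rw [sub_zero, abs_of_pos (by positivity), mul_comm c] at this
  rwa [radialMean, norm_smul, Real.norm_of_nonneg (by positivity), inv_mul_le_iff₀ (by positivity)]

theorem IsTestDensity.radialMean {ρ : Plane → ℝ} (hρ : IsTestDensity ρ) :
    IsTestDensity (radialMean ρ) := by
  obtain ⟨c, hc⟩ := hρ.exists_abs_le
  obtain ⟨R, hR⟩ := hρ.exists_eq_zero
  refine ⟨measurable_radialMean hρ.measurable, ⟨c, norm_radialMean_le (E := ℝ) hc⟩,
    .intro (isCompact_closedBall 0 R) fun x hx => ?_⟩
  have vanish : ∀ θ, ρ (rot θ x) = 0 := fun θ => hR _ (by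
    rwa [LinearIsometryEquiv.norm_map, ← not_le, ← mem_closedBall_zero_iff])
  simp only [WeightedStrichartz.radialMean, vanish, intervalIntegral.integral_zero, smul_zero]

theorem enorm_radialMean_le (f : Plane → E) (x : Plane) :
    ‖radialMean f x‖ₑ ≤ ENNReal.ofReal (2 * Real.pi)⁻¹ *
      ∫⁻ θ in Set.Ioc 0 (2 * Real.pi), ‖f (rot θ x)‖ₑ := by
  rw [radialMean, enorm_smul, Real.enorm_of_nonneg (by positivity),
    intervalIntegral.integral_of_le (by positivity)]
  gcongr
  exact enorm_integral_le_lintegral_enorm _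

theorem lintegral_enorm_radialMean_le {ρ : Plane → ℝ} (hρ : Measurable ρ) :
    ∫⁻ x, ‖radialMean ρ x‖ₑ ≤ ∫⁻ x, ‖ρ x‖ₑ := by
  have uncurried : Measurable fun p : Plane × ℝ => ‖ρ (rot p.2 p.1)‖ₑ :=
    (hρ.comp (continuous_rot.measurable.comp measurable_swap)).enorm
  calc ∫⁻ x, ‖radialMean ρ x‖ₑ
      ≤ ∫⁻ x, ENNReal.ofReal (2 * Real.pi)⁻¹ *
          ∫⁻ θ in Set.Ioc 0 (2 * Real.pi), ‖ρ (rot θ x)‖ₑ :=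
        lintegral_mono fun x => enorm_radialMean_le ρ x
    _ = ENNReal.ofReal (2 * Real.pi)⁻¹ *
          ∫⁻ θ in Set.Ioc 0 (2 * Real.pi), ∫⁻ x, ‖ρ (rot θ x)‖ₑ := by
        rw [lintegral_const_mul _ uncurried.lintegral_prod_right', lintegral_lintegral_swap]
        exact uncurried.aemeasurable
    _ = ENNReal.ofReal (2 * Real.pi)⁻¹ *
          ∫⁻ θ in Set.Ioc 0 (2 * Real.pi), ∫⁻ x, ‖ρ x‖ₑ := by
        simp only [fun θ => (rot θ).measurePreserving.lintegral_comp hρ.enorm]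
    _ = ∫⁻ x, ‖ρ x‖ₑ := by
        rw [setLIntegral_const, Real.volume_Ioc, sub_zero, mul_left_comm,
          ← ENNReal.ofReal_mul (by positivity), inv_mul_cancel₀ (by positivity),
          ENNReal.ofReal_one, mul_one]

theorem measurePreserving_rot_symm (μ : Measure ℝ) [SFinite μ] :
    MeasurePreserving (fun p : ℝ × Plane => (p.1, (rot p.1).symm p.2)) (μ.prod volume)
      (μ.prod volume) :=
  (MeasurePreserving.id μ).skew_product continuous_rot_symm.measurable
    (.of_forall fun θ => (rot θ).symm.measurePreserving.map_eq)

variable {ρ : Plane → ℝ} {F : Plane → ℂ}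

theorem integrable_mul_comp_rot (hρ : IsTestDensity ρ) (hF : LocallyIntegrable F) :
    Integrable (fun p : ℝ × Plane => F p.2 * (ρ (rot p.1 p.2) : ℂ))
      ((volume.restrict (Set.Ioc 0 (2 * Real.pi))).prod volume) := by
  obtain ⟨c, hc⟩ := hρ.exists_abs_le
  obtain ⟨R, hR⟩ := hρ.exists_eq_zero
  have localized : Integrable ((Metric.closedBall (0 : Plane) R).indicator F) :=
    (integrable_indicator_iff Metric.isClosed_closedBall.measurableSet).2
      (hF.integrableOn_isCompact (isCompact_closedBall 0 R))
  have factored : (fun p : ℝ × Plane => F p.2 * (ρ (rot p.1 p.2) : ℂ)) =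
      fun p => (ρ (rot p.1 p.2) : ℂ) * (Metric.closedBall (0 : Plane) R).indicator F p.2 := by
    ext p
    by_cases hp : p.2 ∈ Metric.closedBall 0 R
    · rw [Set.indicator_of_mem hp, mul_comm]
    · rw [hR (rot p.1 p.2) (by simpa using hp), Complex.ofReal_zero, mul_zero, zero_mul]
  rw [factored]
  refine (localized.comp_snd _).bdd_mul (c := c) ?_ (.of_forall fun p => ?_)
  · exact (Complex.measurable_ofReal.comp
      (hρ.measurable.comp continuous_rot.measurable)).aestronglyMeasurable
  · rw [Complex.norm_real]
    exact hc _

theorem integrable_comp_rot_symm_mul (hρ : IsTestDensity ρ) (hF : LocallyIntegrable F) :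
    Integrable (fun p : ℝ × Plane => F ((rot p.1).symm p.2) * (ρ p.2 : ℂ))
      ((volume.restrict (Set.Ioc 0 (2 * Real.pi))).prod volume) := by
  have := (measurePreserving_rot_symm _).integrable_comp_of_integrable
    (integrable_mul_comp_rot hρ hF)
  simpa only [Function.comp_def, LinearIsometryEquiv.apply_symm_apply] using this

theorem integral_mul_radialMean (hρ : IsTestDensity ρ) (hF : LocallyIntegrable F) :
    ∫ y, F y * ((radialMean ρ y : ℝ) : ℂ) =
      ((2 * Real.pi)⁻¹ : ℝ) • ∫ θ in 0..(2 * Real.pi), ∫ y, F ((rot θ).symm y) * (ρ y : ℂ) := by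
  have expand : ∀ y, F y * ((radialMean ρ y : ℝ) : ℂ) =
      ((2 * Real.pi)⁻¹ : ℝ) • ∫ θ in Set.Ioc 0 (2 * Real.pi), F y * (ρ (rot θ y) : ℂ) := fun y => by
    rw [radialMean, intervalIntegral.integral_of_le (by positivity), integral_const_mul,
      integral_complex_ofReal, smul_eq_mul, Complex.ofReal_mul, Complex.real_smul, mul_left_comm]
  simp_rw [expand]
  rw [integral_smul, intervalIntegral.integral_of_le (by positivity),
    ← integral_integral_swap (integrable_mul_comp_rot hρ hF)]
  congr 2
  ext θ
  rw [← (rot θ).symm.measurePreserving.integral_comp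
    (rot θ).symm.toHomeomorph.measurableEmbedding]
  simp only [LinearIsometryEquiv.apply_symm_apply]

theorem integral_mul_radialMean_comm (hρ : IsTestDensity ρ) (hF : LocallyIntegrable F) :
    ∫ y, F y * ((radialMean ρ y : ℝ) : ℂ) = ∫ y, radialMean F y * (ρ y : ℂ) := by
  rw [integral_mul_radialMean hρ hF, intervalIntegral.integral_of_le (by positivity),
    integral_integral_swap (integrable_comp_rot_symm_mul hρ hF), ← integral_smul]
  congr 1
  ext y
  rw [radialMean_eq_integral_symm, intervalIntegral.integral_of_le (by positivity),
    integral_mul_const, smul_mul_assoc]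

end RadialMean

section Dispersive

/-- The convolution kernel `(4πit)⁻¹ e^{i|v|²/(4t)}` of `e^{itΔ}` on the plane, for `t ≠ 0`. -/
def schrodingerKernel (t : ℝ) (v : Plane) : ℂ :=
  gaussianKernel (Complex.I * (4 * Real.pi ^ 2 * t : ℝ)) v

theorem schrodingerKernel_eq (t : ℝ) (v : Plane) :
    schrodingerKernel t v =
      (4 * Real.pi * Complex.I * t)⁻¹ * Complex.exp (Complex.I * (‖v‖ ^ 2 / (4 * t) : ℝ)) := by
  rcases eq_or_ne t 0 with rfl | ht
  · simp [schrodingerKernel, gaussianKernel]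
  have htc : (t : ℂ) ≠ 0 := by exact_mod_cast ht
  have hπ : (Real.pi : ℂ) ≠ 0 := by exact_mod_cast Real.pi_ne_zero
  rw [schrodingerKernel, gaussianKernel, finrank_euclideanSpace_fin, Nat.cast_ofNat,
    div_self two_ne_zero, Complex.cpow_one]
  congr 1
  · push_cast
    field_simp
  · congr 1
    push_cast
    field_simp
    rw [Complex.I_sq]
    ring

theorem continuous_schrodingerKernel (t : ℝ) : Continuous (schrodingerKernel t) :=
  continuous_gaussianKernel _

theorem norm_inv_four_mul_pi_mul_I_mul (t : ℝ) :
    ‖(4 * Real.pi * Complex.I * t : ℂ)⁻¹‖ = (4 * Real.pi * |t|)⁻¹ := by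
  rw [norm_inv, norm_mul, norm_mul, norm_mul, Complex.norm_I, Complex.norm_real, Complex.norm_real,
    Complex.norm_ofNat, mul_one, Real.norm_of_nonneg Real.pi_pos.le, Real.norm_eq_abs]

theorem norm_schrodingerKernel (t : ℝ) (v : Plane) :
    ‖schrodingerKernel t v‖ = (4 * Real.pi * |t|)⁻¹ := by
  rw [schrodingerKernel_eq, norm_mul, norm_exp_I_mul_ofReal, mul_one,
    norm_inv_four_mul_pi_mul_I_mul]

theorem exists_schrodingerKernel_sub_rot_eq {t : ℝ} (ht : t ≠ 0) (x y : Plane) :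
    ∃ (c : ℂ) (α : ℝ), ‖c‖ = (4 * Real.pi * |t|)⁻¹ ∧ ∀ θ, schrodingerKernel t (x - rot θ y) =
      c * Complex.exp (Complex.I * (-(‖x‖ * ‖y‖ / (2 * t)) * Real.cos (θ + α) : ℝ)) := by
  obtain ⟨α, hα⟩ := exists_inner_rot_eq y x
  refine ⟨(4 * Real.pi * Complex.I * t)⁻¹ *
    Complex.exp (Complex.I * ((‖x‖ ^ 2 + ‖y‖ ^ 2) / (4 * t) : ℝ)), α, ?_, fun θ => ?_⟩
  · rw [norm_mul, norm_exp_I_mul_ofReal, mul_one, norm_inv_four_mul_pi_mul_I_mul]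
  have cosine_rule : ‖x - rot θ y‖ ^ 2 =
      ‖x‖ ^ 2 + ‖y‖ ^ 2 - 2 * (‖x‖ * ‖y‖ * Real.cos (θ + α)) := by
    rw [norm_sub_sq_real, real_inner_comm, hα θ, LinearIsometryEquiv.norm_map]
    ring
  rw [schrodingerKernel_eq, cosine_rule, mul_assoc _ (Complex.exp _), ← Complex.exp_add,
    ← mul_add, ← Complex.ofReal_add]
  congr 5
  field_simp
  ring

theorem sqrt_norm_mul_norm_radialMean_schrodingerKernel_le {t : ℝ} (ht : t ≠ 0) (x y : Plane) :
    √‖x‖ * √‖y‖ * ‖radialMean (fun y => schrodingerKernel t (x - y)) y‖ ≤ (√|t|)⁻¹ := by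
  obtain ⟨c, α, hc, hK⟩ := exists_schrodingerKernel_sub_rot_eq ht x y
  set z : ℝ := -(‖x‖ * ‖y‖ / (2 * t)) with hz
  set J := ‖∫ θ in 0..(2 * Real.pi), Complex.exp (Complex.I * (z * Real.cos (θ + α) : ℝ))‖ with hJ
  have sqrt_eq : √‖x‖ * √‖y‖ = √2 * √|t| * √|z| := by
    rw [← Real.sqrt_mul (norm_nonneg _), ← Real.sqrt_mul zero_le_two,
      ← Real.sqrt_mul (by positivity), hz, abs_neg, abs_div, abs_mul 2, abs_two,
      abs_of_nonneg (by positivity : 0 ≤ ‖x‖ * ‖y‖)]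
    congr 1
    have := abs_pos.2 ht
    field_simp
  have constant_le_one : 20 * √2 / (8 * Real.pi ^ 2) ≤ 1 := by
    have sqrt_two_le : √2 ≤ 1.5 := by
      rw [Real.sqrt_le_left (by norm_num)]
      norm_num
    rw [div_le_one (by positivity)]
    nlinarith only [Real.pi_gt_three, sqrt_two_le]
  have norm_mean : ‖radialMean (fun y => schrodingerKernel t (x - y)) y‖ =
      (2 * Real.pi)⁻¹ * (4 * Real.pi * |t|)⁻¹ * J := by
    rw [radialMean, norm_smul, Real.norm_of_nonneg (by positivity)]
    simp only [hK, intervalIntegral.integral_const_mul, norm_mul, hc, hJ, mul_assoc]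
  calc √‖x‖ * √‖y‖ * ‖radialMean (fun y => schrodingerKernel t (x - y)) y‖
      = √2 / (8 * Real.pi ^ 2) * (√|t| / |t|) * (√|z| * J) := by
        rw [norm_mean, sqrt_eq]
        field_simp
        ring
    _ ≤ √2 / (8 * Real.pi ^ 2) * (√|t| / |t|) * 20 := by
        gcongr
        exact sqrt_mul_norm_integral_exp_cos_le z α
    _ = 20 * √2 / (8 * Real.pi ^ 2) * (√|t|)⁻¹ := by
        rw [Real.sqrt_div_self', one_div]
        ring
    _ ≤ (√|t|)⁻¹ := mul_le_of_le_one_left (by positivity) constant_le_one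

theorem enorm_sqrt_norm_mul_integral_schrodingerKernel_mul_le {ρ : Plane → ℝ}
    (hρ : IsTestDensity ρ) {t : ℝ} (ht : t ≠ 0) (x : Plane) :
    ‖√‖x‖‖ₑ * ‖∫ y, schrodingerKernel t (x - y) * ((√‖y‖ * radialMean ρ y : ℝ) : ℂ)‖ₑ ≤
      ‖t‖ₑ ^ (-(1 / 2) : ℝ) * ∫⁻ y, ‖ρ y‖ₑ := by
  have hF : LocallyIntegrable fun y => schrodingerKernel t (x - y) :=
    ((continuous_schrodingerKernel t).comp (continuous_const.sub continuous_id)).locallyIntegrable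
  have adjoint : ∫ y, schrodingerKernel t (x - y) * ((√‖y‖ * radialMean ρ y : ℝ) : ℂ) =
      ∫ y, radialMean (fun y => schrodingerKernel t (x - y)) y * ((√‖y‖ * ρ y : ℝ) : ℂ) := by
    rw [← integral_mul_radialMean_comm (hρ.continuous_mul (by fun_prop)) hF]
    simp only [radialMean_norm_mul]
  have pointwise : ∀ y, ‖√‖x‖‖ₑ * (‖√‖y‖‖ₑ *
      ‖radialMean (fun y => schrodingerKernel t (x - y)) y‖ₑ) ≤ ‖t‖ₑ ^ (-(1 / 2) : ℝ) := by
    intro y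
    rw [← mul_assoc, ← enorm_mul, ← ofReal_norm, ← ofReal_norm, ← ofReal_norm t,
      ENNReal.ofReal_rpow_of_pos (norm_pos_iff.2 ht), ← ENNReal.ofReal_mul (norm_nonneg _)]
    refine ENNReal.ofReal_le_ofReal ?_
    rw [norm_mul, Real.norm_of_nonneg (Real.sqrt_nonneg _),
      Real.norm_of_nonneg (Real.sqrt_nonneg _), Real.norm_eq_abs,
      Real.rpow_neg (abs_nonneg t), ← Real.sqrt_eq_rpow]
    exact sqrt_norm_mul_norm_radialMean_schrodingerKernel_le ht x y
  rw [adjoint, ← lintegral_const_mul _ hρ.measurable.enorm]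
  calc _ ≤ ‖√‖x‖‖ₑ * ∫⁻ y, ‖radialMean (fun y => schrodingerKernel t (x - y)) y *
        ((√‖y‖ * ρ y : ℝ) : ℂ)‖ₑ := by
        gcongr
        exact enorm_integral_le_lintegral_enorm _
    _ = ∫⁻ y, ‖√‖x‖‖ₑ * (‖√‖y‖‖ₑ * ‖radialMean (fun y => schrodingerKernel t (x - y)) y‖ₑ) *
        ‖ρ y‖ₑ := by
        rw [← lintegral_const_mul' _ _ enorm_ne_top]
        refine lintegral_congr fun y => ?_
        rw [enorm_mul, ← ofReal_norm ((_ : ℝ) : ℂ), Complex.norm_real, ofReal_norm, enorm_mul]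
        ring
    _ ≤ _ := lintegral_mono fun y => mul_le_mul_left (pointwise y) _

end Dispersive

section FourierL2

variable {V : Type*} [NormedAddCommGroup V] [InnerProductSpace ℝ V] [FiniteDimensional ℝ V]
  [MeasurableSpace V] [BorelSpace V]

theorem toTemperedDistribution_injective {g h : Lp ℂ 2 (volume : Measure V)}
    (H : ∀ φ : 𝓢(V, ℂ), Lp.toTemperedDistribution g φ = Lp.toTemperedDistribution h φ) :
    g = h :=
  LinearMap.ker_eq_bot.1 (Lp.ker_toTemperedDistributionCLM_eq_bot (F := ℂ) (p := 2))
    (by ext φ; exact H φ)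

theorem integrable_mul_conj {α : Type*} [MeasurableSpace α] {μ : Measure α} (g h : Lp ℂ 2 μ) :
    Integrable (fun x => g x * starRingEnd ℂ (h x)) μ :=
  (L2.integrable_inner (𝕜 := ℂ) h g).congr (.of_forall fun x => by simp only [RCLike.inner_apply])

theorem fourier_toLp_ae_eq {g : V → ℂ} (h1 : Integrable g) (h2 : MemLp g 2) :
    (𝓕 (h2.toLp g) : Lp ℂ 2 (volume : Measure V)) =ᵐ[volume] 𝓕 g := by
  have hc : Continuous (𝓕 g) := VectorFourier.fourierIntegral_continuous
    Real.continuous_fourierChar (L := innerₗ V) continuous_inner h1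
  refine ae_eq_of_integral_contDiff_smul_eq ((Lp.memLp _).locallyIntegrable (by norm_num))
    hc.locallyIntegrable fun χ hχ hχc => ?_
  have hχ₁ : HasCompactSupport (Complex.ofRealCLM ∘ χ) := hχc.comp_left rfl
  have hχ₂ : ContDiff ℝ (⊤ : ℕ∞) (Complex.ofRealCLM ∘ χ) := Complex.ofRealCLM.contDiff.comp hχ
  let X : 𝓢(V, ℂ) := hχ₁.toSchwartzMap hχ₂
  have hX : ∀ ξ, X ξ = (χ ξ : ℂ) := fun ξ => rfl
  have distributional : ∫ ξ, X ξ • (𝓕 (h2.toLp g) : Lp ℂ 2 (volume : Measure V)) ξ =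
      ∫ ξ, (𝓕 X) ξ • (h2.toLp g) ξ := by
    rw [← Lp.toTemperedDistribution_apply, ← Lp.toTemperedDistribution_apply,
      ← Lp.fourier_toTemperedDistribution_eq]
    rfl
  have representative : ∫ ξ, (𝓕 X) ξ • (h2.toLp g) ξ = ∫ ξ, (𝓕 (X : V → ℂ)) ξ • g ξ := by
    refine integral_congr_ae ?_
    filter_upwards [h2.coeFn_toLp] with ξ hξ
    rw [hξ, SchwartzMap.fourier_coe]
  have self_adjoint : ∫ ξ, (𝓕 (X : V → ℂ)) ξ • g ξ = ∫ ξ, X ξ • 𝓕 g ξ := by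
    have := VectorFourier.integral_fourierIntegral_smul_eq_flip (L := innerₗ V)
      (μ := volume) (ν := volume) Real.continuous_fourierChar continuous_inner X.integrable h1
    rwa [flip_innerₗ] at this
  simpa only [hX, Complex.coe_smul] using distributional.trans (representative.trans self_adjoint)

theorem eq_of_fourier_ae_eq {g h : Lp ℂ 2 (volume : Measure V)}
    (H : (𝓕 g : Lp ℂ 2 (volume : Measure V)) =ᵐ[volume] (𝓕 h : Lp ℂ 2 (volume : Measure V))) :
    g = h :=
  (Lp.fourierTransformₗᵢ V ℂ).injective (Lp.ext H)

theorem fourier_compMeasurePreserving (e : V ≃ₗᵢ[ℝ] V) (g : Lp ℂ 2 (volume : Measure V)) :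
    𝓕 (Lp.compMeasurePreserving e e.measurePreserving g) =
      Lp.compMeasurePreserving e e.measurePreserving (𝓕 g) := by
  have hF : Continuous fun g : Lp ℂ 2 (volume : Measure V) => 𝓕 g :=
    (Lp.fourierTransformₗᵢ V ℂ).continuous
  have hc := (Lp.isometry_compMeasurePreserving (E := ℂ) (p := 2) e.measurePreserving).continuous
  refine (SchwartzMap.denseRange_toLpCLM (p := 2) ENNReal.ofNat_ne_top).induction_on
    (p := fun g => 𝓕 (Lp.compMeasurePreserving e e.measurePreserving g) =
      Lp.compMeasurePreserving e e.measurePreserving (𝓕 g)) g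
    (isClosed_eq (hF.comp hc) (hc.comp hF)) fun φ => ?_
  have hφ : MemLp φ 2 (volume : Measure V) := φ.memLp 2 volume
  change 𝓕 (Lp.compMeasurePreserving e e.measurePreserving (hφ.toLp φ)) =
    Lp.compMeasurePreserving e e.measurePreserving (𝓕 (hφ.toLp φ))
  rw [Lp.toLp_compMeasurePreserving]
  ext1
  filter_upwards [fourier_toLp_ae_eq (e.measurePreserving.integrable_comp_of_integrable
      φ.integrable) (hφ.comp_measurePreserving e.measurePreserving),
    Lp.coeFn_compMeasurePreserving (𝓕 (hφ.toLp φ)) e.measurePreserving,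
    e.measurePreserving.quasiMeasurePreserving.ae_eq_comp (fourier_toLp_ae_eq φ.integrable hφ)]
    with x h1 h2 h3
  rw [h1, h2, h3]
  exact Real.fourier_comp_linearIsometry e φ x

end FourierL2

section Propagator

theorem norm_schrodingerSymbol (t : ℝ) (ξ : Plane) : ‖schrodingerSymbol t ξ‖ = 1 := by
  rw [schrodingerSymbol, ← mul_neg, ← Complex.ofReal_neg, norm_exp_I_mul_ofReal]

theorem continuous_schrodingerSymbol :
    Continuous fun p : ℝ × Plane => schrodingerSymbol p.1 p.2 := by
  unfold schrodingerSymbol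
  fun_prop

theorem schrodingerSymbol_add (s t : ℝ) (ξ : Plane) :
    schrodingerSymbol (s + t) ξ = schrodingerSymbol s ξ * schrodingerSymbol t ξ := by
  rw [schrodingerSymbol, schrodingerSymbol, schrodingerSymbol, ← Complex.exp_add]
  congr 1
  push_cast
  ring

theorem schrodingerSymbol_zero (ξ : Plane) : schrodingerSymbol 0 ξ = 1 := by
  simp [schrodingerSymbol]

theorem memLp_schrodingerSymbol (t : ℝ) :
    MemLp (schrodingerSymbol t) ∞ (volume : Measure Plane) :=
  memLp_top_of_bound (continuous_schrodingerSymbol.comp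
    (by fun_prop : Continuous fun ξ : Plane => (t, ξ))).aestronglyMeasurable 1
    (.of_forall fun ξ => (norm_schrodingerSymbol t ξ).le)

/-- Square integrable functions on the plane. -/
abbrev L2 : Type := Lp ℂ 2 (volume : Measure Plane)

theorem fourier_fourierInv_schrodingerSymbol_smul (t : ℝ) (g : L2) :
    (𝓕 (𝓕⁻ ((memLp_schrodingerSymbol t).toLp _ • 𝓕 g : L2) : L2) : L2) =ᵐ[volume]
      fun ξ => schrodingerSymbol t ξ * (𝓕 g : L2) ξ := by
  rw [fourier_fourierInv_eq]
  filter_upwards [Lp.coeFn_lpSMul (r := 2) ((memLp_schrodingerSymbol t).toLp _) (𝓕 g : L2),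
    (memLp_schrodingerSymbol t).coeFn_toLp] with ξ h1 h2
  rw [h1, Pi.smul_apply', h2, smul_eq_mul]

/-- The free Schrödinger propagator `e^{itΔ}` as an isometry of `L²`. -/
def propagatorL2 (t : ℝ) : L2 →ₗᵢ[ℂ] L2 where
  toFun g := 𝓕⁻ ((memLp_schrodingerSymbol t).toLp _ • 𝓕 g : L2)
  map_add' g h := by
    rw [FourierTransform.fourier_add, Lp.add_smul, FourierTransform.fourierInv_add]
  map_smul' c g := by
    rw [FourierTransform.fourier_smul, ← Lp.smul_comm, FourierTransform.fourierInv_smul,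
      RingHom.id_apply]
  norm_map' g := by
    change ‖(𝓕⁻ ((memLp_schrodingerSymbol t).toLp _ • 𝓕 g : L2) : L2)‖ = ‖g‖
    rw [← Lp.norm_fourier_eq, ← Lp.norm_fourier_eq g, Lp.norm_def, Lp.norm_def]
    congr 1
    refine eLpNorm_congr_norm_ae ?_
    filter_upwards [fourier_fourierInv_schrodingerSymbol_smul t g] with ξ h
    rw [h, norm_mul, norm_schrodingerSymbol, one_mul]

theorem fourier_propagatorL2 (t : ℝ) (g : L2) :
    (𝓕 (propagatorL2 t g) : L2) =ᵐ[volume] fun ξ => schrodingerSymbol t ξ * (𝓕 g : L2) ξ :=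
  fourier_fourierInv_schrodingerSymbol_smul t g

theorem toTemperedDistribution_propagatorL2 (t : ℝ) (g : L2) :
    Lp.toTemperedDistribution (propagatorL2 t g) = propagator t (Lp.toTemperedDistribution g) := by
  change Lp.toTemperedDistribution (𝓕⁻ ((memLp_schrodingerSymbol t).toLp _ • 𝓕 g : L2) : L2) = _
  rw [← Lp.fourierInv_toTemperedDistribution_eq,
    Lp.toTemperedDistribution_smul_eq (schrodingerSymbol_hasTemperateGrowth t),
    ← Lp.fourier_toTemperedDistribution_eq]
  rfl

theorem propagatorL2_propagatorL2 (s t : ℝ) (g : L2) :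
    propagatorL2 s (propagatorL2 t g) = propagatorL2 (s + t) g := by
  refine eq_of_fourier_ae_eq ?_
  filter_upwards [fourier_propagatorL2 s (propagatorL2 t g), fourier_propagatorL2 t g,
    fourier_propagatorL2 (s + t) g] with ξ h1 h2 h3
  rw [h1, h2, h3, schrodingerSymbol_add, mul_assoc]

theorem propagatorL2_zero (g : L2) : propagatorL2 0 g = g := by
  refine eq_of_fourier_ae_eq ?_
  filter_upwards [fourier_propagatorL2 0 g] with ξ h
  rw [h, schrodingerSymbol_zero, one_mul]

theorem inner_propagatorL2_left (t : ℝ) (g h : L2) :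
    inner ℂ (propagatorL2 t h) g = inner ℂ h (propagatorL2 (-t) g) := by
  rw [← (propagatorL2 (-t)).inner_map_map (propagatorL2 t h), propagatorL2_propagatorL2,
    neg_add_cancel, propagatorL2_zero]

theorem propagatorL2_compMeasurePreserving (e : Plane ≃ₗᵢ[ℝ] Plane) (t : ℝ) (g : L2) :
    propagatorL2 t (Lp.compMeasurePreserving e e.measurePreserving g) =
      Lp.compMeasurePreserving e e.measurePreserving (propagatorL2 t g) := by
  refine eq_of_fourier_ae_eq ?_
  rw [fourier_compMeasurePreserving]
  filter_upwards [fourier_propagatorL2 t (Lp.compMeasurePreserving e e.measurePreserving g),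
    Lp.coeFn_compMeasurePreserving (𝓕 g) e.measurePreserving,
    Lp.coeFn_compMeasurePreserving (𝓕 (propagatorL2 t g)) e.measurePreserving,
    e.measurePreserving.quasiMeasurePreserving.ae_eq_comp (fourier_propagatorL2 t g)]
    with ξ h1 h2 h3 h4
  rw [h1, fourier_compMeasurePreserving, h2, h3, h4, Function.comp_apply, Function.comp_apply,
    schrodingerSymbol, schrodingerSymbol, LinearIsometryEquiv.norm_map]

theorem inner_propagatorL2 (t : ℝ) (g h : L2) :
    inner ℂ h (propagatorL2 t g) =
      ∫ ξ, schrodingerSymbol t ξ * ((𝓕 g : L2) ξ * starRingEnd ℂ ((𝓕 h : L2) ξ)) := by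
  rw [← Lp.inner_fourier_eq, L2.inner_def]
  refine integral_congr_ae ?_
  filter_upwards [fourier_propagatorL2 t g] with ξ hξ
  rw [hξ, RCLike.inner_apply]
  ring

theorem continuous_inner_propagatorL2 (g h : L2) :
    Continuous fun t => inner ℂ h (propagatorL2 t g) := by
  simp_rw [inner_propagatorL2]
  have hi := integrable_mul_conj (𝓕 g : L2) (𝓕 h : L2)
  refine continuous_of_dominated (fun t => ?_) (fun t => .of_forall fun ξ => ?_) hi.norm
    (.of_forall fun ξ => ?_)
  · exact (memLp_schrodingerSymbol t).aestronglyMeasurable.mul hi.aestronglyMeasurable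
  · rw [norm_mul, norm_schrodingerSymbol, one_mul]
  · exact (continuous_schrodingerSymbol.comp (by fun_prop : Continuous fun t : ℝ => (t, ξ))).mul
      continuous_const

theorem norm_propagatorL2_sub_sq (s t : ℝ) (g : L2) :
    ‖propagatorL2 t g - propagatorL2 s g‖ ^ 2 =
      2 * (‖g‖ ^ 2 - (inner ℂ g (propagatorL2 (s - t) g)).re) := by
  rw [@norm_sub_sq ℂ, LinearIsometry.norm_map, LinearIsometry.norm_map, inner_propagatorL2_left,
    propagatorL2_propagatorL2, neg_add_eq_sub, RCLike.re_to_complex]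
  ring

/-- Strong continuity follows from weak continuity, since the propagator preserves the norm. -/
theorem continuous_propagatorL2 (g : L2) : Continuous fun t => propagatorL2 t g := by
  refine continuous_iff_continuousAt.2 fun s => tendsto_iff_norm_sub_tendsto_zero.2 ?_
  have sq_tendsto : Filter.Tendsto (fun t => ‖propagatorL2 t g - propagatorL2 s g‖ ^ 2)
      (nhds s) (nhds 0) := by
    simp_rw [norm_propagatorL2_sub_sq]
    have hc : Continuous fun t => 2 * (‖g‖ ^ 2 - (inner ℂ g (propagatorL2 (s - t) g)).re) :=
      continuous_const.mul (continuous_const.sub (Complex.continuous_re.comp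
        ((continuous_inner_propagatorL2 g g).comp (by fun_prop))))
    convert hc.tendsto s using 2
    rw [sub_self, propagatorL2_zero, ← RCLike.re_to_complex, inner_self_eq_norm_sq, sub_self,
      mul_zero]
  simpa only [Real.sqrt_sq (norm_nonneg _), Real.sqrt_zero] using sq_tendsto.sqrt

end Propagator

section Bilinear

theorem schrodingerSymbol_eq_exp (t : ℝ) (ξ : Plane) :
    schrodingerSymbol t ξ =
      Complex.exp (-(Complex.I * (4 * Real.pi ^ 2 * t : ℝ)) * (‖ξ‖ : ℂ) ^ 2) := by
  rw [schrodingerSymbol]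
  congr 1
  push_cast
  ring

theorem inner_toLp_propagatorL2 {φ ψ : Plane → ℂ} (hφ : Integrable φ) (hψ : Integrable ψ)
    (hφ2 : MemLp φ 2) (hψ2 : MemLp ψ 2) {t : ℝ} (ht : t ≠ 0) :
    inner ℂ (hφ2.toLp φ) (propagatorL2 t (hψ2.toLp ψ)) =
      ∫ x, starRingEnd ℂ (φ x) * ∫ y, schrodingerKernel t (x - y) * ψ y := by
  have fourier_ae_eq : (fun ξ => (𝓕 (hψ2.toLp ψ) : L2) ξ *
      starRingEnd ℂ ((𝓕 (hφ2.toLp φ) : L2) ξ)) =ᵐ[volume]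
      fun ξ => 𝓕 ψ ξ * starRingEnd ℂ (𝓕 φ ξ) := by
    filter_upwards [fourier_toLp_ae_eq hφ hφ2, fourier_toLp_ae_eq hψ hψ2] with ξ h1 h2
    rw [h1, h2]
  have hb : Complex.I * ((4 * Real.pi ^ 2 * t : ℝ) : ℂ) ≠ 0 := by
    simp [Complex.I_ne_zero, Real.pi_ne_zero, ht]
  have product_integrable : Integrable fun z : Plane × Plane =>
      schrodingerKernel t (z.1 - z.2) * (starRingEnd ℂ (φ z.1) * ψ z.2) :=
    ((LinearIsometryEquiv.integrable_comp_iff Complex.conjLIE).2 hφ |>.mul_prod hψ).bdd_mul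
      ((continuous_schrodingerKernel t).comp (by fun_prop)).aestronglyMeasurable
      (.of_forall fun z => (norm_schrodingerKernel t _).le)
  calc inner ℂ (hφ2.toLp φ) (propagatorL2 t (hψ2.toLp ψ))
      = ∫ ξ, Complex.exp (-(Complex.I * (4 * Real.pi ^ 2 * t : ℝ)) * (‖ξ‖ : ℂ) ^ 2) *
          (𝓕 ψ ξ * starRingEnd ℂ (𝓕 φ ξ)) := by
        rw [inner_propagatorL2]
        refine integral_congr_ae ?_
        filter_upwards [fourier_ae_eq] with ξ hξ
        rw [hξ, schrodingerSymbol_eq_exp]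
    _ = ∫ z : Plane × Plane, schrodingerKernel t (z.1 - z.2) *
          (starRingEnd ℂ (φ z.1) * ψ z.2) :=
        integral_gaussian_mul_fourier_eq hψ hφ ((integrable_mul_conj _ _).congr fourier_ae_eq)
          (by rw [mul_comm, Complex.re_ofReal_mul, Complex.I_re, mul_zero]) hb
    _ = ∫ x, starRingEnd ℂ (φ x) * ∫ y, schrodingerKernel t (x - y) * ψ y := by
        rw [Measure.volume_eq_prod, integral_prod _ product_integrable]
        simp only [← integral_const_mul, mul_left_comm]

theorem enorm_inner_toLp_propagatorL2_radialMean_le {ρ σ : Plane → ℝ} (hρ : IsTestDensity ρ)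
    (hσ : IsTestDensity σ) (hρ2 : MemLp (fun y => ((√‖y‖ * radialMean ρ y : ℝ) : ℂ)) 2)
    (hσ2 : MemLp (fun y => ((√‖y‖ * radialMean σ y : ℝ) : ℂ)) 2) {t : ℝ} (ht : t ≠ 0) :
    ‖inner ℂ (hρ2.toLp _) (propagatorL2 t (hσ2.toLp _))‖ₑ ≤
      ‖t‖ₑ ^ (-(1 / 2) : ℝ) * ((∫⁻ x, ‖ρ x‖ₑ) * ∫⁻ x, ‖σ x‖ₑ) := by
  have integrable_weight_mul : ∀ {τ : Plane → ℝ}, IsTestDensity τ →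
      Integrable fun y => ((√‖y‖ * radialMean τ y : ℝ) : ℂ) := fun hτ =>
    memLp_one_iff_integrable.1 ((hτ.radialMean.continuous_mul (by fun_prop)).memLp_ofReal 1 volume)
  rw [inner_toLp_propagatorL2 (integrable_weight_mul hρ) (integrable_weight_mul hσ) hρ2 hσ2 ht]
  calc _ ≤ ∫⁻ x, ‖radialMean ρ x‖ₑ * (‖√‖x‖‖ₑ *
        ‖∫ y, schrodingerKernel t (x - y) * ((√‖y‖ * radialMean σ y : ℝ) : ℂ)‖ₑ) := by
        refine (enorm_integral_le_lintegral_enorm _).trans_eq (lintegral_congr fun x => ?_)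
        rw [Complex.conj_ofReal, enorm_mul, ← ofReal_norm ((_ : ℝ) : ℂ), Complex.norm_real,
          ofReal_norm, enorm_mul]
        ring
    _ ≤ ∫⁻ x, ‖radialMean ρ x‖ₑ * (‖t‖ₑ ^ (-(1 / 2) : ℝ) * ∫⁻ y, ‖σ y‖ₑ) := by
        refine lintegral_mono fun x => mul_le_mul_right ?_ _
        exact enorm_sqrt_norm_mul_integral_schrodingerKernel_mul_le hσ ht x
    _ ≤ (∫⁻ x, ‖ρ x‖ₑ) * (‖t‖ₑ ^ (-(1 / 2) : ℝ) * ∫⁻ y, ‖σ y‖ₑ) := by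
        rw [lintegral_mul_const _ hρ.radialMean.measurable.enorm]
        exact mul_le_mul_left (lintegral_enorm_radialMean_le hρ.measurable) _
    _ = _ := by ring

end Bilinear

section BallDensity

variable {V : Type*} [NormedAddCommGroup V] [InnerProductSpace ℝ V] [FiniteDimensional ℝ V]

/-- The centre of the `n`-th ball of the countable family of balls with centre in a fixed dense
sequence and radius of the form `1 / (j + 1)`. -/
def ballCenter (n : ℕ) : V := TopologicalSpace.denseSeq V n.unpair.1

/-- The radius of the `n`-th ball of the family described in `ballCenter`. -/
def ballRadius (n : ℕ) : ℝ := 1 / ((n.unpair.2 : ℝ) + 1)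

theorem ballRadius_pos (n : ℕ) : 0 < ballRadius n := by
  unfold ballRadius
  positivity

theorem exists_dist_ballCenter_le (x : V) (j : ℕ) :
    ∃ n, dist x (ballCenter n) ≤ ballRadius n ∧ ballRadius n = 1 / ((j : ℝ) + 1) := by
  obtain ⟨k, hk⟩ := (TopologicalSpace.denseRange_denseSeq V).exists_dist_lt x
    (by positivity : 0 < 1 / ((j : ℝ) + 1))
  refine ⟨Nat.pair k j, ?_, ?_⟩ <;> simp only [ballCenter, ballRadius, Nat.unpair_pair]
  exact hk.le

variable [MeasurableSpace V] [BorelSpace V]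

/-- The normalized indicator function of the `n`-th ball of the family described in
`ballCenter`. -/
def ballDensity (n : ℕ) : V → ℝ :=
  (Metric.closedBall (ballCenter n) (ballRadius n)).indicator
    fun _ => (volume.real (Metric.closedBall (ballCenter n : V) (ballRadius n)))⁻¹

theorem isTestDensity_ballDensity (n : ℕ) : IsTestDensity (ballDensity n : V → ℝ) where
  measurable := measurable_const.indicator Metric.isClosed_closedBall.measurableSet
  exists_abs_le := ⟨‖(volume.real (Metric.closedBall (ballCenter n : V) (ballRadius n)))⁻¹‖,
    fun x => norm_indicator_le_norm_self (fun _ : V => (volume.real _)⁻¹) x⟩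
  hasCompactSupport := .of_support_subset_isCompact (isCompact_closedBall _ _)
    Set.support_indicator_subset

theorem lintegral_enorm_ballDensity (n : ℕ) : ∫⁻ x : V, ‖ballDensity n x‖ₑ = 1 := by
  have h0 := (Metric.measure_closedBall_pos volume (ballCenter n : V) (ballRadius_pos n)).ne'
  have h1 : volume (Metric.closedBall (ballCenter n : V) (ballRadius n)) ≠ ∞ :=
    measure_closedBall_lt_top.ne
  simp_rw [ballDensity, enorm_indicator_eq_indicator_enorm]
  rw [lintegral_indicator Metric.isClosed_closedBall.measurableSet, setLIntegral_const,
    Real.enorm_of_nonneg (by positivity), Measure.real, ENNReal.ofReal_inv_of_pos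
      (ENNReal.toReal_pos h0 h1), ENNReal.ofReal_toReal h1, ENNReal.inv_mul_cancel h0 h1]

theorem integral_mul_ballDensity (w : V → ℂ) (n : ℕ) :
    ∫ y, w y * (ballDensity n y : ℂ) =
      ⨍ y in Metric.closedBall (ballCenter n) (ballRadius n), w y := by
  rw [setAverage_eq, ← integral_indicator Metric.isClosed_closedBall.measurableSet, ← integral_smul]
  refine integral_congr_ae (.of_forall fun y => ?_)
  by_cases h : y ∈ Metric.closedBall (ballCenter n) (ballRadius n)
  · simp only [ballDensity, Set.indicator_of_mem h, Complex.real_smul, mul_comm]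
  · simp only [ballDensity, Set.indicator_of_notMem h, Complex.ofReal_zero, mul_zero, smul_zero]

theorem eLpNorm_top_le_iSup_ballDensity {w : V → ℂ} (hw : LocallyIntegrable w) :
    eLpNorm w ∞ volume ≤ ⨆ n, ‖∫ y, w y * (ballDensity n y : ℂ)‖ₑ := by
  rw [eLpNorm_exponent_top]
  refine eLpNormEssSup_le_of_ae_enorm_bound ?_
  filter_upwards [IsUnifLocDoublingMeasure.ae_tendsto_average volume hw 1] with x lebesgue_point
  choose n dist_le radius_eq using exists_dist_ballCenter_le x
  have radius_tendsto : Filter.Tendsto (fun j => ballRadius (n j)) Filter.atTop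
      (nhdsWithin 0 (Set.Ioi 0)) := by
    refine tendsto_nhdsWithin_iff.2 ⟨?_, .of_forall fun j => ballRadius_pos _⟩
    simpa only [radius_eq] using tendsto_one_div_add_atTop_nhds_zero_nat
  refine le_of_tendsto (lebesgue_point (fun j => ballCenter (n j)) _ radius_tendsto
    (.of_forall fun j => ?_)).enorm (.of_forall fun j => ?_)
  · rw [one_mul]
    exact dist_le j
  · rw [← integral_mul_ballDensity]
    exact le_iSup (fun n => ‖∫ y, w y * (ballDensity n y : ℂ)‖ₑ) _

theorem enorm_integral_mul_ballDensity_le (w : V → ℂ) (n : ℕ) :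
    ‖∫ y, w y * (ballDensity n y : ℂ)‖ₑ ≤ eLpNorm w ∞ volume :=
  calc ‖∫ y, w y * (ballDensity n y : ℂ)‖ₑ
      ≤ ∫⁻ y, ‖w y * (ballDensity n y : ℂ)‖ₑ := enorm_integral_le_lintegral_enorm _
    _ ≤ ∫⁻ y, eLpNorm w ∞ volume * ‖ballDensity n y‖ₑ := by
        refine lintegral_mono_ae ?_
        rw [eLpNorm_exponent_top]
        filter_upwards [enorm_ae_le_eLpNormEssSup w volume] with y hy
        rw [enorm_mul, ← ofReal_norm (ballDensity n y : ℂ), Complex.norm_real, ofReal_norm]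
        gcongr
    _ = eLpNorm w ∞ volume := by
        rw [lintegral_const_mul _ (isTestDensity_ballDensity n).measurable.enorm,
          lintegral_enorm_ballDensity, mul_one]

theorem eLpNorm_top_eq_iSup_ballDensity {w : V → ℂ} (hw : LocallyIntegrable w) :
    eLpNorm w ∞ volume = ⨆ n, ‖∫ y, w y * (ballDensity n y : ℂ)‖ₑ :=
  (eLpNorm_top_le_iSup_ballDensity hw).antisymm
    (iSup_le (enorm_integral_mul_ballDensity_le w))

end BallDensity

section RotationInvariance

/-- Invariance under all rotations of a function that is defined up to null sets. -/
def IsRotInvariant (g : Plane → ℂ) : Prop :=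
  ∀ θ, (fun x => g (rot θ x)) =ᵐ[volume] g

theorem IsRadial.isRotInvariant {g : Plane → ℂ} (hg : IsRadial g) : IsRotInvariant g := by
  obtain ⟨h, hh⟩ := hg
  intro θ
  filter_upwards [(rot θ).measurePreserving.quasiMeasurePreserving.ae_eq_comp hh, hh] with x h1 h2
  simpa only [Function.comp_apply, LinearIsometryEquiv.norm_map, h2] using h1

/-- Composition with the rotation by `θ`, as an isometry of `L²`. -/
def rotL2 (θ : ℝ) : L2 →ₗᵢ[ℂ] L2 :=
  Lp.compMeasurePreservingₗᵢ ℂ (rot θ) (rot θ).measurePreserving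

theorem isRotInvariant_iff (g : L2) : IsRotInvariant g ↔ ∀ θ, rotL2 θ g = g := by
  have rotL2_ae_eq : ∀ θ, rotL2 θ g =ᵐ[volume] fun x => g (rot θ x) := fun θ =>
    Lp.coeFn_compMeasurePreserving g (rot θ).measurePreserving
  refine forall_congr' fun θ => ?_
  rw [Lp.ext_iff]
  exact ⟨(rotL2_ae_eq θ).trans, (rotL2_ae_eq θ).symm.trans⟩

theorem IsRotInvariant.propagatorL2 {g : L2} (hg : IsRotInvariant g) (t : ℝ) :
    IsRotInvariant (propagatorL2 t g) := by
  rw [isRotInvariant_iff] at hg ⊢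
  exact fun θ => (propagatorL2_compMeasurePreserving (rot θ) t g).symm.trans
    (congrArg (WeightedStrichartz.propagatorL2 t) (hg θ))

theorem IsRotInvariant.sub {g h : L2} (hg : IsRotInvariant g) (hh : IsRotInvariant h) :
    IsRotInvariant (g - h : L2) := by
  rw [isRotInvariant_iff] at *
  intro θ
  rw [map_sub, hg, hh]

theorem IsRotInvariant.const_smul {g : L2} (hg : IsRotInvariant g) (c : ℂ) :
    IsRotInvariant (c • g : L2) := by
  rw [isRotInvariant_iff] at *
  intro θ
  rw [map_smul, hg]

end RotationInvariance

section WeightedSup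

theorem memLp_sqrt_norm_mul_radialMean {ρ : Plane → ℝ} (hρ : IsTestDensity ρ) :
    MemLp (fun y => ((√‖y‖ * radialMean ρ y : ℝ) : ℂ)) 2 :=
  (hρ.radialMean.continuous_mul (by fun_prop)).memLp_ofReal 2 volume

/-- The rotational average of `|x|^{1/2}` times the `n`-th ball density. -/
def testL2 (n : ℕ) : L2 :=
  (memLp_sqrt_norm_mul_radialMean (isTestDensity_ballDensity n)).toLp _

theorem enorm_inner_testL2_propagatorL2_le (m n : ℕ) (t : ℝ) :
    ‖inner ℂ (testL2 m) (propagatorL2 t (testL2 n))‖ₑ ≤ ‖t‖ₑ ^ (-(1 / 2) : ℝ) := by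
  rcases eq_or_ne t 0 with rfl | ht
  · rw [enorm_zero, ENNReal.zero_rpow_of_neg (by norm_num)]
    exact le_top
  · have hm := isTestDensity_ballDensity (V := Plane) m
    have hn := isTestDensity_ballDensity (V := Plane) n
    have dispersive := enorm_inner_toLp_propagatorL2_radialMean_le hm hn
      (memLp_sqrt_norm_mul_radialMean hm) (memLp_sqrt_norm_mul_radialMean hn) ht
    rwa [lintegral_enorm_ballDensity, lintegral_enorm_ballDensity, mul_one, mul_one] at dispersive

/-- The countable supremum of inner products that computes `‖|x|^{1/2} g‖_{L^∞}` for rotation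
invariant `g`. Unlike that norm it is a lower semicontinuous seminorm on all of `L²`. -/
def weightedSup (g : L2) : ℝ≥0∞ := ⨆ n, ‖inner ℂ (testL2 n) g‖ₑ

theorem lowerSemicontinuous_weightedSup : LowerSemicontinuous weightedSup :=
  lowerSemicontinuous_iSup fun n =>
    ((innerSL ℂ (testL2 n)).continuous.enorm).lowerSemicontinuous

theorem weightedSup_add_le (g h : L2) : weightedSup (g + h) ≤ weightedSup g + weightedSup h :=
  iSup_le fun n => by
    rw [inner_add_right]
    exact (enorm_add_le _ _).trans (add_le_add (le_iSup (fun n => ‖inner ℂ (testL2 n) g‖ₑ) n)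
      (le_iSup (fun n => ‖inner ℂ (testL2 n) h‖ₑ) n))

theorem weightedSup_smul (c : ℂ) (g : L2) : weightedSup (c • g) = ‖c‖ₑ * weightedSup g := by
  simp only [weightedSup, inner_smul_right, enorm_mul, ENNReal.mul_iSup]

theorem inner_testL2 {g : L2} (hg : IsRotInvariant g) (n : ℕ) :
    inner ℂ (testL2 n) g = ∫ y, ((√‖y‖ : ℝ) : ℂ) * g y * (ballDensity n y : ℂ) := by
  have hρ := isTestDensity_ballDensity (V := Plane) n
  have representative : inner ℂ (testL2 n) g =
      ∫ y, g y * ((radialMean (fun y => √‖y‖ * ballDensity n y) y : ℝ) : ℂ) := by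
    rw [L2.inner_def]
    refine integral_congr_ae ?_
    filter_upwards [(memLp_sqrt_norm_mul_radialMean hρ).coeFn_toLp] with y hy
    rw [testL2, hy, RCLike.inner_apply, Complex.conj_ofReal, radialMean_norm_mul]
  have invariant : ∀ θ, ∫ y, g ((rot θ).symm y) * ((√‖y‖ * ballDensity n y : ℝ) : ℂ) =
      ∫ y, ((√‖y‖ : ℝ) : ℂ) * g y * (ballDensity n y : ℂ) := fun θ => by
    refine integral_congr_ae ?_
    filter_upwards [hg (-θ)] with y hy
    rw [rot_symm, hy]
    push_cast
    ring
  rw [representative, integral_mul_radialMean (hρ.continuous_mul (by fun_prop))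
    ((Lp.memLp g).locallyIntegrable one_le_two)]
  simp_rw [invariant]
  rw [intervalIntegral.integral_const, sub_zero, smul_smul, inv_mul_cancel₀ (by positivity),
    one_smul]

theorem eLpNorm_top_sqrt_norm_mul_eq {g : L2} (hg : IsRotInvariant g) :
    eLpNorm (fun x => ((√‖x‖ : ℝ) : ℂ) * g x) ∞ volume = weightedSup g := by
  have locallyIntegrable : LocallyIntegrable fun x => ((√‖x‖ : ℝ) : ℂ) * g x := by
    have := (Lp.memLp g).locallyIntegrable one_le_two
    rw [← locallyIntegrableOn_univ] at this ⊢
    exact this.continuousOn_mul (by fun_prop) isOpen_univ.isLocallyClosed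
  simp only [eLpNorm_top_eq_iSup_ballDensity locallyIntegrable, weightedSup, inner_testL2 hg]

theorem eLpNorm_top_weighted {u : ℝ → L2} {t : ℝ} (hu : IsRotInvariant (u t)) :
    eLpNorm (weighted u t) ∞ volume = weightedSup (u t) := by
  rw [← eLpNorm_top_sqrt_norm_mul_eq hu]
  simp only [Real.sqrt_eq_rpow]
  rfl

end WeightedSup

section HomogeneousEstimate

theorem continuous_propagatorL2_uncurry : Continuous fun p : L2 × ℝ => propagatorL2 p.2 p.1 :=
  continuous_prod_of_continuous_lipschitzWith _ 1 continuous_propagatorL2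
    fun t => (propagatorL2 t).lipschitz

theorem measurable_weightedSup_propagatorL2 {D : ℝ → L2} (hD : Continuous D) :
    Measurable fun t => weightedSup (propagatorL2 t (D t)) :=
  (lowerSemicontinuous_weightedSup.comp
    (continuous_propagatorL2_uncurry.comp (hD.prodMk continuous_id))).measurable

/-- The constant of the homogeneous weighted estimate. -/
def homogeneousConst : ℝ≥0 := NNReal.sqrt (hlsConst 4)

theorem eLpNorm_weightedSup_propagatorL2_le (h : L2) :
    eLpNorm (fun t => weightedSup (propagatorL2 t h)) 4 volume ≤ homogeneousConst * ‖h‖ₑ := by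
  have holderConjugate : (4 / 3 : ℝ).HolderConjugate 4 := by
    rw [Real.holderConjugate_iff]
    norm_num
  have maximal := lintegral_iSup_enorm_inner_rpow_le (𝕜 := ℂ) (C := 1) holderConjugate (by norm_num)
    (T := fun n t => propagatorL2 (-t) (testL2 n))
    (fun n => ((continuous_propagatorL2 _).comp continuous_neg).stronglyMeasurable)
    (fun m n t s => by
      rw [inner_propagatorL2_left, propagatorL2_propagatorL2, neg_neg, one_mul, ← sub_eq_add_neg]
      convert enorm_inner_testL2_propagatorL2_le m n (t - s) using 2
      norm_num) h
  simp only [inner_propagatorL2_left, neg_neg] at maximal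
  rw [eLpNorm_le_iff_lintegral_rpow_le (by norm_num) (by norm_num)]
  refine maximal.trans_eq ?_
  have sq_homogeneousConst : (homogeneousConst : ℝ≥0∞) ^ 2 = hlsConst 4 := by
    rw [homogeneousConst, ← ENNReal.coe_pow, NNReal.sq_sqrt]
  rw [one_mul, ← sq_homogeneousConst, ← mul_pow, ← ENNReal.rpow_natCast,
    ← ENNReal.rpow_mul]
  norm_num

end HomogeneousEstimate

section L2Distributions

variable {V : Type*} [NormedAddCommGroup V] [InnerProductSpace ℝ V] [FiniteDimensional ℝ V]
  [MeasurableSpace V] [BorelSpace V]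

theorem toTemperedDistribution_star (d : Lp ℂ 2 (volume : Measure V)) (φ : 𝓢(V, ℂ)) :
    Lp.toTemperedDistribution (star d) φ = inner ℂ d (φ.toLp 2 volume) := by
  rw [L2.inner_def, Lp.toTemperedDistribution_apply]
  refine integral_congr_ae ?_
  filter_upwards [Lp.coeFn_star d, φ.coeFn_toLp 2 volume] with x hd hφ
  rw [hd, hφ, RCLike.inner_apply]
  rfl

theorem norm_star_Lp {α : Type*} [MeasurableSpace α] {μ : Measure α} {p : ℝ≥0∞} (g : Lp ℂ p μ) :
    ‖star g‖ = ‖g‖ := by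
  rw [Lp.norm_def, Lp.norm_def]
  congr 1
  refine eLpNorm_congr_norm_ae ?_
  filter_upwards [Lp.coeFn_star g] with x hx
  rw [hx, Pi.star_apply, norm_star]

theorem exists_toTemperedDistribution_eq (Λ : 𝓢(V, ℂ) →ₗ[ℂ] ℂ) {K : ℝ≥0}
    (hΛ : ∀ φ, ‖Λ φ‖ₑ ≤ K * ‖φ.toLp 2 volume‖ₑ) :
    ∃ d : Lp ℂ 2 (volume : Measure V), ‖d‖ₑ ≤ K ∧
      ∀ φ, Lp.toTemperedDistribution d φ = Λ φ := by
  set toL2 : 𝓢(V, ℂ) →ₗ[ℂ] Lp ℂ 2 (volume : Measure V) :=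
    (SchwartzMap.toLpCLM ℂ (E := V) ℂ 2 volume).toLinearMap
  have dense : DenseRange toL2 := SchwartzMap.denseRange_toLpCLM ENNReal.ofNat_ne_top
  have bound : ∀ φ, ‖Λ φ‖ ≤ K * ‖toL2 φ‖ := fun φ => by
    have hφ := hΛ φ
    simp only [enorm_eq_nnnorm, ← ENNReal.coe_mul, ENNReal.coe_le_coe] at hφ
    exact hφ
  refine ⟨star ((InnerProductSpace.toDual ℂ _).symm (Λ.extendOfNorm toL2)), ?_, fun φ => ?_⟩
  · rw [enorm_eq_nnnorm, ENNReal.coe_le_coe, ← NNReal.coe_le_coe, coe_nnnorm, norm_star_Lp,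
      LinearIsometryEquiv.norm_map]
    exact LinearMap.opNorm_extendOfNorm_le dense K.2 bound
  · rw [toTemperedDistribution_star, InnerProductSpace.toDual_symm_apply]
    exact LinearMap.extendOfNorm_eq dense ⟨K, bound⟩ φ

/-- Composition of a Schwartz function with a linear isometry. -/
def compIsometry (e : V ≃ₗᵢ[ℝ] V) : 𝓢(V, ℂ) →L[ℂ] 𝓢(V, ℂ) :=
  SchwartzMap.compCLMOfContinuousLinearEquiv ℂ e.toContinuousLinearEquiv

omit [FiniteDimensional ℝ V] [MeasurableSpace V] [BorelSpace V] in
theorem compIsometry_apply (e : V ≃ₗᵢ[ℝ] V) (φ : 𝓢(V, ℂ)) (x : V) :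
    compIsometry e φ x = φ (e x) := rfl

theorem integral_comp_isometry (e : V ≃ₗᵢ[ℝ] V) (f : V → ℂ) : ∫ x, f (e x) = ∫ x, f x :=
  e.measurePreserving.integral_comp e.toHomeomorph.measurableEmbedding f

theorem toTemperedDistribution_compMeasurePreserving (e : V ≃ₗᵢ[ℝ] V)
    (d : Lp ℂ 2 (volume : Measure V)) (φ : 𝓢(V, ℂ)) :
    Lp.toTemperedDistribution (Lp.compMeasurePreserving e e.measurePreserving d) φ =
      Lp.toTemperedDistribution d (compIsometry e.symm φ) := by
  simp only [Lp.toTemperedDistribution_apply, compIsometry_apply, smul_eq_mul]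
  rw [← integral_comp_isometry e fun x => φ (e.symm x) * d x]
  refine integral_congr_ae ?_
  filter_upwards [Lp.coeFn_compMeasurePreserving d e.measurePreserving] with x hx
  rw [hx, LinearIsometryEquiv.symm_apply_apply, Function.comp_apply]

end L2Distributions

section PropagatorSchwartz

/-- The transpose of the propagator `e^{itΔ}`, which is the propagator on Schwartz functions. -/
def propagatorSchwartz (t : ℝ) : 𝓢(Plane, ℂ) →L[ℂ] 𝓢(Plane, ℂ) :=
  fourierCLM ℂ 𝓢(Plane, ℂ) ∘L SchwartzMap.smulLeftCLM ℂ (schrodingerSymbol t) ∘L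
    fourierInvCLM ℂ 𝓢(Plane, ℂ)

theorem propagator_apply (t : ℝ) (T : 𝓢'(Plane, ℂ)) (φ : 𝓢(Plane, ℂ)) :
    propagator t T φ = T (propagatorSchwartz t φ) := rfl

theorem fourierInv_propagatorSchwartz (t : ℝ) (φ : 𝓢(Plane, ℂ)) :
    𝓕⁻ (propagatorSchwartz t φ) = SchwartzMap.smulLeftCLM ℂ (schrodingerSymbol t) (𝓕⁻ φ) :=
  fourierInv_fourier_eq _

theorem propagatorSchwartz_propagatorSchwartz (s t : ℝ) (φ : 𝓢(Plane, ℂ)) :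
    propagatorSchwartz s (propagatorSchwartz t φ) = propagatorSchwartz (s + t) φ := by
  have symbol_mul : schrodingerSymbol s * schrodingerSymbol t = schrodingerSymbol (s + t) :=
    funext fun ξ => (schrodingerSymbol_add s t ξ).symm
  change 𝓕 (SchwartzMap.smulLeftCLM ℂ _ (𝓕⁻ (propagatorSchwartz t φ))) = _
  rw [fourierInv_propagatorSchwartz, SchwartzMap.smulLeftCLM_smulLeftCLM_apply
    (schrodingerSymbol_hasTemperateGrowth s) (schrodingerSymbol_hasTemperateGrowth t), symbol_mul]
  rfl

theorem propagatorSchwartz_apply (t : ℝ) (φ : 𝓢(Plane, ℂ)) (x : Plane) :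
    propagatorSchwartz t φ x = freeWave (𝓕⁻ φ : 𝓢(Plane, ℂ)) t x := by
  change 𝓕 (SchwartzMap.smulLeftCLM ℂ (schrodingerSymbol t) (𝓕⁻ φ : 𝓢(Plane, ℂ))) x = _
  rw [SchwartzMap.fourier_coe, Real.fourier_eq', freeWave]
  refine integral_congr_ae (.of_forall fun ξ => ?_)
  simp only [SchwartzMap.smulLeftCLM_apply_apply (schrodingerSymbol_hasTemperateGrowth t),
    smul_eq_mul, ← mul_assoc, schrodingerSymbol, ← Complex.exp_add, real_inner_comm ξ x]
  congr 2
  push_cast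
  ring

theorem continuous_propagatorSchwartz_neg (φ : 𝓢(Plane, ℂ)) :
    Continuous fun y : ℝ × Plane => propagatorSchwartz (-y.1) φ y.2 := by
  simp only [propagatorSchwartz_apply]
  exact (continuous_freeWave (𝓕⁻ φ : 𝓢(Plane, ℂ)).integrable).comp
    (by fun_prop : Continuous fun y : ℝ × Plane => (-y.1, y.2))

theorem lintegral_enorm_fourierInv_sq (φ : 𝓢(Plane, ℂ)) :
    ∫⁻ ξ, ‖(𝓕⁻ φ : 𝓢(Plane, ℂ)) ξ‖ₑ ^ 2 = ‖φ.toLp 2 volume‖ₑ ^ 2 := by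
  have plancherel : ‖φ.toLp 2 volume‖ₑ = ‖(𝓕⁻ φ : 𝓢(Plane, ℂ)).toLp 2 volume‖ₑ := by
    rw [← ofReal_norm, ← ofReal_norm, ← SchwartzMap.norm_fourier_toL2_eq (𝓕⁻ φ),
      fourier_fourierInv_eq]
  rw [plancherel, Lp.enorm_def, eLpNorm_congr_ae ((𝓕⁻ φ : 𝓢(Plane, ℂ)).coeFn_toLp 2 volume),
    eLpNorm_eq_lintegral_rpow_enorm_toReal (by norm_num) (by norm_num), ← ENNReal.rpow_natCast,
    ← ENNReal.rpow_mul]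
  norm_num

theorem lintegral_propagatorSchwartz_neg_pow_four_le (φ : 𝓢(Plane, ℂ)) :
    ∫⁻ y : ℝ × Plane, ‖propagatorSchwartz (-y.1) φ y.2‖ₑ ^ 4 ≤ ‖φ.toLp 2 volume‖ₑ ^ 4 := by
  have time_reversal : MeasurePreserving (fun y : ℝ × Plane => (-y.1, y.2)) volume volume :=
    (Measure.measurePreserving_neg (volume : Measure ℝ)).prod
      (MeasurePreserving.id (volume : Measure Plane))
  have hψ := (𝓕⁻ φ : 𝓢(Plane, ℂ)).integrable (μ := volume)
  calc _ = ∫⁻ y : ℝ × Plane, ‖freeWave (𝓕⁻ φ : 𝓢(Plane, ℂ)) y.1 y.2‖ₑ ^ 4 := by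
        simp only [propagatorSchwartz_apply]
        exact time_reversal.lintegral_comp ((continuous_freeWave hψ).enorm.measurable.pow_const 4)
    _ ≤ 4⁻¹ * (∫⁻ ξ, ‖(𝓕⁻ φ : 𝓢(Plane, ℂ)) ξ‖ₑ ^ 2) ^ 2 := lintegral_freeWave_pow_four_le hψ
    _ ≤ 1 * (∫⁻ ξ, ‖(𝓕⁻ φ : 𝓢(Plane, ℂ)) ξ‖ₑ ^ 2) ^ 2 := by
        gcongr
        norm_num
    _ = _ := by rw [one_mul, lintegral_enorm_fourierInv_sq, ← pow_mul]

theorem lintegral_enorm_mul_propagatorSchwartz_le {G : ℝ × Plane → ℂ} {μ : Measure (ℝ × Plane)}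
    (hμ : μ ≤ volume) (hG : AEStronglyMeasurable G μ) (φ : 𝓢(Plane, ℂ)) :
    ∫⁻ y, ‖G y * propagatorSchwartz (-y.1) φ y.2‖ₑ ∂μ ≤
      (∫⁻ y, ‖G y‖ₑ ^ (4 / 3 : ℝ) ∂μ) ^ (3 / 4 : ℝ) * ‖φ.toLp 2 volume‖ₑ := by
  have hpq : (4 / 3 : ℝ).HolderConjugate 4 := by
    rw [Real.holderConjugate_iff]
    norm_num
  have strichartz : (∫⁻ y, ‖propagatorSchwartz (-y.1) φ y.2‖ₑ ^ (4 : ℝ) ∂μ) ^ (1 / 4 : ℝ) ≤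
      ‖φ.toLp 2 volume‖ₑ := by
    rw [one_div, ENNReal.rpow_inv_le_iff (by norm_num)]
    simp only [ENNReal.rpow_ofNat]
    exact (lintegral_mono' hμ le_rfl).trans (lintegral_propagatorSchwartz_neg_pow_four_le φ)
  have holder := ENNReal.lintegral_mul_le_Lp_mul_Lq μ hpq hG.enorm
    (continuous_propagatorSchwartz_neg φ).enorm.measurable.aemeasurable
  simp only [Pi.mul_apply, ← enorm_mul, one_div_div] at holder
  exact holder.trans (by gcongr)

theorem propagatorSchwartz_compIsometry (e : Plane ≃ₗᵢ[ℝ] Plane) (t : ℝ) (φ : 𝓢(Plane, ℂ))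
    (x : Plane) : propagatorSchwartz t (compIsometry e φ) x = propagatorSchwartz t φ (e x) := by
  have fourierInv_comp : ∀ ξ, (𝓕⁻ (compIsometry e φ) : 𝓢(Plane, ℂ)) ξ =
      (𝓕⁻ φ : 𝓢(Plane, ℂ)) (e ξ) := fun ξ => by
    rw [SchwartzMap.fourierInv_coe, SchwartzMap.fourierInv_coe]
    exact Real.fourierInv_comp_linearIsometry e φ ξ
  rw [propagatorSchwartz_apply, propagatorSchwartz_apply, freeWave, freeWave]
  symm
  rw [← integral_comp_isometry e]
  simp only [fourierInv_comp, LinearIsometryEquiv.inner_map_map, LinearIsometryEquiv.norm_map]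

end PropagatorSchwartz

section SliceMass

variable {α X E : Type*} [MeasurableSpace α] [MeasurableSpace X] [NormedAddCommGroup E]
  {μ : Measure α} {ν : Measure X} [SFinite ν] {p : ℝ≥0∞} {G : α × X → E}

/-- The integral of `‖G (s, ·)‖ ^ p`, as a density in `s` for the `p`-th power of the `L^p` norm of
`G`. -/
def sliceMass (p : ℝ≥0∞) (ν : Measure X) (G : α × X → E) (s : α) : ℝ≥0∞ :=
  ∫⁻ x, ‖G (s, x)‖ₑ ^ p.toReal ∂ν

theorem aemeasurable_sliceMass (hG : AEStronglyMeasurable G (μ.prod ν)) :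
    AEMeasurable (sliceMass p ν G) μ :=
  (hG.enorm.pow_const _).lintegral_prod_right'

theorem lintegral_sliceMass [SFinite μ] (hp : p ≠ 0) (hp' : p ≠ ∞)
    (hG : AEStronglyMeasurable G (μ.prod ν)) :
    ∫⁻ s, sliceMass p ν G s ∂μ = eLpNorm G p (μ.prod ν) ^ p.toReal := by
  have hp_pos : p.toReal ≠ 0 := (ENNReal.toReal_pos hp hp').ne'
  rw [eLpNorm_eq_lintegral_rpow_enorm_toReal hp hp', ← ENNReal.rpow_mul, one_div,
    inv_mul_cancel₀ hp_pos, ENNReal.rpow_one, lintegral_prod _ (hG.enorm.pow_const _)]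
  rfl

theorem lintegral_sliceMass_ne_top [SFinite μ] (hp : p ≠ 0) (hp' : p ≠ ∞)
    (hG : MemLp G p (μ.prod ν)) : ∫⁻ s, sliceMass p ν G s ∂μ ≠ ∞ := by
  rw [lintegral_sliceMass hp hp' hG.1]
  exact ENNReal.rpow_ne_top_of_nonneg ENNReal.toReal_nonneg hG.2.ne

theorem ae_memLp_slice [SFinite μ] (hp : p ≠ 0) (hp' : p ≠ ∞) (hG : MemLp G p (μ.prod ν)) :
    ∀ᵐ s ∂μ, MemLp (fun x => G (s, x)) p ν := by
  filter_upwards [ae_lt_top' (aemeasurable_sliceMass hG.1) (lintegral_sliceMass_ne_top hp hp' hG),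
    hG.1.prodMk_left] with s mass_lt_top measurable_slice
  exact ⟨measurable_slice,
    (eLpNorm_lt_top_iff_lintegral_rpow_enorm_lt_top hp hp').2 mass_lt_top⟩

end SliceMass

section CumulativeMass

/-- The mass `∫_{-∞}^t m(s) ds` of a nonnegative density of finite total mass. -/
def cumulativeMass (m : ℝ → ℝ≥0∞) (t : ℝ) : ℝ := ∫ s in Set.Iic t, (m s).toReal

variable {m : ℝ → ℝ≥0∞}

theorem cumulativeMass_nonneg (t : ℝ) : 0 ≤ cumulativeMass m t :=
  integral_nonneg fun _ => ENNReal.toReal_nonneg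

theorem cumulativeMass_le (hm : AEMeasurable m) (hm' : ∫⁻ s, m s ≠ ∞) (t : ℝ) :
    cumulativeMass m t ≤ (∫⁻ s, m s).toReal := by
  rw [← integral_toReal hm (ae_lt_top' hm hm')]
  exact setIntegral_le_integral (integrable_toReal_of_lintegral_ne_top hm hm')
    (.of_forall fun _ => ENNReal.toReal_nonneg)

theorem cumulativeMass_sub (hm : AEMeasurable m) (hm' : ∫⁻ s, m s ≠ ∞) (a t : ℝ) :
    cumulativeMass m t - cumulativeMass m a = ∫ s in a..t, (m s).toReal :=
  have integrable := integrable_toReal_of_lintegral_ne_top hm hm'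
  intervalIntegral.integral_Iic_sub_Iic integrable.integrableOn integrable.integrableOn

theorem continuous_cumulativeMass (hm : AEMeasurable m) (hm' : ∫⁻ s, m s ≠ ∞) :
    Continuous (cumulativeMass m) := by
  have primitive : cumulativeMass m =
      fun t => cumulativeMass m 0 + ∫ s in (0 : ℝ)..t, (m s).toReal := by
    funext t
    rw [← cumulativeMass_sub hm hm', add_sub_cancel]
  rw [primitive]
  exact continuous_const.add (intervalIntegral.continuous_primitive (fun _ _ =>
    (integrable_toReal_of_lintegral_ne_top hm hm').intervalIntegrable) 0)

theorem enorm_cumulativeMass_sub (hm : AEMeasurable m) (hm' : ∫⁻ s, m s ≠ ∞) (a t : ℝ) :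
    ‖cumulativeMass m t - cumulativeMass m a‖ₑ = ∫⁻ s in Set.uIoc a t, m s := by
  have mass_ne_top : ∫⁻ s in Set.uIoc a t, m s ≠ ∞ :=
    ((setLIntegral_le_lintegral _ _).trans_lt hm'.lt_top).ne
  rw [cumulativeMass_sub hm hm', ← ofReal_norm, intervalIntegral.norm_intervalIntegral_eq,
    integral_toReal hm.restrict (ae_restrict_of_ae (ae_lt_top' hm hm')), Real.norm_of_nonneg
    ENNReal.toReal_nonneg, ENNReal.ofReal_toReal mass_ne_top]

end CumulativeMass

section MassPath

variable {α H : Type*} [MeasurableSpace α] {μ : Measure α} {q : ℝ≥0∞} [NormedAddCommGroup H]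
  {S : α → H → ℝ≥0∞} {B : ℝ≥0∞}

theorem eLpNorm_mass_path_le (hq : 1 ≤ q) (hq' : q ≠ ∞)
    (hSm : ∀ h, Measurable fun t => S t h) (hSlsc : ∀ t, LowerSemicontinuous (S t))
    (hSadd : ∀ t h h', S t (h + h') ≤ S t h + S t h')
    (hSB : ∀ h, eLpNorm (fun t => S t h) q μ ≤ B * ‖h‖ₑ)
    {m : α → ℝ} (hm : Measurable m) (hm0 : ∀ t, 0 ≤ m t) {M : ℝ≥0} (hmM : ∀ t, m t ≤ M)
    {D : α → H} {a : α} (hDa : D a = 0) {σ : ℝ} (hσ : 0 < σ)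
    (hD : ∀ t s, ‖D t - D s‖ₑ ≤ ‖m t - m s‖ₑ ^ σ) :
    eLpNorm (fun t => S t (D t)) q μ ≤ chainingConst q σ * (B * (M : ℝ≥0∞) ^ σ) := by
  have bound_D : ∀ t, ‖D t‖ₑ ≤ (M : ℝ≥0∞) ^ σ := fun t => by
    have increment : ‖m t - m a‖ₑ ≤ M := by
      rw [enorm_eq_nnnorm, ENNReal.coe_le_coe, ← NNReal.coe_le_coe, coe_nnnorm, Real.norm_eq_abs,
        abs_le]
      constructor <;> linarith [hm0 t, hm0 a, hmM t, hmM a]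
    simpa only [hDa, sub_zero] using (hD t a).trans (ENNReal.rpow_le_rpow increment hσ.le)
  rcases eq_or_ne M 0 with rfl | hM
  · have D_eq_zero : ∀ t, D t = 0 := fun t => by
      simpa only [ENNReal.coe_zero, ENNReal.zero_rpow_of_pos hσ, nonpos_iff_eq_zero, enorm_eq_zero]
        using bound_D t
    simp only [D_eq_zero]
    exact (hSB 0).trans (by simp only [enorm_zero, mul_zero, zero_le])
  · rw [← ENNReal.coe_rpow_of_nonneg M hσ.le] at bound_D ⊢
    have hM_pos : (0 : ℝ) < M := by positivity
    refine eLpNorm_holder_path_le hq hq' hSm hSlsc hSadd hSB (F := fun t => m t / M)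
      (hm.div_const _) (fun t => div_nonneg (hm0 t) M.2) (fun t => (div_le_one hM_pos).2 (hmM t))
      hσ bound_D fun t s => (hD t s).trans_eq ?_
    rw [ENNReal.coe_rpow_of_nonneg M hσ.le, ← ENNReal.mul_rpow_of_nonneg _ _ hσ.le, ← sub_div,
      ← NNReal.enorm_eq, ← enorm_mul, mul_div_cancel₀ _ hM_pos.ne']

end MassPath

section Forcing

variable {G : ℝ × Plane → ℂ}

theorem four_thirds_ne_zero : (4 / 3 : ℝ≥0∞) ≠ 0 := by simp

theorem four_thirds_ne_top : (4 / 3 : ℝ≥0∞) ≠ ∞ := (ENNReal.div_lt_top (by simp) (by simp)).ne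

theorem toReal_four_thirds : (4 / 3 : ℝ≥0∞).toReal = 4 / 3 := by simp [ENNReal.toReal_div]

/-- The mass `∫_{-∞}^t ∫ |G|^{4/3} dx ds`, the clock in which the forcing evolves Hölder
continuously. -/
def forcingMass (G : ℝ × Plane → ℂ) : ℝ → ℝ := cumulativeMass (sliceMass (4 / 3) volume G)

theorem continuous_forcingMass (hG : MemLp G (4 / 3) volume) : Continuous (forcingMass G) :=
  continuous_cumulativeMass (aemeasurable_sliceMass hG.1)
    (lintegral_sliceMass_ne_top four_thirds_ne_zero four_thirds_ne_top hG)

theorem forcingMass_le (hG : MemLp G (4 / 3) volume) (t : ℝ) :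
    forcingMass G t ≤ (eLpNorm G (4 / 3) volume ^ (4 / 3 : ℝ)).toReal := by
  have total := lintegral_sliceMass four_thirds_ne_zero four_thirds_ne_top
    (μ := (volume : Measure ℝ)) (ν := (volume : Measure Plane)) hG.1
  rw [toReal_four_thirds, ← Measure.volume_eq_prod] at total
  rw [← total]
  exact cumulativeMass_le (aemeasurable_sliceMass hG.1)
    (lintegral_sliceMass_ne_top four_thirds_ne_zero four_thirds_ne_top hG) t

theorem integrable_mul_propagatorSchwartz (hG : MemLp G (4 / 3) volume) (φ : 𝓢(Plane, ℂ)) :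
    Integrable fun y : ℝ × Plane => G y * propagatorSchwartz (-y.1) φ y.2 := by
  refine ⟨hG.1.mul (continuous_propagatorSchwartz_neg φ).aestronglyMeasurable,
    (lintegral_enorm_mul_propagatorSchwartz_le le_rfl hG.1 φ).trans_lt
      (ENNReal.mul_lt_top (ENNReal.rpow_lt_top_of_nonneg (by norm_num) ?_) enorm_lt_top)⟩
  have := (lintegral_rpow_enorm_lt_top_of_eLpNorm_lt_top four_thirds_ne_zero four_thirds_ne_top
    hG.2).ne
  rwa [toReal_four_thirds] at this

/-- The functional `φ ↦ ∫_a^b ∫ G(s, x) (e^{-isΔ} φ)(x) dx ds`, that is, the weak integral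
`∫_a^b e^{-isΔ} G(s) ds`. -/
def pairing (hG : MemLp G (4 / 3) volume) (a b : ℝ) : 𝓢(Plane, ℂ) →ₗ[ℂ] ℂ where
  toFun φ := ∫ s in a..b, ∫ x, G (s, x) * propagatorSchwartz (-s) φ x
  map_add' φ ψ := by
    have hφ := integrable_mul_propagatorSchwartz hG φ
    have hψ := integrable_mul_propagatorSchwartz hG ψ
    rw [← intervalIntegral.integral_add hφ.integral_prod_left.intervalIntegrable
      hψ.integral_prod_left.intervalIntegrable]
    refine intervalIntegral.integral_congr_ae ?_
    filter_upwards [hφ.prod_right_ae, hψ.prod_right_ae] with s hφs hψs _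
    rw [← integral_add hφs hψs]
    simp only [map_add, add_apply, mul_add]
  map_smul' c φ := by
    simp only [map_smul, smul_apply, smul_eq_mul, mul_left_comm _ c,
      integral_const_mul, intervalIntegral.integral_const_mul, RingHom.id_apply]

theorem pairing_apply (hG : MemLp G (4 / 3) volume) (a b : ℝ) (φ : 𝓢(Plane, ℂ)) :
    pairing hG a b φ = ∫ s in a..b, ∫ x, G (s, x) * propagatorSchwartz (-s) φ x := rfl

theorem pairing_sub_pairing (hG : MemLp G (4 / 3) volume) (a s t : ℝ) (φ : 𝓢(Plane, ℂ)) :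
    pairing hG a t φ - pairing hG a s φ = pairing hG s t φ :=
  have integrable := (integrable_mul_propagatorSchwartz hG φ).integral_prod_left
  intervalIntegral.integral_interval_sub_left integrable.intervalIntegrable
    integrable.intervalIntegrable

theorem restrict_prod_volume (I : Set ℝ) :
    (volume.restrict I).prod (volume : Measure Plane) = volume.restrict (I ×ˢ Set.univ) := by
  rw [Measure.volume_eq_prod, ← Measure.prod_restrict, Measure.restrict_univ]

theorem enorm_pairing_le (hG : MemLp G (4 / 3) volume) (a b : ℝ) (φ : 𝓢(Plane, ℂ)) :
    ‖pairing hG a b φ‖ₑ ≤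
      ‖forcingMass G b - forcingMass G a‖ₑ ^ (3 / 4 : ℝ) * ‖φ.toLp 2 volume‖ₑ := by
  set strip := (volume.restrict (Set.uIoc a b)).prod (volume : Measure Plane)
  have strip_le : strip ≤ volume := (restrict_prod_volume _).trans_le Measure.restrict_le_self
  have hG_strip : AEStronglyMeasurable G strip := hG.1.mono_measure strip_le
  have mass_strip : ∫⁻ y, ‖G y‖ₑ ^ (4 / 3 : ℝ) ∂strip = ‖forcingMass G b - forcingMass G a‖ₑ := by
    rw [forcingMass, enorm_cumulativeMass_sub (aemeasurable_sliceMass hG.1)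
      (lintegral_sliceMass_ne_top four_thirds_ne_zero four_thirds_ne_top hG),
      lintegral_prod _ (hG_strip.enorm.pow_const _)]
    simp only [sliceMass, toReal_four_thirds]
  have measurable_integrand : AEMeasurable
      (fun y : ℝ × Plane => ‖G y * propagatorSchwartz (-y.1) φ y.2‖ₑ) strip :=
    (hG_strip.mul (continuous_propagatorSchwartz_neg φ).aestronglyMeasurable).enorm
  calc ‖pairing hG a b φ‖ₑ
      = ‖∫ s in Set.uIoc a b, ∫ x, G (s, x) * propagatorSchwartz (-s) φ x‖ₑ := by
        rw [pairing_apply, ← ofReal_norm, intervalIntegral.norm_intervalIntegral_eq, ofReal_norm]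
    _ ≤ ∫⁻ s in Set.uIoc a b, ∫⁻ x, ‖G (s, x) * propagatorSchwartz (-s) φ x‖ₑ :=
        (enorm_integral_le_lintegral_enorm _).trans
          (lintegral_mono fun s => enorm_integral_le_lintegral_enorm _)
    _ = ∫⁻ y, ‖G y * propagatorSchwartz (-y.1) φ y.2‖ₑ ∂strip :=
        (lintegral_prod _ measurable_integrand).symm
    _ ≤ _ := mass_strip ▸ lintegral_enorm_mul_propagatorSchwartz_le strip_le hG_strip φ

theorem toTemperedDistribution_sub (g h : L2) (φ : 𝓢(Plane, ℂ)) :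
    Lp.toTemperedDistribution (g - h) φ =
      Lp.toTemperedDistribution g φ - Lp.toTemperedDistribution h φ :=
  DFunLike.congr_fun (map_sub (Lp.toTemperedDistributionCLM ℂ volume 2) g h) φ

theorem exists_forcing (hG : MemLp G (4 / 3) volume) (a : ℝ) :
    ∃ D : ℝ → L2, D a = 0 ∧
      (∀ t φ, Lp.toTemperedDistribution (D t) φ = pairing hG a t φ) ∧
      ∀ t s, ‖D t - D s‖ₑ ≤ ‖forcingMass G t - forcingMass G s‖ₑ ^ (3 / 4 : ℝ) := by
  have represent := fun s t => exists_toTemperedDistribution_eq (pairing hG s t)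
    (K := ‖forcingMass G t - forcingMass G s‖₊ ^ (3 / 4 : ℝ)) fun φ => by
      rw [ENNReal.coe_rpow_of_nonneg _ (by norm_num)]
      exact enorm_pairing_le hG s t φ
  choose D enorm_D_le D_apply using represent
  have increment : ∀ s t, D a t - D a s = D s t := fun s t =>
    toTemperedDistribution_injective fun φ => by
      rw [toTemperedDistribution_sub, D_apply, D_apply, D_apply, pairing_sub_pairing]
  refine ⟨D a, by rw [← increment, sub_self], D_apply a, fun t s => ?_⟩
  rw [increment]
  exact (enorm_D_le s t).trans_eq (ENNReal.coe_rpow_of_nonneg _ (by norm_num))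

theorem continuous_of_enorm_sub_le_forcingMass (hG : MemLp G (4 / 3) volume) {D : ℝ → L2}
    (hD : ∀ t s, ‖D t - D s‖ₑ ≤ ‖forcingMass G t - forcingMass G s‖ₑ ^ (3 / 4 : ℝ)) :
    Continuous D := by
  refine continuous_iff_continuousAt.2 fun s => tendsto_iff_edist_tendsto_0.2 ?_
  have modulus : Continuous fun t => ‖forcingMass G t - forcingMass G s‖ₑ ^ (3 / 4 : ℝ) :=
    (ENNReal.continuous_rpow_const).comp
      ((continuous_forcingMass hG).sub continuous_const).enorm
  have modulus_tendsto := modulus.tendsto s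
  rw [sub_self, enorm_zero, ENNReal.zero_rpow_of_pos (by norm_num)] at modulus_tendsto
  refine tendsto_of_tendsto_of_tendsto_of_le_of_le tendsto_const_nhds modulus_tendsto
    (fun _ => zero_le) fun t => ?_
  rw [edist_eq_enorm_sub]
  exact hD t s

theorem eLpNorm_weightedSup_forcing_le (hG : MemLp G (4 / 3) volume) {D : ℝ → L2} {a : ℝ}
    (hDa : D a = 0)
    (hD : ∀ t s, ‖D t - D s‖ₑ ≤ ‖forcingMass G t - forcingMass G s‖ₑ ^ (3 / 4 : ℝ)) :
    eLpNorm (fun t => weightedSup (propagatorL2 t (D t))) 4 volume ≤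
      chainingConst 4 (3 / 4) * (homogeneousConst * eLpNorm G (4 / 3) volume) := by
  set M : ℝ≥0 := (eLpNorm G (4 / 3) volume ^ (4 / 3 : ℝ)).toNNReal
  have M_rpow : (M : ℝ≥0∞) ^ (3 / 4 : ℝ) = eLpNorm G (4 / 3) volume := by
    rw [ENNReal.coe_toNNReal (ENNReal.rpow_ne_top_of_nonneg (by norm_num) hG.2.ne),
      ← ENNReal.rpow_mul]
    norm_num
  rw [← M_rpow]
  exact eLpNorm_mass_path_le (S := fun t h => weightedSup (propagatorL2 t h)) (by norm_num)
    (by norm_num) (fun h => measurable_weightedSup_propagatorL2 continuous_const)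
    (fun t => lowerSemicontinuous_weightedSup.comp (propagatorL2 t).continuous)
    (fun t h h' => by rw [map_add]; exact weightedSup_add_le _ _)
    eLpNorm_weightedSup_propagatorL2_le (continuous_forcingMass hG).measurable
    cumulativeMass_nonneg (forcingMass_le hG) hDa (by norm_num) hD

theorem isRotInvariant_of_pairing (hG : MemLp G (4 / 3) volume)
    (hrot : ∀ᵐ s, IsRotInvariant fun x => G (s, x)) {a t : ℝ} {d : L2}
    (hd : ∀ φ, Lp.toTemperedDistribution d φ = pairing hG a t φ) : IsRotInvariant d := by
  rw [isRotInvariant_iff]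
  refine fun θ => toTemperedDistribution_injective fun φ => ?_
  refine (toTemperedDistribution_compMeasurePreserving (rot θ) d φ).trans ?_
  rw [hd, hd, pairing_apply, pairing_apply]
  refine intervalIntegral.integral_congr_ae ?_
  filter_upwards [hrot] with s hs _
  simp only [propagatorSchwartz_compIsometry]
  rw [← integral_comp_isometry (rot θ)]
  refine integral_congr_ae ?_
  filter_upwards [hs θ] with x hx
  rw [hx, LinearIsometryEquiv.symm_apply_apply]

end Forcing

section ExtendForcing

variable {I : Set ℝ} {f : ℝ → Plane → ℂ}

/-- A forcing term on `I × ℝ²`, extended by zero to all times. -/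
def extendForcing (I : Set ℝ) (f : ℝ → Plane → ℂ) : ℝ × Plane → ℂ :=
  (I ×ˢ Set.univ).indicator (Function.uncurry f)

theorem extendForcing_of_mem {s : ℝ} (hs : s ∈ I) (x : Plane) : extendForcing I f (s, x) = f s x :=
  Set.indicator_of_mem (Set.mk_mem_prod hs (Set.mem_univ x)) _

theorem memLp_extendForcing (hI : MeasurableSet I)
    (hf : MemLp (Function.uncurry f) (4 / 3) ((volume.restrict I).prod volume)) :
    MemLp (extendForcing I f) (4 / 3) volume := by
  rw [restrict_prod_volume] at hf
  exact (memLp_indicator_iff_restrict (hI.prod .univ)).2 hf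

theorem eLpNorm_extendForcing (hI : MeasurableSet I) (f : ℝ → Plane → ℂ) :
    eLpNorm (extendForcing I f) (4 / 3) volume =
      eLpNorm (Function.uncurry f) (4 / 3) ((volume.restrict I).prod volume) := by
  rw [restrict_prod_volume]
  exact eLpNorm_indicator_eq_eLpNorm_restrict (hI.prod .univ)

theorem isRotInvariant_extendForcing (hI : MeasurableSet I)
    (hf : ∀ᵐ t ∂(volume.restrict I), IsRadial (f t)) :
    ∀ᵐ s, IsRotInvariant fun x => extendForcing I f (s, x) := by
  rw [ae_restrict_iff' hI] at hf
  filter_upwards [hf] with s hs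
  by_cases hsI : s ∈ I
  · simp only [extendForcing_of_mem hsI]
    exact (hs hsI).isRotInvariant
  · have vanish : ∀ x, extendForcing I f (s, x) = 0 := fun x =>
      Set.indicator_of_notMem (fun h => hsI h.1) _
    simp only [vanish]
    exact fun θ => .rfl

end ExtendForcing

section Duhamel

variable {I : Set ℝ} {f : ℝ → Plane → ℂ}

theorem ae_propagator_sliceDistribution (hI : MeasurableSet I)
    (hf : MemLp (Function.uncurry f) (4 / 3) ((volume.restrict I).prod volume)) (t : ℝ)
    (φ : 𝓢(Plane, ℂ)) :
    ∀ᵐ s, s ∈ I → propagator (t - s) (sliceDistribution (f s)) φ =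
      ∫ x, extendForcing I f (s, x) * propagatorSchwartz (-s) (propagatorSchwartz t φ) x := by
  filter_upwards [ae_memLp_slice four_thirds_ne_zero four_thirds_ne_top
    (memLp_extendForcing hI hf)] with s hs hsI
  simp only [extendForcing_of_mem hsI] at hs ⊢
  rw [propagator_apply, sliceDistribution, dif_pos hs, Lp.toTemperedDistribution_apply,
    propagatorSchwartz_propagatorSchwartz, neg_add_eq_sub]
  refine integral_congr_ae ?_
  filter_upwards [hs.coeFn_toLp] with x hx
  rw [hx, smul_eq_mul, mul_comm]

theorem ae_uIoc_propagator_sliceDistribution (hI : I.OrdConnected)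
    (hf : MemLp (Function.uncurry f) (4 / 3) ((volume.restrict I).prod volume)) {t₀ t : ℝ}
    (ht₀ : t₀ ∈ I) (ht : t ∈ I) (φ : 𝓢(Plane, ℂ)) :
    ∀ᵐ s, s ∈ Set.uIoc t₀ t → propagator (t - s) (sliceDistribution (f s)) φ =
      ∫ x, extendForcing I f (s, x) * propagatorSchwartz (-s) (propagatorSchwartz t φ) x :=
  (ae_propagator_sliceDistribution hI.measurableSet hf t φ).mono fun _ hs hst =>
    hs (hI.uIcc_subset ht₀ ht (Set.uIoc_subset_uIcc hst))

theorem intervalIntegrable_propagator_sliceDistribution (hI : I.OrdConnected)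
    (hf : MemLp (Function.uncurry f) (4 / 3) ((volume.restrict I).prod volume)) {t₀ t : ℝ}
    (ht₀ : t₀ ∈ I) (ht : t ∈ I) (φ : 𝓢(Plane, ℂ)) :
    IntervalIntegrable (fun s => propagator (t - s) (sliceDistribution (f s)) φ) volume t₀ t := by
  refine (integrable_mul_propagatorSchwartz (memLp_extendForcing hI.measurableSet hf)
    (propagatorSchwartz t φ)).integral_prod_left.intervalIntegrable.congr_ae ?_
  rw [Filter.EventuallyEq, ae_restrict_iff' measurableSet_uIoc]
  filter_upwards [ae_uIoc_propagator_sliceDistribution hI hf ht₀ ht φ] with s hs hst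
  exact (hs hst).symm

theorem integral_propagator_sliceDistribution (hI : I.OrdConnected)
    (hf : MemLp (Function.uncurry f) (4 / 3) ((volume.restrict I).prod volume)) {t₀ t : ℝ}
    (ht₀ : t₀ ∈ I) (ht : t ∈ I) (φ : 𝓢(Plane, ℂ)) :
    ∫ s in t₀..t, propagator (t - s) (sliceDistribution (f s)) φ =
      pairing (memLp_extendForcing hI.measurableSet hf) t₀ t (propagatorSchwartz t φ) :=
  intervalIntegral.integral_congr_ae (ae_uIoc_propagator_sliceDistribution hI hf ht₀ ht φ)

/-- The backward evolution `P(t) = e^{-itΔ} u(t)` of the Duhamel solution `u`, where `D` is the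
backward evolution `∫_{t₀}^t e^{-isΔ} f(s) ds` of the forcing. -/
def duhamelProfile (t₀ : ℝ) (u₀ : L2) (D : ℝ → L2) (t : ℝ) : L2 :=
  propagatorL2 (-t₀) u₀ - Complex.I • D t

theorem toTemperedDistribution_duhamelProfile (hI : I.OrdConnected)
    (hf : MemLp (Function.uncurry f) (4 / 3) ((volume.restrict I).prod volume)) {t₀ t : ℝ}
    (ht₀ : t₀ ∈ I) (ht : t ∈ I) (u₀ : L2) {D : ℝ → L2}
    (hD : ∀ t φ, Lp.toTemperedDistribution (D t) φ =
      pairing (memLp_extendForcing hI.measurableSet hf) t₀ t φ) (φ : 𝓢(Plane, ℂ)) :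
    Lp.toTemperedDistribution (propagatorL2 t (duhamelProfile t₀ u₀ D t)) φ =
      propagator (t - t₀) (Lp.toTemperedDistribution u₀) φ -
        Complex.I * ∫ s in t₀..t, propagator (t - s) (sliceDistribution (f s)) φ := by
  have smul_I : ∀ g : L2, Lp.toTemperedDistribution (Complex.I • g) φ =
      Complex.I * Lp.toTemperedDistribution g φ := fun g =>
    DFunLike.congr_fun (map_smul (Lp.toTemperedDistributionCLM ℂ volume 2) Complex.I g) φ
  rw [duhamelProfile, map_sub, map_smul, propagatorL2_propagatorL2, ← sub_eq_add_neg,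
    toTemperedDistribution_sub, smul_I, toTemperedDistribution_propagatorL2,
    toTemperedDistribution_propagatorL2, propagator_apply t, hD,
    integral_propagator_sliceDistribution hI hf ht₀ ht]

theorem isDuhamel_iff (hI : I.OrdConnected)
    (hf : MemLp (Function.uncurry f) (4 / 3) ((volume.restrict I).prod volume)) {t₀ : ℝ}
    (ht₀ : t₀ ∈ I) (u₀ : L2) {D : ℝ → L2}
    (hD : ∀ t φ, Lp.toTemperedDistribution (D t) φ =
      pairing (memLp_extendForcing hI.measurableSet hf) t₀ t φ) (u : ℝ → L2) :
    IsDuhamel I t₀ u₀ f u ↔ ∀ t ∈ I, u t = propagatorL2 t (duhamelProfile t₀ u₀ D t) := by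
  refine forall₂_congr fun t ht => ?_
  have formula := toTemperedDistribution_duhamelProfile hI hf ht₀ ht u₀ hD
  exact ⟨fun h => toTemperedDistribution_injective fun φ => (h φ).2.trans (formula φ).symm,
    fun h φ => ⟨intervalIntegrable_propagator_sliceDistribution hI hf ht₀ ht φ, h ▸ formula φ⟩⟩

end Duhamel

section WeightedEstimate

variable {I : Set ℝ} {u P : ℝ → L2}

theorem eLpNorm_weighted_ae_eq (hI : MeasurableSet I) (hP : ∀ t, IsRotInvariant (P t))
    (hu : ∀ t ∈ I, u t = propagatorL2 t (P t)) :
    (fun t => eLpNorm (weighted u t) ∞ volume) =ᵐ[volume.restrict I]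
      fun t => weightedSup (propagatorL2 t (P t)) := by
  rw [Filter.EventuallyEq, ae_restrict_iff' hI]
  refine .of_forall fun t ht => ?_
  have rotInvariant : IsRotInvariant (u t) := hu t ht ▸ (hP t).propagatorL2 t
  rw [eLpNorm_top_weighted rotInvariant, hu t ht]

theorem aemeasurable_eLpNorm_weighted (hI : MeasurableSet I) (hP : ∀ t, IsRotInvariant (P t))
    (hu : ∀ t ∈ I, u t = propagatorL2 t (P t)) (hPc : Continuous P) :
    AEMeasurable (fun t => eLpNorm (weighted u t) ∞ volume) (volume.restrict I) :=
  (measurable_weightedSup_propagatorL2 hPc).aemeasurable.congr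
    (eLpNorm_weighted_ae_eq hI hP hu).symm

theorem mixedNorm_weighted_le (hI : MeasurableSet I) (hP : ∀ t, IsRotInvariant (P t))
    (hu : ∀ t ∈ I, u t = propagatorL2 t (P t)) :
    mixedNorm 4 ∞ I (weighted u) ≤
      eLpNorm (fun t => weightedSup (propagatorL2 t (P t))) 4 volume := by
  rw [mixedNorm, eLpNorm_congr_ae (eLpNorm_weighted_ae_eq hI hP hu)]
  exact eLpNorm_mono_measure _ Measure.restrict_le_self

theorem continuous_duhamelProfile (t₀ : ℝ) (u₀ : L2) {D : ℝ → L2} (hD : Continuous D) :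
    Continuous (duhamelProfile t₀ u₀ D) :=
  continuous_const.sub (hD.const_smul Complex.I)

theorem IsRotInvariant.duhamelProfile {u₀ : L2} (hu₀ : IsRotInvariant u₀) {D : ℝ → L2} {t : ℝ}
    (hD : IsRotInvariant (D t)) (t₀ : ℝ) : IsRotInvariant (duhamelProfile t₀ u₀ D t) :=
  (hu₀.propagatorL2 (-t₀)).sub (hD.const_smul Complex.I)

theorem eLpNorm_weightedSup_duhamelProfile_le (t₀ : ℝ) (u₀ : L2) {D : ℝ → L2}
    (hD : Continuous D) :
    eLpNorm (fun t => weightedSup (propagatorL2 t (duhamelProfile t₀ u₀ D t))) 4 volume ≤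
      homogeneousConst * ‖u₀‖ₑ +
        eLpNorm (fun t => weightedSup (propagatorL2 t (D t))) 4 volume := by
  have triangle : ∀ t, weightedSup (propagatorL2 t (duhamelProfile t₀ u₀ D t)) ≤
      weightedSup (propagatorL2 t (propagatorL2 (-t₀) u₀)) +
        weightedSup (propagatorL2 t (D t)) := fun t => by
    rw [duhamelProfile, sub_eq_add_neg, ← neg_smul, map_add, map_smul]
    refine (weightedSup_add_le _ _).trans_eq ?_
    rw [weightedSup_smul, enorm_neg, ← ofReal_norm, Complex.norm_I, ENNReal.ofReal_one, one_mul]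
  refine (eLpNorm_mono_enorm
    (g := (fun t => weightedSup (propagatorL2 t (propagatorL2 (-t₀) u₀))) +
      fun t => weightedSup (propagatorL2 t (D t))) triangle).trans ((eLpNorm_add_le
      (measurable_weightedSup_propagatorL2 continuous_const).aestronglyMeasurable
      (measurable_weightedSup_propagatorL2 hD).aestronglyMeasurable (by norm_num)).trans ?_)
  gcongr
  refine (eLpNorm_weightedSup_propagatorL2_le _).trans_eq ?_
  rw [← ofReal_norm, LinearIsometry.norm_map, ofReal_norm]

/-- A constant for which the weighted endpoint Strichartz estimate holds: the first summand
accounts for the initial datum, the second for the forcing. -/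
def strichartzConst : ℝ≥0 :=
  homogeneousConst * (1 + (chainingConst 4 (3 / 4)).toNNReal)

theorem eLpNorm_weightedSup_duhamelProfile_le_strichartzConst {G : ℝ × Plane → ℂ}
    (hG : MemLp G (4 / 3) volume) {t₀ : ℝ} (u₀ : L2) {D : ℝ → L2} (hDt₀ : D t₀ = 0)
    (hD : ∀ t s, ‖D t - D s‖ₑ ≤ ‖forcingMass G t - forcingMass G s‖ₑ ^ (3 / 4 : ℝ)) :
    eLpNorm (fun t => weightedSup (propagatorL2 t (duhamelProfile t₀ u₀ D t))) 4 volume ≤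
      strichartzConst * (‖u₀‖ₑ + eLpNorm G (4 / 3) volume) := by
  have chaining_ne_top : chainingConst 4 (3 / 4) ≠ ∞ :=
    chainingConst_ne_top (by norm_num)
  refine (eLpNorm_weightedSup_duhamelProfile_le t₀ u₀
    (continuous_of_enorm_sub_le_forcingMass hG hD)).trans
    ((add_le_add_right (eLpNorm_weightedSup_forcing_le hG hDt₀ hD) _).trans ?_)
  rw [strichartzConst, ENNReal.coe_mul, ENNReal.coe_add, ENNReal.coe_one,
    ENNReal.coe_toNNReal chaining_ne_top, mul_left_comm, mul_assoc, ← mul_add]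
  gcongr
  rw [add_mul, one_mul, mul_add]
  exact add_le_add le_self_add le_add_self

end WeightedEstimate

end WeightedStrichartz

end

theorem mainTheorem10 :
    ∃ C : ℝ≥0, ∀ (I : Set ℝ), I.OrdConnected → ∀ t₀ ∈ I,
      ∀ u₀ : Lp ℂ 2 (volume : Measure WeightedStrichartz.Plane),
        WeightedStrichartz.IsRadial u₀ →
      ∀ f : ℝ → WeightedStrichartz.Plane → ℂ,
        MemLp (Function.uncurry f) (4 / 3) ((volume.restrict I).prod volume) →
        (∀ᵐ t ∂(volume.restrict I), WeightedStrichartz.IsRadial (f t)) →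
      (∃ u, WeightedStrichartz.IsDuhamel I t₀ u₀ f u) ∧
      ∀ u, WeightedStrichartz.IsDuhamel I t₀ u₀ f u →
        (∀ v, WeightedStrichartz.IsDuhamel I t₀ u₀ f v → Set.EqOn v u I) ∧
        AEMeasurable (fun t => eLpNorm (WeightedStrichartz.weighted u t) ⊤ volume)
          (volume.restrict I) ∧
        WeightedStrichartz.mixedNorm 4 ⊤ I (WeightedStrichartz.weighted u) ≤
          C * (‖u₀‖ₑ +
            eLpNorm (Function.uncurry f) (4 / 3) ((volume.restrict I).prod volume)) := by
  open WeightedStrichartz in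
  refine ⟨strichartzConst, fun I hI t₀ ht₀ u₀ hu₀ f hf hrad => ?_⟩
  have hG := memLp_extendForcing hI.measurableSet hf
  obtain ⟨D, D_t₀, D_apply, D_holder⟩ := exists_forcing hG t₀
  have continuous_profile : Continuous (duhamelProfile t₀ u₀ D) :=
    continuous_duhamelProfile t₀ u₀ (continuous_of_enorm_sub_le_forcingMass hG D_holder)
  have rotInvariant_profile : ∀ t, IsRotInvariant (duhamelProfile t₀ u₀ D t) := fun t =>
    hu₀.isRotInvariant.duhamelProfile (isRotInvariant_of_pairing hG
      (isRotInvariant_extendForcing hI.measurableSet hrad) (D_apply t)) t₀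
  have duhamel_iff := isDuhamel_iff hI hf ht₀ u₀ D_apply
  refine ⟨⟨_, (duhamel_iff _).2 fun _ _ => rfl⟩, fun u hu => ?_⟩
  have u_eq := (duhamel_iff u).1 hu
  refine ⟨fun v hv t ht => ((duhamel_iff v).1 hv t ht).trans (u_eq t ht).symm,
    aemeasurable_eLpNorm_weighted hI.measurableSet rotInvariant_profile u_eq continuous_profile, ?_⟩
  rw [← eLpNorm_extendForcing hI.measurableSet]
  exact (mixedNorm_weighted_le hI.measurableSet rotInvariant_profile u_eq).trans
    (eLpNorm_weightedSup_duhamelProfile_le_strichartzConst hG u₀ D_t₀ D_holder)
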